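/- **The scheme.** Let $\Delta x,\Delta t>0$, $\lambda=\Delta x/\Delta t$, and let $v_0,\dots,v_{18}$ be the vectors $\lambda e$, where $e\in\{-1,0,1\}^3$ has at most two nonzero coordinates. For $v=(x,y,z)$ and $n=x^2+y^2+z^2$, the moments are $m_k=\sum_j M_{kj}f_j$, $M_{kj}=p_k(v_j)$, with $p_0=1$; $p_1,p_2,p_3=x,y,z$; $p_4=19n-30\lambda^2$ ($\varepsilon$); $p_5=2x^2-y^2-z^2$ ($XX$), $p_6=y^2-z^2$ ($WW$); $p_7,p_8,p_9=xy,yz,zx$ ($XY,YZ,ZX$); $p_{10},p_{11},p_{12}=(5n-9\lambda^2)x,\,(5n-9\lambda^2)y,\,(5n-9\lambda^2)z$ ($q$); $p_{13}=\frac12(21n^2-53\lambda^2n+24\lambda^4)$ ($\varepsilon_2$); $p_{14}=(3n-5\lambda^2)p_5$ ($XX_e$), $p_{15}=(3n-5\lambda^2)p_6$ ($WW_e$); $p_{16},p_{17},p_{18}=x(y^2-z^2),\,y(z^2-x^2),\,z(x^2-y^2)$. The moments $W=(m_0,\dots,m_3)=(\rho,J)$ are conserved. For $k\ge4$, $m_k^*=m_k+s_k(m_k^{eq}-m_k)$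 with $s_k\ne0$ and $m_k^{eq}$ a linear function of $W$; then $f_j(x,t+\Delta t)=f_j^*(x-v_j\Delta t,t)$ with $Mf^*=m^*$. Put $\sigma_k=\frac1{s_k}-\frac12$. **Equivalent equations.** Write $J_0$ for the relaxation matrix ($m^*=J_0m$), $Y=(m_4,\dots,m_{18})$, $Y^{eq}=EW$, $S=\mathrm{diag}(s_4,\dots,s_{18})$, and let $\begin{pmatrix}A_n&B_n\\C_n&D_n\end{pmatrix}=\frac1{n!}M\,\mathrm{diag}_j\big((-v_j\cdot\nabla)^n\big)M^{-1}J_0$. The formal expansions $\partial_tW=\sum_{\ell\ge1}\Delta t^{\ell-1}\alpha_\ell W$, $Y=\sum_{\ell\ge0}\Delta t^\ell\beta_\ell W$ are defined by $\beta_0=E$ and $$\alpha_{k+1}=A_{k+1}+\sum_{j=1}^{k+1}B_j\beta_{k+1-j}-\sum_{j=2}^{k+1}\tfrac1{j!}\Gamma^j_{k+1},\qquad S\beta_{k+1}=C_{k+1}+\sum_{j=1}^{k+1}D_j\beta_{k+1-j}-\sum_{j=1}^{k+1}\tfrac1{j!}K^j_{k+1},$$ where $\Gamma^j_m$, $K^j_m$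 are the coefficients of $t^m$ in $(\sum_{\ell\ge1}t^\ell\alpha_\ell)^j$ and in $(\sum_{i\ge0}t^i\beta_i)(\sum_{\ell\ge1}t^\ell\alpha_\ell)^j$. The equivalent equation at order $\ell$ is $\partial_tW-\sum_{j=1}^\ell\Delta t^{j-1}\alpha_jW=0$. The scheme is *invariant by rotation at order $\ell$* if this equation has the form $$\partial_t\rho+\sum_k(a_k\Delta^k\rho+b_k\,\mathrm{div}\,\Delta^kJ)=0,\qquad \partial_tJ+\sum_k(d_k\nabla\Delta^k\rho+g_k\Delta^kJ+e_k\nabla\mathrm{div}\,\Delta^kJ+f_k\,\mathrm{curl}\,\Delta^kJ)=0$$ with finitely many real coefficients. **Theorem.** Let $\alpha\in\mathbb R$ and $c_0^2=\frac{\alpha+30}{57}\lambda^2$. 1. (Order 1.) Consider the condition (1): $\varepsilon^{eq}=\alpha\lambda^2\rho$, $XX^{eq}=WW^{eq}=XY^{eq}=YZ^{eq}=ZX^{eq}=0$. The scheme is invariant by rotation at order 1 if and only if (1) holds for some real $\alpha$. If (1) holds, the equivalent equation at order 1 is $\partial_t\rho+\mathrm{div}J=0$, $\partial_tJ+c_0^2\nabla\rho=0$.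 2. (Order 2.) Consider the conditions (2): (1), $\sigma_5=\sigma_6$, $\sigma_7=\sigma_8=\sigma_9$, $\sigma_5+2\sigma_7\neq0$, $q^{eq}=2\,\frac{3\sigma_5-4\sigma_7}{\sigma_5+2\sigma_7}\lambda^2J$, $m_{16}^{eq}=m_{17}^{eq}=m_{18}^{eq}=0$. If (2) holds, the scheme is invariant by rotation at order 2, with equation $\partial_t\rho+\mathrm{div}J=0$, $\partial_tJ+c_0^2\nabla\rho-\mu\Delta J-\zeta\nabla\mathrm{div}J=0$, where $$\mu=\frac{\sigma_5\sigma_7}{\sigma_5+2\sigma_7}\lambda\Delta x,\qquad \zeta=\frac{\lambda\Delta x}{57(\sigma_5+2\sigma_7)}\big(27\sigma_4\sigma_5+19\sigma_5\sigma_7-22\sigma_4\sigma_7-\alpha\sigma_4\sigma_5-2\alpha\sigma_4\sigma_7\big).$$ 3. (Order 3.) Suppose that (2) holds, $XX_e^{eq}=WW_e^{eq}=0$, $\sigma_5=\sigma_7$, and that one of the following holds: (3a) $\varepsilon_2^{eq}=-\frac{42+9\alpha}{19}\lambda^4\rho$; (3b) $\varepsilon_2^{eq}=\beta\lambda^4\rho$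 for a real $\beta$, $\sigma_{10}=\sigma_{11}=\sigma_{12}=\frac1{12\sigma_5}$, $\sigma_{16}=\frac1{8\sigma_5}$, $\sigma_{17}=\frac1{4\sigma_5}$, $\sigma_{18}=\frac1{12\sigma_5}$. Then $q^{eq}=-\frac23\lambda^2J$ and the scheme is invariant by rotation at order 3, with equation $\partial_t\rho+\mathrm{div}J+\xi\Delta\mathrm{div}J=0$, $\partial_tJ+c_0^2\nabla\rho-\mu\Delta J-\zeta\nabla\mathrm{div}J+\chi\nabla\Delta\rho=0$, where $$\mu=\tfrac13\sigma_5\lambda\Delta x,\quad \zeta=\tfrac{\lambda\Delta x}{171}(5\sigma_4+19\sigma_5-3\alpha\sigma_4),\quad \xi=\tfrac{\Delta x^2}{684}(\alpha-27),\quad 3\zeta-\mu=\tfrac{\lambda\sigma_4\Delta x}{57}(5-3\alpha),$$ and, in case (3a), $$\chi=\tfrac{\lambda^2\Delta x^2}{19494}(\alpha+30)\big(27+6\alpha\sigma_4^2-10\sigma_4^2-152\sigma_5^2-\alpha\big),$$ in case (3b), $$\chi=\tfrac{\lambda^2\Delta x^2}{409374\,\sigma_5}\big(16212\sigma_5+126\alpha^2\sigma_4^2\sigma_5+3570\alpha\sigma_4^2\sigma_5-6300\sigma_4^2\sigma_5-21\alpha^2\sigma_5-234\alpha\sigma_5+361\beta\sigma_4+171\alpha\sigma_4+798\sigma_4-3192\alpha\sigma_5^3-95760\sigma_5^3-361\beta\sigma_5\big).$$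 4. (Order 4.) Consider the conditions (4): $\sigma_4=\sigma_5$, $\sigma_{10}=\sigma_{11}=\sigma_{12}=\sigma_{16}=\sigma_{17}=\sigma_{18}=\frac1{6\sigma_5}$, $\sigma_{14}=\sigma_{15}=\sigma_5$. *Sufficiency.* If (2), $XX_e^{eq}=WW_e^{eq}=0$, $\sigma_5=\sigma_7$, (3a), (4) and $\sigma_{13}=\sigma_5$ hold, the scheme is invariant by rotation at order 4, with equation $\partial_t\rho+\mathrm{div}J+\xi\Delta\mathrm{div}J+\eta\Delta^2\rho=0$, $\partial_tJ+c_0^2\nabla\rho-\mu\Delta J-\zeta\nabla\mathrm{div}J+\chi\nabla\Delta\rho+\mu_4\Delta^2J+\zeta_4\nabla\mathrm{div}\Delta J=0$, where $\mu,\zeta,\xi,\chi$ are as in 3 (case (3a)), so that $3\zeta-\mu=\frac{5-3\alpha}{19}\mu$, and $$\eta=\tfrac{(\alpha+30)(\alpha-27)}{38988}\sigma_5\lambda\Delta x^3,\qquad \mu_4=\tfrac{12\sigma_5^2-1}{108}\sigma_5\lambda\Delta x^3,$$ $$\zeta_4=\tfrac{\sigma_5\lambda\Delta x^3}{38988}\big(2062+45\alpha-4\alpha^2-5304\sigma_5^2-612\alpha\sigma_5^2+24\alpha^2\sigma_5^2\big).$$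 *Necessity.* If $0<s_k<2$ for all $k\ge4$, (2) holds, $\varepsilon_2^{eq}=\beta\lambda^4\rho$ for some real $\beta$, $XX_e^{eq}=WW_e^{eq}=0$, and the scheme is invariant by rotation at order 4, then $\sigma_5=\sigma_7$, (3a) and (4) hold, and also $\sigma_{13}=\sigma_5$ unless $27\alpha+88=0$. -/

import Mathlib

noncomputable section

namespace LBM

/-- Linear differential operators in three space variables with constant real coefficients:
the polynomial variable `X i` stands for the partial derivative `∂/∂x_i`. -/
abbrev DOp := MvPolynomial (Fin 3) ℝ

/-- The partial derivative in the direction `i`. -/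
def pd (i : Fin 3) : DOp := MvPolynomial.X i

/-- The Laplace operator. -/
def lap : DOp := ∑ i, pd i ^ 2

/-- `(curl J)_i = ∑_k (curlOp i k) J_k`. -/
def curlOp : Matrix (Fin 3) (Fin 3) DOp :=
  !![0, -pd 2, pd 1;
     pd 2, 0, -pd 0;
     -pd 1, pd 0, 0]

/-- The operator `P` acting on `W = (ρ, J)` whose equation `∂_t W + P W = 0` is
`∂_t ρ + a ρ + b div J = 0`,
`∂_t J + d ∇ρ + m J + e ∇ div J + f curl J = 0`,
where `a, b, d, m, e, f` are scalar differential operators. -/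
def acousticOp (a b d m e f : DOp) : Matrix (Fin 4) (Fin 4) DOp :=
  Matrix.of fun i j =>
    Fin.cases (Fin.cases a (fun l => b * pd l) j)
      (fun k => Fin.cases (d * pd k)
        (fun l => (if k = l then m else 0) + e * pd k * pd l + f * curlOp k l) j) i

/-- The eight fourth order coefficients: the operator `P` for which `∂_t W + P W = 0` is
`∂_t ρ + div J + ξ Δ div J + η Δ² ρ = 0`,
`∂_t J + c0sq ∇ρ - μ ΔJ - ζ ∇ div J + χ ∇Δρ + μ4 Δ² J + ζ4 ∇ div ΔJ = 0`. -/
def isoOp4 (c0sq μ ζ ξ χ η μ4 ζ4 : ℝ) : Matrix (Fin 4) (Fin 4) DOp :=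
  acousticOp (η • lap ^ 2) (1 + ξ • lap) (MvPolynomial.C c0sq + χ • lap)
    (-(μ • lap) + μ4 • lap ^ 2) (-MvPolynomial.C ζ + ζ4 • lap) 0

/-- `∂_t ρ + div J + ξ Δ div J = 0`,
`∂_t J + c0sq ∇ρ - μ ΔJ - ζ ∇ div J + χ ∇Δρ = 0`. -/
def isoOp3 (c0sq μ ζ ξ χ : ℝ) : Matrix (Fin 4) (Fin 4) DOp :=
  isoOp4 c0sq μ ζ ξ χ 0 0 0

/-- `∂_t ρ + div J = 0`, `∂_t J + c0sq ∇ρ - μ ΔJ - ζ ∇ div J = 0`. -/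
def isoOp2 (c0sq μ ζ : ℝ) : Matrix (Fin 4) (Fin 4) DOp := isoOp3 c0sq μ ζ 0 0

/-- `∂_t ρ + div J = 0`, `∂_t J + c0sq ∇ρ = 0`. -/
def isoOp1 (c0sq : ℝ) : Matrix (Fin 4) (Fin 4) DOp := isoOp2 c0sq 0 0

/-- The general form of a rotation invariant linear acoustic-type operator in dimension three:
`∂_t ρ + ∑_k (a_k Δ^k ρ + b_k div Δ^k J) = 0`,
`∂_t J + ∑_k (d_k ∇Δ^k ρ + m_k Δ^k J + e_k ∇ div Δ^k J + f_k curl Δ^k J) = 0`,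
with finitely many real coefficients, which are recorded as polynomials evaluated at `Δ`. -/
def IsRotationInvariantOp (P : Matrix (Fin 4) (Fin 4) DOp) : Prop :=
  ∃ a b d m e f : Polynomial ℝ,
    P = acousticOp (Polynomial.aeval lap a) (Polynomial.aeval lap b) (Polynomial.aeval lap d)
      (Polynomial.aeval lap m) (Polynomial.aeval lap e) (Polynomial.aeval lap f)

/-- The nineteen dimensionless D3Q19 velocities. -/
def dir : Fin 19 → Fin 3 → ℝ :=
  ![![0, 0, 0],
    ![1, 0, 0], ![-1, 0, 0], ![0, 1, 0], ![0, -1, 0], ![0, 0, 1], ![0, 0, -1],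
    ![1, 1, 0], ![1, -1, 0], ![-1, 1, 0], ![-1, -1, 0],
    ![0, 1, 1], ![0, 1, -1], ![0, -1, 1], ![0, -1, -1],
    ![1, 0, 1], ![-1, 0, 1], ![1, 0, -1], ![-1, 0, -1]]

/-- The D3Q19 moment polynomials `p_k`, for the reference velocity `lam`, in the order
`1; X, Y, Z; ε; XX, WW; XY, YZ, ZX; q_x, q_y, q_z; ε₂; XX_e, WW_e;` and the three
antisymmetric moments of order 3. -/
def momentPoly (lam : ℝ) (v : Fin 3 → ℝ) : Fin 19 → ℝ :=
  let x := v 0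
  let y := v 1
  let z := v 2
  let n := x ^ 2 + y ^ 2 + z ^ 2
  ![1,
    x, y, z,
    19 * n - 30 * lam ^ 2,
    2 * x ^ 2 - y ^ 2 - z ^ 2, y ^ 2 - z ^ 2,
    x * y, y * z, z * x,
    (5 * n - 9 * lam ^ 2) * x, (5 * n - 9 * lam ^ 2) * y, (5 * n - 9 * lam ^ 2) * z,
    (21 * n ^ 2 - 53 * lam ^ 2 * n + 24 * lam ^ 4) / 2,
    (3 * n - 5 * lam ^ 2) * (2 * x ^ 2 - y ^ 2 - z ^ 2), (3 * n - 5 * lam ^ 2) * (y ^ 2 - z ^ 2),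
    x * (y ^ 2 - z ^ 2), y * (z ^ 2 - x ^ 2), z * (x ^ 2 - y ^ 2)]

/-- A linear multiple relaxation time D3Q19 scheme with conserved moments `m_0, …, m_3`
(`W = (ρ, J_x, J_y, J_z)`).  For `k ≥ 4`, `s k` is the relaxation coefficient of the moment
`m_k`, and `meq k` is the row of coefficients of its equilibrium,
`m_k^eq = ∑ i, meq k i * W i`.  The values of `s` and `meq` at `k < 4` are not used. -/
structure D3Q19 where
  dx : ℝ
  dt : ℝ
  dx_pos : 0 < dx
  dt_pos : 0 < dt
  s : Fin 19 → ℝ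
  meq : Fin 19 → Fin 4 → ℝ
  s_ne_zero : ∀ k, 4 ≤ k → s k ≠ 0

namespace D3Q19

variable (D : D3Q19)

/-- The reference numerical velocity `λ = Δx / Δt`. -/
def lam : ℝ := D.dx / D.dt

/-- Hénon's parameters. -/
def sigma (k : Fin 19) : ℝ := 1 / D.s k - 1 / 2

/-- The stability condition `0 < s_k < 2` on the relaxation coefficients. -/
def Stable : Prop := ∀ k, 4 ≤ k → 0 < D.s k ∧ D.s k < 2

/-- The discrete velocities `v_j`. -/
def vel (j : Fin 19) : Fin 3 → ℝ := fun a => D.lam * dir j a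

/-- The matrix of moments, `m = M f`, `M_{kj} = p_k (v_j)`. -/
def M : Matrix (Fin 19) (Fin 19) ℝ :=
  Matrix.of fun k j => momentPoly D.lam (D.vel j) k

/-- Splitting of the moments into the four conserved and the fifteen other ones. -/
def split : Fin 4 ⊕ Fin 15 ≃ Fin 19 := finSumFinEquiv

/-- The matrix of equilibrium coefficients. -/
def E : Matrix (Fin 15) (Fin 4) ℝ := Matrix.of fun l i => D.meq (split (Sum.inr l)) i

/-- The diagonal matrix of relaxation coefficients. -/
def S : Matrix (Fin 15) (Fin 15) ℝ := Matrix.diagonal fun l => D.s (split (Sum.inr l))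

/-- The relaxation matrix: `m* = J0 m`. -/
def J0 : Matrix (Fin 4 ⊕ Fin 15) (Fin 4 ⊕ Fin 15) ℝ :=
  Matrix.fromBlocks 1 0 (D.S * D.E) (1 - D.S)

/-- The matrix of differential operators of order `n`
`1/n! ∑_{j,ℓ} M_{kj} (M⁻¹)_{jℓ} (-∑_a v_j^a ∂_a)^n (J0)_{ℓp}`,
the coefficient of `Δt ^ n` in the Taylor expansion of one iteration (relaxation followed by
`f_j(x, t + Δt) = f_j*(x - v_j Δt, t)`) of the scheme. -/
def taylor (n : ℕ) : Matrix (Fin 4 ⊕ Fin 15) (Fin 4 ⊕ Fin 15) DOp :=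
  Matrix.of fun k p =>
    (1 / (n.factorial : ℝ)) • ∑ j, ∑ l,
      (D.M (split k) j * D.M⁻¹ j (split l) * D.J0 l p) •
        (-∑ a, D.vel j a • pd a) ^ n

def A (n : ℕ) : Matrix (Fin 4) (Fin 4) DOp := (D.taylor n).toBlocks₁₁
def B (n : ℕ) : Matrix (Fin 4) (Fin 15) DOp := (D.taylor n).toBlocks₁₂
def C (n : ℕ) : Matrix (Fin 15) (Fin 4) DOp := (D.taylor n).toBlocks₂₁
def Dm (n : ℕ) : Matrix (Fin 15) (Fin 15) DOp := (D.taylor n).toBlocks₂₂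

/-- `gam α j m` is the coefficient of `t ^ m` in `(∑_ℓ t ^ ℓ α_ℓ) ^ j`. -/
def gam (α : ℕ → Matrix (Fin 4) (Fin 4) DOp) : ℕ → ℕ → Matrix (Fin 4) (Fin 4) DOp
  | 0, m => if m = 0 then 1 else 0
  | j + 1, m => ∑ p ∈ Finset.HasAntidiagonal.antidiagonal m, α p.1 * gam α j p.2

/-- `kap α β j m` is the coefficient of `t ^ m` in `(∑_i t ^ i β_i) (∑_ℓ t ^ ℓ α_ℓ) ^ j`. -/
def kap (α : ℕ → Matrix (Fin 4) (Fin 4) DOp) (β : ℕ → Matrix (Fin 15) (Fin 4) DOp)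
    (j m : ℕ) : Matrix (Fin 15) (Fin 4) DOp :=
  ∑ p ∈ Finset.HasAntidiagonal.antidiagonal m, β p.1 * gam α j p.2

/-- `α_{k+1}` from the previous coefficients:
`A_{k+1} + ∑_{j=1}^{k+1} B_j β_{k+1-j} - ∑_{j=2}^{k+1} 1/j! Γ^j_{k+1}`. -/
def nextAlpha (k : ℕ) (α : ℕ → Matrix (Fin 4) (Fin 4) DOp)
    (β : ℕ → Matrix (Fin 15) (Fin 4) DOp) : Matrix (Fin 4) (Fin 4) DOp :=
  D.A (k + 1) + ∑ j ∈ Finset.Icc 1 (k + 1), D.B j * β (k + 1 - j)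
    - ∑ j ∈ Finset.Icc 2 (k + 1), (1 / (j.factorial : ℝ)) • gam α j (k + 1)

/-- `β_{k+1}` from the previous coefficients (`α_{k+1}` included):
`S⁻¹ (C_{k+1} + ∑_{j=1}^{k+1} D_j β_{k+1-j} - ∑_{j=1}^{k+1} 1/j! K^j_{k+1})`. -/
def nextBeta (k : ℕ) (α : ℕ → Matrix (Fin 4) (Fin 4) DOp)
    (β : ℕ → Matrix (Fin 15) (Fin 4) DOp) : Matrix (Fin 15) (Fin 4) DOp :=
  (D.S⁻¹).map MvPolynomial.C *
    (D.C (k + 1) + ∑ j ∈ Finset.Icc 1 (k + 1), D.Dm j * β (k + 1 - j)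
      - ∑ j ∈ Finset.Icc 1 (k + 1), (1 / (j.factorial : ℝ)) • kap α β j (k + 1))

/-- The coefficients `α_1, …, α_k` and `β_0 = E, β_1, …, β_k` of the formal expansions
`∂_t W = ∑_ℓ Δt ^ (ℓ-1) α_ℓ W` and `Y = ∑_ℓ Δt ^ ℓ β_ℓ W` (the other entries are `0`). -/
def expansion : ℕ → (ℕ → Matrix (Fin 4) (Fin 4) DOp) × (ℕ → Matrix (Fin 15) (Fin 4) DOp)
  | 0 => (fun _ => 0, fun m => if m = 0 then D.E.map MvPolynomial.C else 0)
  | k + 1 =>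
    let p := expansion k
    let α := Function.update p.1 (k + 1) (D.nextAlpha k p.1 p.2)
    (α, Function.update p.2 (k + 1) (D.nextBeta k α p.2))

/-- The space derivation operator `α_ℓ` of order `ℓ`. -/
def alpha (l : ℕ) : Matrix (Fin 4) (Fin 4) DOp := (D.expansion l).1 l

/-- `∂_t W + P W = 0` is the equivalent partial differential equation
`∂_t W - ∑_{j=1}^ℓ Δt ^ (j-1) α_j W = 0` of the scheme, truncated at the order `l`. -/
def equivOp (l : ℕ) : Matrix (Fin 4) (Fin 4) DOp :=
  -∑ j ∈ Finset.Icc 1 l, D.dt ^ (j - 1) • D.alpha j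

/-- The scheme is invariant by rotation at order `l`. -/
def RotationInvariantAtOrder (l : ℕ) : Prop := IsRotationInvariantOp (D.equivOp l)

/-- `m_k^eq = c ρ`. -/
def EqRho (k : Fin 19) (c : ℝ) : Prop := D.meq k = Pi.single 0 c

/-- `q^eq = c J`. -/
def EqHeatFlux (c : ℝ) : Prop :=
  D.meq 10 = Pi.single 1 c ∧ D.meq 11 = Pi.single 2 c ∧ D.meq 12 = Pi.single 3 c

/-- `ε^eq = a λ² ρ` and `XX^eq = WW^eq = XY^eq = YZ^eq = ZX^eq = 0`. -/
def Order1Cond (a : ℝ) : Prop :=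
  D.EqRho 4 (a * D.lam ^ 2) ∧
    D.meq 5 = 0 ∧ D.meq 6 = 0 ∧ D.meq 7 = 0 ∧ D.meq 8 = 0 ∧ D.meq 9 = 0

/-- The first order conditions, `q^eq = 2 (3 σ₅ - 4 σ₇) / (σ₅ + 2 σ₇) λ² J`, a zero equilibrium
for the three antisymmetric moments, `σ₅ = σ₆` and `σ₇ = σ₈ = σ₉`. -/
def Order2Cond (a : ℝ) : Prop :=
  D.Order1Cond a ∧
    D.sigma 5 + 2 * D.sigma 7 ≠ 0 ∧
    D.EqHeatFlux
      (2 * ((3 * D.sigma 5 - 4 * D.sigma 7) / (D.sigma 5 + 2 * D.sigma 7)) * D.lam ^ 2) ∧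
    D.meq 16 = 0 ∧ D.meq 17 = 0 ∧ D.meq 18 = 0 ∧
    D.sigma 5 = D.sigma 6 ∧ D.sigma 7 = D.sigma 8 ∧ D.sigma 8 = D.sigma 9

/-- First family: the second order conditions, `ε₂^eq = -(42 + 9 a) / 19 λ⁴ ρ`,
`XX_e^eq = WW_e^eq = 0` and `σ₅ = σ₇`. -/
def Order3CondA (a : ℝ) : Prop :=
  D.Order2Cond a ∧ D.EqRho 13 (-((42 + 9 * a) / 19) * D.lam ^ 4) ∧
    D.meq 14 = 0 ∧ D.meq 15 = 0 ∧ D.sigma 5 = D.sigma 7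

/-- Second family, with a free parameter `b`. -/
def Order3CondB (a b : ℝ) : Prop :=
  D.Order2Cond a ∧ D.EqRho 13 (b * D.lam ^ 4) ∧
    D.meq 14 = 0 ∧ D.meq 15 = 0 ∧ D.sigma 5 = D.sigma 7 ∧
    D.sigma 10 = 1 / (12 * D.sigma 5) ∧ D.sigma 11 = 1 / (12 * D.sigma 5) ∧
    D.sigma 12 = 1 / (12 * D.sigma 5) ∧
    D.sigma 16 = 1 / (8 * D.sigma 5) ∧ D.sigma 17 = 1 / (4 * D.sigma 5) ∧
    D.sigma 18 = 1 / (12 * D.sigma 5)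

/-- The relations between Hénon's parameters at fourth order, apart from `σ₁₃ = σ₅`. -/
def Order4Sigmas : Prop :=
  D.sigma 4 = D.sigma 5 ∧
    D.sigma 10 = 1 / (6 * D.sigma 5) ∧ D.sigma 11 = 1 / (6 * D.sigma 5) ∧
    D.sigma 12 = 1 / (6 * D.sigma 5) ∧
    D.sigma 14 = D.sigma 5 ∧ D.sigma 15 = D.sigma 5 ∧
    D.sigma 16 = 1 / (6 * D.sigma 5) ∧ D.sigma 17 = 1 / (6 * D.sigma 5) ∧
    D.sigma 18 = 1 / (6 * D.sigma 5)

end D3Q19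

end LBM

end

/-! Everything is done on Fourier symbols: a derivative becomes a real vector `ξ`, and an operator
identity becomes a matrix identity for every `ξ`. Let `Λ` be the symbol of `-v·∇` acting on moments,
`b = (1; β)`, and `α = ∑ Δt^(l-1) α_l`. The recursions for `α` and `β` are the conserved and the
relaxed rows of one identity between formal series, `e^(ΔtΛ) J0 b = b e^(Δtα)`.

Put `h = J0 b - b` and `g = b + h/2`. Left multiplication by `Λ` and right multiplication by `α`
commute, so with `δX = Xα - ΛX` the identity reads `h = 2 tanh(Δt δ/2) g = Δt δg - (Δt δ)³g/12 + …`.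
The next term is quintic, so up to order four `-1/12` is the only correction. On relaxed moments of
positive order relaxation becomes `g = -σ h`; on conserved ones `h = 0`, which yields `α_l` from
lower orders (`act_one` to `act_four`). The Hénon parameters thus enter polynomially. The explicit
form of multiplication by `v·ξ` in moment coordinates (`flux`) then makes every coefficient
computable.

Sufficiency is this computation. At order 2 the coefficient of `q^eq` removes the cubic anisotropy
`ξ_k² J_k`. At order 3 let `κ` measure the deviation of `ε₂^eq` from (3a): `κ` carries the whole
remaining anisotropy, so either `κ = 0` or the relation `12 σ₅ σ₁₀ = 1` (and likewise for `σ₁₁`,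
`σ₁₂`) cancels it. At order 4 the second order moments must relax coherently with the third order
ones, with product `σ₅ σ₁₀ = 1/6`.

For necessity, `α_l` is homogeneous of degree `l`, so invariance of the truncated equation passes to
each `α_l` (`act_of_rotationInvariant`), and it suffices to test a few `ξ` and `W`. The mass row of
`α_3` forces `q^eq = -2/3 λ² J`, hence `σ₅ = σ₇`. The mass row of `α_4` gives `(σ₁₀ + σ₁₁) κ = 0`.
The momentum rows of `α_4` give polynomial relations between the `σ_k`, which positivity makes
solvable. The exception `27a + 88 = 0` arises because this is, up to a factor, the first order jump
of `ε₂`: if it vanishes, `σ₁₃` drops out. -/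

namespace LBM

open Matrix

/-! ### Symmetrised form of the formal expansion -/

section Symmetrised

variable {N P : Type*} [Fintype N] [Fintype P]

theorem symm_one {L : Matrix N N ℝ} {g0 g1 h1 : Matrix N P ℝ} {a1 : Matrix P P ℝ}
    (H : (g1 + (1 / 2 : ℝ) • h1) + L * g0 = (g1 - (1 / 2 : ℝ) • h1) + g0 * a1) :
    h1 = g0 * a1 - L * g0 := by
  have : h1 = (g1 + (1 / 2 : ℝ) • h1) - (g1 - (1 / 2 : ℝ) • h1) := by module
  rw [this, eq_sub_of_add_eq H]
  module

theorem symm_two {L : Matrix N N ℝ} {g0 g1 h1 g2 h2 : Matrix N P ℝ} {a1 a2 : Matrix P P ℝ}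
    (h1_eq : h1 = g0 * a1 - L * g0)
    (H : (g2 + (1 / 2 : ℝ) • h2) + L * (g1 + (1 / 2 : ℝ) • h1) + (1 / 2 : ℝ) • (L * (L * g0)) =
      (g2 - (1 / 2 : ℝ) • h2) + (g1 - (1 / 2 : ℝ) • h1) * a1
        + g0 * (a2 + (1 / 2 : ℝ) • (a1 * a1))) :
    h2 = g1 * a1 - L * g1 + g0 * a2 := by
  have : h2 = (g2 + (1 / 2 : ℝ) • h2) - (g2 - (1 / 2 : ℝ) • h2) := by module
  rw [this, eq_sub_of_add_eq (eq_sub_of_add_eq H), h1_eq]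
  simp only [Matrix.mul_add, Matrix.mul_sub, Matrix.sub_mul, Matrix.smul_mul,
    Matrix.mul_smul, Matrix.mul_assoc]
  module

/-- The operator `X ↦ X a - L X`. -/
def com (L : Matrix N N ℝ) (a : Matrix P P ℝ) (X : Matrix N P ℝ) : Matrix N P ℝ := X * a - L * X

/-- The hypothesis `H` is the third order coefficient of `e^L (g + h/2) = (g - h/2) e^a`. This is
the first order at which the cubic term of `2 tanh(δ/2)` appears; since `h1 = com L a1 g0`, it
equals `-δ³g0/12`. -/
theorem symm_three {L : Matrix N N ℝ} {g0 g1 h1 g2 h2 g3 h3 : Matrix N P ℝ}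
    {a1 a2 a3 : Matrix P P ℝ}
    (h1_eq : h1 = g0 * a1 - L * g0) (h2_eq : h2 = g1 * a1 - L * g1 + g0 * a2)
    (H : (g3 + (1 / 2 : ℝ) • h3) + L * (g2 + (1 / 2 : ℝ) • h2)
        + (1 / 2 : ℝ) • (L * (L * (g1 + (1 / 2 : ℝ) • h1)))
        + (1 / 6 : ℝ) • (L * (L * (L * g0))) =
      (g3 - (1 / 2 : ℝ) • h3) + (g2 - (1 / 2 : ℝ) • h2) * a1
        + (g1 - (1 / 2 : ℝ) • h1) * (a2 + (1 / 2 : ℝ) • (a1 * a1))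
        + g0 * (a3 + (1 / 2 : ℝ) • (a1 * a2 + a2 * a1) + (1 / 6 : ℝ) • (a1 * a1 * a1))) :
    h3 = com L a1 g2 + g1 * a2 + g0 * a3 - (1 / 12 : ℝ) • com L a1 (com L a1 h1) := by
  have : h3 = (g3 + (1 / 2 : ℝ) • h3) - (g3 - (1 / 2 : ℝ) • h3) := by module
  rw [this, eq_sub_of_add_eq (eq_sub_of_add_eq (eq_sub_of_add_eq H)), h2_eq, h1_eq]
  simp only [com, Matrix.mul_add, Matrix.add_mul, Matrix.mul_sub, Matrix.sub_mul, Matrix.smul_mul,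
    Matrix.mul_smul, Matrix.mul_assoc]
  module

/-- At order four only the conserved rows are needed, where the jump and the midpoint vanish; hence
`g4` and `h4` are left out and an identity between the remaining terms suffices. The bracket with
`1/12` collects `δ³g1` and the three positions of one factor `a2` in `δ³g0`; one of these sits
inside `h2`. -/
theorem symm_four {L : Matrix N N ℝ} {g0 g1 h1 g2 h2 g3 h3 : Matrix N P ℝ}
    {a1 a2 a3 a4 : Matrix P P ℝ}
    (h1_eq : h1 = g0 * a1 - L * g0) (h2_eq : h2 = g1 * a1 - L * g1 + g0 * a2)
    (h3_eq : h3 = com L a1 g2 + g1 * a2 + g0 * a3 - (1 / 12 : ℝ) • com L a1 (com L a1 h1)) :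
      ((g3 - (1 / 2 : ℝ) • h3) * a1
        + (g2 - (1 / 2 : ℝ) • h2) * (a2 + (1 / 2 : ℝ) • (a1 * a1))
        + (g1 - (1 / 2 : ℝ) • h1) *
          (a3 + (1 / 2 : ℝ) • (a1 * a2 + a2 * a1) + (1 / 6 : ℝ) • (a1 * a1 * a1))
        + g0 * (a4 + (1 / 2 : ℝ) • (a1 * a3 + a2 * a2 + a3 * a1)
          + (1 / 6 : ℝ) • (a1 * a1 * a2 + a1 * a2 * a1 + a2 * a1 * a1)
          + (1 / 24 : ℝ) • (a1 * a1 * a1 * a1)))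
      - (L * (g3 + (1 / 2 : ℝ) • h3) + (1 / 2 : ℝ) • (L * (L * (g2 + (1 / 2 : ℝ) • h2)))
        + (1 / 6 : ℝ) • (L * (L * (L * (g1 + (1 / 2 : ℝ) • h1))))
        + (1 / 24 : ℝ) • (L * (L * (L * (L * g0)))))
      = com L a1 g3 + g2 * a2 + g1 * a3 + g0 * a4
        - (1 / 12 : ℝ) • (com L a1 (com L a1 h2)
          + com L a1 (h1 * a2) + com L a1 h1 * a2) := by
  rw [h3_eq, h2_eq, h1_eq]
  simp only [com, Matrix.mul_add, Matrix.add_mul, Matrix.mul_sub, Matrix.sub_mul, Matrix.smul_mul,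
    Matrix.mul_smul, Matrix.mul_assoc]
  module

end Symmetrised

end LBM

/-! ### Unfolding the recursion up to order four -/

namespace LBM.D3Q19

open Matrix

variable (D : D3Q19)

/-- The coefficient `β_l` of the formal expansion `Y = ∑ Δt ^ l β_l W`. -/
noncomputable def beta (l : ℕ) : Matrix (Fin 15) (Fin 4) DOp := (D.expansion l).2 l

/-- Each step updates a single new index, so earlier coefficients are final. This allows the
recursion to be written with the limiting sequences, truncated at `k`. -/
theorem expansion_fst (k l : ℕ) : (D.expansion k).1 l = if l ≤ k then D.alpha l else 0 := by
  induction k with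
  | zero => rcases Nat.eq_zero_or_pos l with rfl | h
            · simp [alpha]
            · simp [expansion, h.ne']
  | succ k ih =>
    rcases eq_or_ne l (k + 1) with rfl | h
    · simp [alpha]
    · have : (D.expansion (k + 1)).1 l = (D.expansion k).1 l := by
        simp [expansion, Function.update_of_ne h]
      rw [this, ih]
      congr 1
      simp only [eq_iff_iff]
      omega

theorem expansion_snd (k l : ℕ) : (D.expansion k).2 l = if l ≤ k then D.beta l else 0 := by
  induction k with
  | zero => rcases Nat.eq_zero_or_pos l with rfl | h
            · simp [beta]
            · simp [expansion, h.ne']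
  | succ k ih =>
    rcases eq_or_ne l (k + 1) with rfl | h
    · simp [beta]
    · have : (D.expansion (k + 1)).2 l = (D.expansion k).2 l := by
        simp [expansion, Function.update_of_ne h]
      rw [this, ih]
      congr 1
      simp only [eq_iff_iff]
      omega

theorem alpha_zero : D.alpha 0 = 0 := rfl

theorem beta_zero : D.beta 0 = D.E.map MvPolynomial.C := by simp [beta, expansion]

theorem alpha_succ (k : ℕ) : D.alpha (k + 1) =
    D.nextAlpha k (fun l => if l ≤ k then D.alpha l else 0)
      (fun l => if l ≤ k then D.beta l else 0) := by
  have h1 : (D.expansion k).1 = fun l => if l ≤ k then D.alpha l else 0 :=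
    funext (D.expansion_fst k)
  have h2 : (D.expansion k).2 = fun l => if l ≤ k then D.beta l else 0 :=
    funext (D.expansion_snd k)
  rw [← h1, ← h2]
  simp [alpha, expansion]

theorem beta_succ (k : ℕ) : D.beta (k + 1) =
    D.nextBeta k (fun l => if l ≤ k + 1 then D.alpha l else 0)
      (fun l => if l ≤ k then D.beta l else 0) := by
  have h1 : (D.expansion (k + 1)).1 = fun l => if l ≤ k + 1 then D.alpha l else 0 :=
    funext (D.expansion_fst (k + 1))
  have h2 : (D.expansion k).2 = fun l => if l ≤ k then D.beta l else 0 :=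
    funext (D.expansion_snd k)
  rw [← h1, ← h2]
  simp [beta, expansion]

theorem isUnit_S_det : IsUnit D.S.det := by
  rw [S, det_diagonal, isUnit_iff_ne_zero, Finset.prod_ne_zero_iff]
  intro l _
  apply D.s_ne_zero
  simp [split, Fin.le_def, finSumFinEquiv]

theorem nextBeta_eq (k : ℕ) (α : ℕ → Matrix (Fin 4) (Fin 4) DOp)
    (β : ℕ → Matrix (Fin 15) (Fin 4) DOp) : D.nextBeta k α β =
    ((D.S⁻¹).map MvPolynomial.C : Matrix _ _ DOp) *
    (D.C (k + 1) + ∑ j ∈ Finset.Icc 1 (k + 1), D.Dm j * β (k + 1 - j)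
      - ∑ j ∈ Finset.Icc 1 (k + 1), (1 / (j.factorial : ℝ)) • kap α β j (k + 1)) := rfl

theorem S_mul_beta_succ (k : ℕ) : (D.S.map MvPolynomial.C : Matrix _ _ DOp) * D.beta (k + 1) =
    D.C (k + 1) + ∑ j ∈ Finset.Icc 1 (k + 1), D.Dm j * D.beta (k + 1 - j)
      - ∑ j ∈ Finset.Icc 1 (k + 1), (1 / (j.factorial : ℝ)) •
        kap (fun l => if l ≤ k + 1 then D.alpha l else 0)
          (fun l => if l ≤ k then D.beta l else 0) j (k + 1) := by
  rw [beta_succ, nextBeta_eq, ← Matrix.mul_assoc, ← Matrix.map_mul, mul_nonsing_inv _ D.isUnit_S_det,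
    Matrix.map_one _ (map_zero _) (map_one _), Matrix.one_mul]
  -- The sum starts at `j = 1`, so the index `k + 1 - j` never reaches the truncated entry.
  have h : ∀ j ∈ Finset.Icc 1 (k + 1),
      D.Dm j * (if k + 1 - j ≤ k then D.beta (k + 1 - j) else 0) = D.Dm j * D.beta (k + 1 - j) :=
    fun j hj => by rw [if_pos (by have := Finset.mem_Icc.1 hj; omega)]
  rw [Finset.sum_congr rfl h]

theorem alpha_one : D.alpha 1 = D.A 1 + D.B 1 * D.beta 0 := by
  rw [alpha_succ]; simp [nextAlpha]

theorem alpha_two : D.alpha 2 = D.A 2 + (D.B 1 * D.beta 1 + D.B 2 * D.beta 0)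
    - (1 / 2 : ℝ) • (D.alpha 1 * D.alpha 1) := by
  rw [alpha_succ]
  simp [nextAlpha, Finset.sum_Icc_succ_top, gam, Finset.Nat.antidiagonal_succ, alpha_zero,
    Nat.factorial]

theorem alpha_three : D.alpha 3 = D.A 3 + (D.B 1 * D.beta 2 + D.B 2 * D.beta 1 + D.B 3 * D.beta 0)
    - ((1 / 2 : ℝ) • (D.alpha 1 * D.alpha 2 + D.alpha 2 * D.alpha 1)
      + (1 / 6 : ℝ) • (D.alpha 1 * D.alpha 1 * D.alpha 1)) := by
  rw [alpha_succ]
  simp [nextAlpha, Finset.sum_Icc_succ_top, gam, Finset.Nat.antidiagonal_succ, alpha_zero,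
    Nat.factorial, Matrix.mul_assoc]

theorem alpha_four : D.alpha 4 =
    D.A 4 + (D.B 1 * D.beta 3 + D.B 2 * D.beta 2 + D.B 3 * D.beta 1 + D.B 4 * D.beta 0)
    - ((1 / 2 : ℝ) • (D.alpha 1 * D.alpha 3 + D.alpha 2 * D.alpha 2 + D.alpha 3 * D.alpha 1)
      + (1 / 6 : ℝ) • (D.alpha 1 * D.alpha 1 * D.alpha 2 + D.alpha 1 * D.alpha 2 * D.alpha 1
        + D.alpha 2 * D.alpha 1 * D.alpha 1)
      + (1 / 24 : ℝ) • (D.alpha 1 * D.alpha 1 * D.alpha 1 * D.alpha 1)) := by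
  rw [alpha_succ]
  simp [nextAlpha, Finset.sum_Icc_succ_top, gam, Finset.Nat.antidiagonal_succ, alpha_zero,
    Nat.factorial, Matrix.mul_assoc, Matrix.mul_add, add_assoc]

theorem S_mul_beta_one : (D.S.map MvPolynomial.C : Matrix _ _ DOp) * D.beta 1 =
    D.C 1 + D.Dm 1 * D.beta 0 - D.beta 0 * D.alpha 1 := by
  rw [S_mul_beta_succ]
  simp [kap, gam, Finset.Nat.antidiagonal_succ]

theorem S_mul_beta_two : (D.S.map MvPolynomial.C : Matrix _ _ DOp) * D.beta 2 =
    D.C 2 + (D.Dm 1 * D.beta 1 + D.Dm 2 * D.beta 0) - (D.beta 0 * D.alpha 2 + D.beta 1 * D.alpha 1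
      + (1 / 2 : ℝ) • (D.beta 0 * (D.alpha 1 * D.alpha 1))) := by
  rw [S_mul_beta_succ]
  simp [Finset.sum_Icc_succ_top, kap, gam, Finset.Nat.antidiagonal_succ, alpha_zero,
    Nat.factorial]

theorem S_mul_beta_three : (D.S.map MvPolynomial.C : Matrix _ _ DOp) * D.beta 3 =
    D.C 3 + (D.Dm 1 * D.beta 2 + D.Dm 2 * D.beta 1 + D.Dm 3 * D.beta 0)
      - (D.beta 0 * D.alpha 3 + D.beta 1 * D.alpha 2 + D.beta 2 * D.alpha 1
      + (1 / 2 : ℝ) • (D.beta 0 * (D.alpha 1 * D.alpha 2 + D.alpha 2 * D.alpha 1)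
        + D.beta 1 * (D.alpha 1 * D.alpha 1))
      + (1 / 6 : ℝ) • (D.beta 0 * (D.alpha 1 * (D.alpha 1 * D.alpha 1)))) := by
  rw [S_mul_beta_succ]
  simp [Finset.sum_Icc_succ_top, kap, gam, Finset.Nat.antidiagonal_succ, alpha_zero,
    Nat.factorial, add_assoc]

end LBM.D3Q19

/-! ### Fourier symbols, midpoints and jumps -/

namespace LBM.D3Q19

open Matrix

theorem fromRows_add {R m₁ m₂ n : Type*} [Add R] (A B : Matrix m₁ n R) (C D : Matrix m₂ n R) :
    fromRows A C + fromRows B D = fromRows (A + B) (C + D) := by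
  ext (i | i) j <;> rfl

theorem fromRows_sub {R m₁ m₂ n : Type*} [Sub R] (A B : Matrix m₁ n R) (C D : Matrix m₂ n R) :
    fromRows A C - fromRows B D = fromRows (A - B) (C - D) := by
  ext (i | i) j <;> rfl

variable (D : D3Q19) (ξ : Fin 3 → ℝ)

/-- The Fourier symbol of a matrix of operators, evaluated at `ξ`. -/
noncomputable def sym {m n : Type*} (X : Matrix m n DOp) : Matrix m n ℝ :=
  X.map (MvPolynomial.eval ξ)

section sym
variable {m n p : Type*}

theorem sym_add (X Y : Matrix m n DOp) : sym ξ (X + Y) = sym ξ X + sym ξ Y :=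
  Matrix.map_add _ (map_add _) _ _

theorem sym_sub (X Y : Matrix m n DOp) : sym ξ (X - Y) = sym ξ X - sym ξ Y :=
  Matrix.map_sub _ (map_sub _) _ _

theorem sym_neg (X : Matrix m n DOp) : sym ξ (-X) = -sym ξ X :=
  Matrix.map_neg _ (map_neg _) _

theorem sym_mul [Fintype n] (X : Matrix m n DOp) (Y : Matrix n p DOp) :
    sym ξ (X * Y) = sym ξ X * sym ξ Y :=
  Matrix.map_mul

theorem sym_smul (r : ℝ) (X : Matrix m n DOp) : sym ξ (r • X) = r • sym ξ X :=
  Matrix.map_smul _ r (MvPolynomial.smul_eval ξ · r) _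

theorem sym_C (X : Matrix m n ℝ) : sym ξ (X.map MvPolynomial.C) = X := by
  ext; simp [sym]

end sym

/-- The symbol of `-v · ∇`, acting on moments. -/
noncomputable def Lam : Matrix (Fin 4 ⊕ Fin 15) (Fin 4 ⊕ Fin 15) ℝ :=
  (D.M * diagonal (fun j => -∑ a, D.vel j a * ξ a) * D.M⁻¹).submatrix split split

theorem conj_diagonal_pow {n : Type*} [Fintype n] [DecidableEq n] {M : Matrix n n ℝ}
    (h : IsUnit M.det) (d : n → ℝ) (k : ℕ) :
    (M * diagonal d * M⁻¹) ^ k = M * diagonal (d ^ k) * M⁻¹ := by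
  induction k with
  | zero => simp [mul_nonsing_inv _ h]
  | succ k ih =>
    have hd : diagonal (d ^ (k + 1)) = diagonal (d ^ k) * diagonal d := by
      rw [diagonal_mul_diagonal]; rfl
    rw [pow_succ, ih, hd]
    calc _ = M * diagonal (d ^ k) * (M⁻¹ * M) * diagonal d * M⁻¹ := by
            simp only [Matrix.mul_assoc]
      _ = _ := by rw [nonsing_inv_mul _ h, Matrix.mul_one]; simp only [Matrix.mul_assoc]

theorem sym_taylor (h : IsUnit D.M.det) (n : ℕ) :
    sym ξ (D.taylor n) = (1 / (n.factorial : ℝ)) • (D.Lam ξ ^ n * D.J0) := by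
  have hL : D.Lam ξ ^ n = (D.M * diagonal ((fun j => -∑ a, D.vel j a * ξ a) ^ n)
      * D.M⁻¹).submatrix split split := by
    rw [← conj_diagonal_pow h, Lam]
    induction n with
    | zero => simp
    | succ n ih => rw [pow_succ, ih, submatrix_mul_equiv, pow_succ]
  rw [hL]
  ext k p
  simp only [sym, taylor, map_apply, of_apply, MvPolynomial.smul_eval, map_sum, Matrix.smul_apply,
    smul_eq_mul, map_pow, map_neg, pd, MvPolynomial.eval_X]
  congr 1
  rw [Matrix.mul_apply, Finset.sum_comm]
  refine Finset.sum_congr rfl fun l _ => ?_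
  rw [submatrix_apply, Matrix.mul_apply, Finset.sum_mul]
  refine Finset.sum_congr rfl fun j _ => ?_
  rw [mul_diagonal, Pi.pow_apply]
  ring

theorem sym_taylor_blocks (n : ℕ) : sym ξ (D.taylor n) =
    fromBlocks (sym ξ (D.A n)) (sym ξ (D.B n)) (sym ξ (D.C n)) (sym ξ (D.Dm n)) := by
  ext (i | i) (j | j) <;> rfl

/-- The moments `b_k W` at order `k`, before relaxation. -/
noncomputable def col (k : ℕ) : Matrix (Fin 4 ⊕ Fin 15) (Fin 4) ℝ :=
  fromRows (if k = 0 then 1 else 0) (sym ξ (D.beta k))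

theorem taylor_mul_col_zero (h : IsUnit D.M.det) (n : ℕ) :
    (1 / (n.factorial : ℝ)) • (D.Lam ξ ^ n * (D.J0 * D.col ξ 0)) =
      fromRows (sym ξ (D.A n + D.B n * D.beta 0)) (sym ξ (D.C n + D.Dm n * D.beta 0)) := by
  rw [← Matrix.mul_assoc, ← Matrix.smul_mul, ← sym_taylor D ξ h, sym_taylor_blocks, col,
    fromBlocks_mul_fromRows]
  simp [sym_add, sym_mul]

theorem taylor_mul_col_succ (h : IsUnit D.M.det) (n k : ℕ) :
    (1 / (n.factorial : ℝ)) • (D.Lam ξ ^ n * (D.J0 * D.col ξ (k + 1))) =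
      fromRows (sym ξ (D.B n * D.beta (k + 1))) (sym ξ (D.Dm n * D.beta (k + 1))) := by
  rw [← Matrix.mul_assoc, ← Matrix.smul_mul, ← sym_taylor D ξ h, sym_taylor_blocks, col,
    fromBlocks_mul_fromRows]
  simp [sym_mul]

theorem col_zero_mul (X : Matrix (Fin 4) (Fin 4) DOp) :
    D.col ξ 0 * sym ξ X = fromRows (sym ξ X) (sym ξ (D.beta 0 * X)) := by
  rw [col, fromRows_mul, sym_mul]; simp

theorem col_succ_mul (k : ℕ) (X : Matrix (Fin 4) (Fin 4) DOp) :
    D.col ξ (k + 1) * sym ξ X = fromRows 0 (sym ξ (D.beta (k + 1) * X)) := by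
  rw [col, fromRows_mul, sym_mul]; simp

theorem J0_mul_col_zero : D.J0 * D.col ξ 0 = D.col ξ 0 := by
  rw [col, J0, fromBlocks_mul_fromRows, beta_zero, sym_C]
  simp [Matrix.sub_mul]

theorem J0_mul_col_succ (k : ℕ) : D.J0 * D.col ξ (k + 1) =
    D.col ξ (k + 1) - fromRows 0 (sym ξ ((D.S.map MvPolynomial.C : Matrix _ _ DOp) *
      D.beta (k + 1))) := by
  rw [col, J0, fromBlocks_mul_fromRows, sym_mul, sym_C, fromRows_sub]
  simp [Matrix.sub_mul]

/-- The recursion for `α` gives the upper block and the one for `S β` the lower block of a single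
identity: the coefficient of `Δt` in `e^(ΔtΛ) J0 b = b e^(Δtα)`. The orders two and three follow the
same pattern. -/
theorem match_one (h : IsUnit D.M.det) :
    D.J0 * D.col ξ 1 + D.Lam ξ * (D.J0 * D.col ξ 0) =
      D.col ξ 1 + D.col ξ 0 * sym ξ (D.alpha 1) := by
  have t := D.taylor_mul_col_zero ξ h 1
  simp only [Nat.factorial, Nat.cast_one, div_one, one_smul, pow_one, mul_one] at t
  rw [J0_mul_col_succ, t, col_zero_mul, S_mul_beta_one, alpha_one, col]
  simp only [fromRows_add, fromRows_sub, sym_add, sym_sub]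
  congr 1
  · simp
  · simp only [sym_mul]; module

theorem match_two (h : IsUnit D.M.det) :
    D.J0 * D.col ξ 2 + D.Lam ξ * (D.J0 * D.col ξ 1)
      + (1 / 2 : ℝ) • (D.Lam ξ * (D.Lam ξ * (D.J0 * D.col ξ 0))) =
      D.col ξ 2 + D.col ξ 1 * sym ξ (D.alpha 1)
        + D.col ξ 0 * (sym ξ (D.alpha 2)
          + (1 / 2 : ℝ) • (sym ξ (D.alpha 1) * sym ξ (D.alpha 1))) := by
  have t0 := D.taylor_mul_col_zero ξ h 2
  have t1 := D.taylor_mul_col_succ ξ h 1 0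
  simp only [Nat.factorial, Nat.cast_one, div_one, one_smul, mul_one, pow_succ, pow_zero,
    Nat.succ_eq_add_one, zero_add, Nat.reduceAdd, Nat.cast_ofNat, one_mul,
    Matrix.mul_assoc] at t0 t1
  rw [J0_mul_col_succ, t0, t1]
  simp only [← sym_mul, ← sym_smul, ← sym_add]
  rw [col_zero_mul, col_succ_mul, S_mul_beta_two, alpha_two, col]
  simp only [fromRows_add, fromRows_sub, sym_add, sym_sub, Matrix.mul_add, Matrix.mul_sub,
    Matrix.mul_smul]
  congr 1 <;> simp <;> module

theorem match_three (h : IsUnit D.M.det) :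
    D.J0 * D.col ξ 3 + D.Lam ξ * (D.J0 * D.col ξ 2)
      + (1 / 2 : ℝ) • (D.Lam ξ * (D.Lam ξ * (D.J0 * D.col ξ 1)))
      + (1 / 6 : ℝ) • (D.Lam ξ * (D.Lam ξ * (D.Lam ξ * (D.J0 * D.col ξ 0)))) =
      D.col ξ 3 + D.col ξ 2 * sym ξ (D.alpha 1)
        + D.col ξ 1 * (sym ξ (D.alpha 2)
          + (1 / 2 : ℝ) • (sym ξ (D.alpha 1) * sym ξ (D.alpha 1)))
        + D.col ξ 0 * (sym ξ (D.alpha 3)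
          + (1 / 2 : ℝ) • (sym ξ (D.alpha 1) * sym ξ (D.alpha 2)
            + sym ξ (D.alpha 2) * sym ξ (D.alpha 1))
          + (1 / 6 : ℝ) • (sym ξ (D.alpha 1) * sym ξ (D.alpha 1) * sym ξ (D.alpha 1))) := by
  have t0 := D.taylor_mul_col_zero ξ h 3
  have t1 := D.taylor_mul_col_succ ξ h 2 0
  have t2 := D.taylor_mul_col_succ ξ h 1 1
  simp only [Nat.factorial, Nat.cast_one, div_one, one_smul, mul_one, pow_succ, pow_zero,
    Nat.succ_eq_add_one, zero_add, Nat.reduceAdd, Nat.reduceMul, Nat.cast_ofNat, one_mul,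
    Matrix.mul_assoc] at t0 t1 t2
  rw [J0_mul_col_succ, t0, t1, t2]
  simp only [← sym_mul, ← sym_smul, ← sym_add]
  rw [col_zero_mul, col_succ_mul, col_succ_mul, S_mul_beta_three, alpha_three, col]
  simp only [fromRows_add, fromRows_sub, sym_add, sym_sub, sym_mul, sym_smul, Matrix.mul_add,
    Matrix.mul_sub, Matrix.mul_smul, Matrix.mul_assoc]
  congr 1 <;> simp <;> module

/-- Restricting to the conserved rows avoids `β_4`, which does not influence `α_4`. -/
theorem match_four (h : IsUnit D.M.det) : toRows₁ (
      (D.col ξ 3 * sym ξ (D.alpha 1)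
        + D.col ξ 2 * (sym ξ (D.alpha 2)
          + (1 / 2 : ℝ) • (sym ξ (D.alpha 1) * sym ξ (D.alpha 1)))
        + D.col ξ 1 * (sym ξ (D.alpha 3)
          + (1 / 2 : ℝ) • (sym ξ (D.alpha 1) * sym ξ (D.alpha 2)
            + sym ξ (D.alpha 2) * sym ξ (D.alpha 1))
          + (1 / 6 : ℝ) • (sym ξ (D.alpha 1) * sym ξ (D.alpha 1) * sym ξ (D.alpha 1)))
        + D.col ξ 0 * (sym ξ (D.alpha 4)
          + (1 / 2 : ℝ) • (sym ξ (D.alpha 1) * sym ξ (D.alpha 3)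
            + sym ξ (D.alpha 2) * sym ξ (D.alpha 2) + sym ξ (D.alpha 3) * sym ξ (D.alpha 1))
          + (1 / 6 : ℝ) • (sym ξ (D.alpha 1) * sym ξ (D.alpha 1) * sym ξ (D.alpha 2)
            + sym ξ (D.alpha 1) * sym ξ (D.alpha 2) * sym ξ (D.alpha 1)
            + sym ξ (D.alpha 2) * sym ξ (D.alpha 1) * sym ξ (D.alpha 1))
          + (1 / 24 : ℝ) • (sym ξ (D.alpha 1) * sym ξ (D.alpha 1) * sym ξ (D.alpha 1)
            * sym ξ (D.alpha 1))))
      - (D.Lam ξ * (D.J0 * D.col ξ 3)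
        + (1 / 2 : ℝ) • (D.Lam ξ * (D.Lam ξ * (D.J0 * D.col ξ 2)))
        + (1 / 6 : ℝ) • (D.Lam ξ * (D.Lam ξ * (D.Lam ξ * (D.J0 * D.col ξ 1))))
        + (1 / 24 : ℝ) • (D.Lam ξ * (D.Lam ξ * (D.Lam ξ * (D.Lam ξ * (D.J0 * D.col ξ 0))))))) =
      0 := by
  have t0 := D.taylor_mul_col_zero ξ h 4
  have t1 := D.taylor_mul_col_succ ξ h 3 0
  have t2 := D.taylor_mul_col_succ ξ h 2 1
  have t3 := D.taylor_mul_col_succ ξ h 1 2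
  simp only [Nat.factorial, Nat.cast_one, div_one, one_smul, mul_one, pow_succ, pow_zero,
    Nat.succ_eq_add_one, zero_add, Nat.reduceAdd, Nat.reduceMul, Nat.cast_ofNat, one_mul,
    Matrix.mul_assoc] at t0 t1 t2 t3
  rw [t0, t1, t2, t3]
  simp only [← sym_mul, ← sym_smul, ← sym_add]
  rw [col_zero_mul, col_succ_mul, col_succ_mul, col_succ_mul, alpha_four]
  simp only [fromRows_add, fromRows_sub, toRows₁_fromRows, sym_add, sym_sub, sym_smul]
  module

/-- The jump `b_k* - b_k` of the moments in the relaxation. -/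
noncomputable def jump (k : ℕ) : Matrix (Fin 4 ⊕ Fin 15) (Fin 4) ℝ :=
  D.J0 * D.col ξ k - D.col ξ k

/-- The average of the moments before and after relaxation. -/
noncomputable def mid (k : ℕ) : Matrix (Fin 4 ⊕ Fin 15) (Fin 4) ℝ :=
  D.col ξ k + (1 / 2 : ℝ) • D.jump ξ k

theorem J0_mul_col_eq (k : ℕ) : D.J0 * D.col ξ k = D.mid ξ k + (1 / 2 : ℝ) • D.jump ξ k := by
  rw [mid, jump]; module

theorem col_eq (k : ℕ) : D.col ξ k = D.mid ξ k - (1 / 2 : ℝ) • D.jump ξ k := by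
  rw [mid]; module

theorem jump_zero : D.jump ξ 0 = 0 := by rw [jump, J0_mul_col_zero, sub_self]

theorem mid_zero : D.mid ξ 0 = fromRows 1 D.E := by
  simp [mid, jump_zero, col, beta_zero, sym_C]

theorem jump_succ_inl (k : ℕ) (i j : Fin 4) : D.jump ξ (k + 1) (Sum.inl i) j = 0 := by
  rw [jump, J0_mul_col_succ]; simp

theorem mid_succ_inl (k : ℕ) (i j : Fin 4) : D.mid ξ (k + 1) (Sum.inl i) j = 0 := by
  simp [mid, jump_succ_inl, col]

/-- Beyond order zero the equilibrium part is absent, so the jump is `h = -s b`; then `g = b + h/2 =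
-(1/s - 1/2) h`. This is the only way in which the relaxation coefficients enter from here on. -/
theorem mid_succ_inr (k : ℕ) (i : Fin 15) (j : Fin 4) : D.mid ξ (k + 1) (Sum.inr i) j =
    -D.sigma (split (Sum.inr i)) * D.jump ξ (k + 1) (Sum.inr i) j := by
  have hs : D.s (split (Sum.inr i)) ≠ 0 := by
    apply D.s_ne_zero
    simp [split, Fin.le_def, finSumFinEquiv]
  have : D.jump ξ (k + 1) (Sum.inr i) j =
      -(D.s (split (Sum.inr i)) * D.col ξ (k + 1) (Sum.inr i) j) := by
    rw [jump, J0_mul_col_succ, sym_mul, sym_C, S]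
    simp [col]
  rw [mid, Matrix.add_apply, Matrix.smul_apply, this, sigma, smul_eq_mul]
  field_simp
  ring

theorem jump_one (h : IsUnit D.M.det) : D.jump ξ 1 = com (D.Lam ξ) (sym ξ (D.alpha 1)) (D.mid ξ 0) := by
  have H := D.match_one ξ h
  rw [J0_mul_col_eq, J0_mul_col_eq, D.col_eq ξ 1, D.col_eq ξ 0, jump_zero, smul_zero, add_zero,
    sub_zero] at H
  exact symm_one H

theorem jump_two (h : IsUnit D.M.det) : D.jump ξ 2 =
    com (D.Lam ξ) (sym ξ (D.alpha 1)) (D.mid ξ 1) + D.mid ξ 0 * sym ξ (D.alpha 2) := by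
  have H := D.match_two ξ h
  simp only [J0_mul_col_eq] at H
  simp only [D.col_eq ξ, jump_zero, smul_zero, add_zero, sub_zero] at H
  exact symm_two (D.jump_one ξ h) H

theorem jump_three (h : IsUnit D.M.det) : D.jump ξ 3 =
    com (D.Lam ξ) (sym ξ (D.alpha 1)) (D.mid ξ 2) + D.mid ξ 1 * sym ξ (D.alpha 2)
      + D.mid ξ 0 * sym ξ (D.alpha 3)
      - (1 / 12 : ℝ) • com (D.Lam ξ) (sym ξ (D.alpha 1))
        (com (D.Lam ξ) (sym ξ (D.alpha 1)) (D.jump ξ 1)) := by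
  have H := D.match_three ξ h
  simp only [J0_mul_col_eq] at H
  simp only [D.col_eq ξ, jump_zero, smul_zero, add_zero, sub_zero] at H
  exact symm_three (D.jump_one ξ h) (D.jump_two ξ h) H

theorem top_four (h : IsUnit D.M.det) : toRows₁ (
    com (D.Lam ξ) (sym ξ (D.alpha 1)) (D.mid ξ 3) + D.mid ξ 2 * sym ξ (D.alpha 2)
      + D.mid ξ 1 * sym ξ (D.alpha 3) + D.mid ξ 0 * sym ξ (D.alpha 4)
      - (1 / 12 : ℝ) • (com (D.Lam ξ) (sym ξ (D.alpha 1))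
          (com (D.Lam ξ) (sym ξ (D.alpha 1)) (D.jump ξ 2))
        + com (D.Lam ξ) (sym ξ (D.alpha 1)) (D.jump ξ 1 * sym ξ (D.alpha 2))
        + com (D.Lam ξ) (sym ξ (D.alpha 1)) (D.jump ξ 1) * sym ξ (D.alpha 2))) = 0 := by
  have H := D.match_four ξ h
  simp only [J0_mul_col_eq] at H
  simp only [D.col_eq ξ, jump_zero, smul_zero, add_zero, sub_zero] at H
  rw [← symm_four (D.jump_one ξ h) (D.jump_two ξ h) (D.jump_three ξ h)]
  exact H

end LBM.D3Q19

/-! ### The D3Q19 moments: invertibility of `M` and transport in moment coordinates -/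

namespace LBM.D3Q19

open Matrix

/-- The velocities with integer entries. -/
def dirZ : Fin 19 → Fin 3 → ℤ :=
  ![![0, 0, 0],
    ![1, 0, 0], ![-1, 0, 0], ![0, 1, 0], ![0, -1, 0], ![0, 0, 1], ![0, 0, -1],
    ![1, 1, 0], ![1, -1, 0], ![-1, 1, 0], ![-1, -1, 0],
    ![0, 1, 1], ![0, 1, -1], ![0, -1, 1], ![0, -1, -1],
    ![1, 0, 1], ![-1, 0, 1], ![1, 0, -1], ![-1, 0, -1]]

theorem dir_eq (j : Fin 19) (i : Fin 3) : dir j i = dirZ j i := by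
  fin_cases j <;> fin_cases i <;> simp [dir, dirZ]

/-- The moment polynomials for `lam = 1` over the integers, without denominator. -/
def momentZ (v : Fin 3 → ℤ) : Fin 19 → ℤ :=
  let x := v 0
  let y := v 1
  let z := v 2
  let n := x ^ 2 + y ^ 2 + z ^ 2
  ![1,
    x, y, z,
    19 * n - 30,
    2 * x ^ 2 - y ^ 2 - z ^ 2, y ^ 2 - z ^ 2,
    x * y, y * z, z * x,
    (5 * n - 9) * x, (5 * n - 9) * y, (5 * n - 9) * z,
    21 * n ^ 2 - 53 * n + 24,
    (3 * n - 5) * (2 * x ^ 2 - y ^ 2 - z ^ 2), (3 * n - 5) * (y ^ 2 - z ^ 2),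
    x * (y ^ 2 - z ^ 2), y * (z ^ 2 - x ^ 2), z * (x ^ 2 - y ^ 2)]

/-- The matrix of moments with integer entries. -/
def MZ : Matrix (Fin 19) (Fin 19) ℤ := Matrix.of fun k j => momentZ (dirZ j) k

/-- The squared norms of the rows of `MZ`. -/
def normZ : Fin 19 → ℤ :=
  ![19, 10, 10, 10, 2394, 36, 12, 4, 4, 4, 40, 40, 40, 1008, 72, 24, 8, 8, 8]

/-- The moments are orthogonal on the set of velocities; this gives the invertibility of `M` through
a decidable integer computation. -/
theorem MZ_mul_transpose : MZ * MZᵀ = diagonal normZ := by decide +kernel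

variable (D : D3Q19)

theorem lam_pos : 0 < D.lam := div_pos D.dx_pos D.dt_pos

/-- The scaling of the moments by powers of `lam`. -/
noncomputable def scale (lam : ℝ) : Fin 19 → ℝ :=
  ![1, lam, lam, lam, lam ^ 2, lam ^ 2, lam ^ 2, lam ^ 2, lam ^ 2, lam ^ 2, lam ^ 3, lam ^ 3,
    lam ^ 3, lam ^ 4 / 2, lam ^ 4, lam ^ 4, lam ^ 3, lam ^ 3, lam ^ 3]

/-- Each `p_k` is homogeneous in `(v, λ)`. The half in entry 13 of `scale` restores the denominator
of `ε₂` omitted in `momentZ`. -/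
theorem M_eq : D.M = diagonal (scale D.lam) * MZ.map (Int.cast : ℤ → ℝ) := by
  ext k j
  rw [diagonal_mul, map_apply, M, MZ, of_apply, of_apply]
  have h : ∀ a, D.vel j a = D.lam * dirZ j a := fun a => by rw [vel, dir_eq]
  fin_cases k <;> simp [momentPoly, momentZ, scale, h] <;> ring

theorem isUnit_M_det : IsUnit D.M.det := by
  have h1 : (MZ * MZᵀ).det ≠ 0 := by
    rw [MZ_mul_transpose, det_diagonal, Finset.prod_ne_zero_iff]
    decide
  have h2 : MZ.det ≠ 0 := by
    rw [det_mul] at h1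
    exact left_ne_zero_of_mul h1
  have h3 : (MZ.map (Int.cast : ℤ → ℝ)).det = (MZ.det : ℝ) := (Int.cast_det MZ).symm
  have hl := D.lam_pos.ne'
  rw [M_eq, det_mul, h3, det_diagonal, isUnit_iff_ne_zero]
  refine mul_ne_zero (Finset.prod_ne_zero_iff.2 fun k _ => ?_) (Int.cast_ne_zero.2 h2)
  fin_cases k <;> simp [scale, hl]

/-- Multiplication by `v · ξ`, acting on moments. -/
noncomputable def flux (lam : ℝ) (ξ : Fin 3 → ℝ) (m : Fin 19 → ℝ) : Fin 19 → ℝ :=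
  let x := ξ 0
  let y := ξ 1
  let z := ξ 2
  ![x * m 1 + y * m 2 + z * m 3,
    x * (10 / 19 * lam ^ 2 * m 0 + m 4 / 57 + m 5 / 3) + y * m 7 + z * m 9,
    x * m 7 + y * (10 / 19 * lam ^ 2 * m 0 + m 4 / 57 - m 5 / 6 + m 6 / 2) + z * m 8,
    x * m 9 + y * m 8 + z * (10 / 19 * lam ^ 2 * m 0 + m 4 / 57 - m 5 / 6 - m 6 / 2),
    x * (21 * lam ^ 2 * m 1 + 19 * m 10) / 5 + y * (21 * lam ^ 2 * m 2 + 19 * m 11) / 5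
      + z * (21 * lam ^ 2 * m 3 + 19 * m 12) / 5,
    x * (6 * lam ^ 2 * m 1 - m 10) / 5 - y * (6 * lam ^ 2 * m 2 - m 11 + 15 * m 17) / 10
      - z * (6 * lam ^ 2 * m 3 - m 12 - 15 * m 18) / 10,
    x * m 16 + y * (6 * lam ^ 2 * m 2 - m 11 - 5 * m 17) / 10
      - z * (6 * lam ^ 2 * m 3 - m 12 + 5 * m 18) / 10,
    x * (4 * lam ^ 2 * m 2 + m 11 - 5 * m 17) / 10 + y * (4 * lam ^ 2 * m 1 + m 10 + 5 * m 16) / 10,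
    y * (4 * lam ^ 2 * m 3 + m 12 - 5 * m 18) / 10 + z * (4 * lam ^ 2 * m 2 + m 11 + 5 * m 17) / 10,
    x * (4 * lam ^ 2 * m 3 + m 12 + 5 * m 18) / 10 + z * (4 * lam ^ 2 * m 1 + m 10 - 5 * m 16) / 10,
    x * (4 / 63 * lam ^ 2 * m 4 - 2 / 9 * lam ^ 2 * m 5 + 10 / 63 * m 13 + 5 / 9 * m 14)
      + lam ^ 2 * (y * m 7 + z * m 9),
    y * (4 / 63 * lam ^ 2 * m 4 + 1 / 9 * lam ^ 2 * m 5 - 1 / 3 * lam ^ 2 * m 6 + 10 / 63 * m 13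
      - 5 / 18 * m 14 + 5 / 6 * m 15) + lam ^ 2 * (x * m 7 + z * m 8),
    z * (4 / 63 * lam ^ 2 * m 4 + 1 / 9 * lam ^ 2 * m 5 + 1 / 3 * lam ^ 2 * m 6 + 10 / 63 * m 13
      - 5 / 18 * m 14 - 5 / 6 * m 15) + lam ^ 2 * (x * m 9 + y * m 8),
    lam ^ 2 * (x * m 10 + y * m 11 + z * m 12),
    lam ^ 2 * (x * m 10 - y * (m 11 + 3 * m 17) / 2 - z * (m 12 - 3 * m 18) / 2),
    lam ^ 2 * (x * m 16 + y * (m 11 - m 17) / 2 - z * (m 12 + m 18) / 2),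
    x * (2 * lam ^ 2 * m 6 + m 15) / 3 + lam ^ 2 * (y * m 7 - z * m 9),
    lam ^ 2 * (z * m 8 - x * m 7) - y * (2 * lam ^ 2 * m 5 + 2 * lam ^ 2 * m 6 + m 14 + m 15) / 6,
    lam ^ 2 * (x * m 9 - y * m 8) + z * (2 * lam ^ 2 * m 5 - 2 * lam ^ 2 * m 6 + m 14 - m 15) / 6]

section rows

variable (lam : ℝ) (ξ : Fin 3 → ℝ) (m : Fin 19 → ℝ)

theorem flux_0 : flux lam ξ m 0 =
    ξ 0 * m 1 + ξ 1 * m 2 + ξ 2 * m 3 := rfl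

theorem flux_1 : flux lam ξ m 1 =
    ξ 0 * (10 / 19 * lam ^ 2 * m 0 + m 4 / 57 + m 5 / 3) + ξ 1 * m 7 + ξ 2 * m 9 := rfl

theorem flux_2 : flux lam ξ m 2 =
    ξ 0 * m 7 + ξ 1 * (10 / 19 * lam ^ 2 * m 0 + m 4 / 57 - m 5 / 6 + m 6 / 2) + ξ 2 * m 8 := rfl

theorem flux_3 : flux lam ξ m 3 =
    ξ 0 * m 9 + ξ 1 * m 8 + ξ 2 * (10 / 19 * lam ^ 2 * m 0 + m 4 / 57 - m 5 / 6 - m 6 / 2) := rfl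

theorem flux_4 : flux lam ξ m 4 =
    ξ 0 * (21 * lam ^ 2 * m 1 + 19 * m 10) / 5 + ξ 1 * (21 * lam ^ 2 * m 2 + 19 * m 11) / 5 + ξ 2
      * (21 * lam ^ 2 * m 3 + 19 * m 12) / 5 := rfl

theorem flux_5 : flux lam ξ m 5 =
    ξ 0 * (6 * lam ^ 2 * m 1 - m 10) / 5 - ξ 1 * (6 * lam ^ 2 * m 2 - m 11 + 15 * m 17) / 10 - ξ
      2 * (6 * lam ^ 2 * m 3 - m 12 - 15 * m 18) / 10 := rfl

theorem flux_6 : flux lam ξ m 6 =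
    ξ 0 * m 16 + ξ 1 * (6 * lam ^ 2 * m 2 - m 11 - 5 * m 17) / 10 - ξ 2 * (6 * lam ^ 2 * m 3 - m
      12 + 5 * m 18) / 10 := rfl

theorem flux_7 : flux lam ξ m 7 =
    ξ 0 * (4 * lam ^ 2 * m 2 + m 11 - 5 * m 17) / 10 + ξ 1 * (4 * lam ^ 2 * m 1 + m 10 + 5 * m
      16) / 10 := rfl

theorem flux_8 : flux lam ξ m 8 =
    ξ 1 * (4 * lam ^ 2 * m 3 + m 12 - 5 * m 18) / 10 + ξ 2 * (4 * lam ^ 2 * m 2 + m 11 + 5 * m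
      17) / 10 := rfl

theorem flux_9 : flux lam ξ m 9 =
    ξ 0 * (4 * lam ^ 2 * m 3 + m 12 + 5 * m 18) / 10 + ξ 2 * (4 * lam ^ 2 * m 1 + m 10 - 5 * m
      16) / 10 := rfl

theorem flux_10 : flux lam ξ m 10 =
    ξ 0 * (4 / 63 * lam ^ 2 * m 4 - 2 / 9 * lam ^ 2 * m 5 + 10 / 63 * m 13 + 5 / 9 * m 14) + lam
      ^ 2 * (ξ 1 * m 7 + ξ 2 * m 9) := rfl

theorem flux_11 : flux lam ξ m 11 =
    ξ 1 * (4 / 63 * lam ^ 2 * m 4 + 1 / 9 * lam ^ 2 * m 5 - 1 / 3 * lam ^ 2 * m 6 + 10 / 63 * m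
      13 - 5 / 18 * m 14 + 5 / 6 * m 15) + lam ^ 2 * (ξ 0 * m 7 + ξ 2 * m 8) := rfl

theorem flux_12 : flux lam ξ m 12 =
    ξ 2 * (4 / 63 * lam ^ 2 * m 4 + 1 / 9 * lam ^ 2 * m 5 + 1 / 3 * lam ^ 2 * m 6 + 10 / 63 * m
      13 - 5 / 18 * m 14 - 5 / 6 * m 15) + lam ^ 2 * (ξ 0 * m 9 + ξ 1 * m 8) := rfl

theorem flux_13 : flux lam ξ m 13 =
    lam ^ 2 * (ξ 0 * m 10 + ξ 1 * m 11 + ξ 2 * m 12) := rfl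

theorem flux_14 : flux lam ξ m 14 =
    lam ^ 2 * (ξ 0 * m 10 - ξ 1 * (m 11 + 3 * m 17) / 2 - ξ 2 * (m 12 - 3 * m 18) / 2) := rfl

theorem flux_15 : flux lam ξ m 15 =
    lam ^ 2 * (ξ 0 * m 16 + ξ 1 * (m 11 - m 17) / 2 - ξ 2 * (m 12 + m 18) / 2) := rfl

theorem flux_16 : flux lam ξ m 16 =
    ξ 0 * (2 * lam ^ 2 * m 6 + m 15) / 3 + lam ^ 2 * (ξ 1 * m 7 - ξ 2 * m 9) := rfl

theorem flux_17 : flux lam ξ m 17 =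
    lam ^ 2 * (ξ 2 * m 8 - ξ 0 * m 7) - ξ 1 * (2 * lam ^ 2 * m 5 + 2 * lam ^ 2 * m 6 + m 14 + m
      15) / 6 := rfl

theorem flux_18 : flux lam ξ m 18 =
    lam ^ 2 * (ξ 0 * m 9 - ξ 1 * m 8) + ξ 2 * (2 * lam ^ 2 * m 5 - 2 * lam ^ 2 * m 6 + m 14 - m
      15) / 6 := rfl

end rows

theorem forall_fin_nineteen {p : Fin 19 → Prop} (h0 : p 0) (h1 : p 1) (h2 : p 2) (h3 : p 3) (h4 : p 4) (h5 : p 5) (h6 : p 6) (h7 : p 7) (h8 : p 8) (h9 : p 9)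
    (h10 : p 10) (h11 : p 11) (h12 : p 12) (h13 : p 13) (h14 : p 14) (h15 : p 15) (h16 : p 16) (h17 : p 17) (h18 : p 18) :
    ∀ k, p k := by
  intro k; fin_cases k <;> assumption

theorem flux_add (lam : ℝ) (ξ : Fin 3 → ℝ) (m m' : Fin 19 → ℝ) :
    flux lam ξ (m + m') = flux lam ξ m + flux lam ξ m' := by
  funext k
  revert k
  apply forall_fin_nineteen <;> simp only [Pi.add_apply, flux_0, flux_1, flux_2, flux_3, flux_4, flux_5, flux_6, flux_7, flux_8, flux_9, flux_10,
    flux_11, flux_12, flux_13, flux_14, flux_15, flux_16, flux_17, flux_18] <;> ring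

theorem flux_smul (lam : ℝ) (ξ : Fin 3 → ℝ) (c : ℝ) (m : Fin 19 → ℝ) :
    flux lam ξ (c • m) = c • flux lam ξ m := by
  funext k
  revert k
  apply forall_fin_nineteen <;> simp only [Pi.smul_apply, smul_eq_mul, flux_0, flux_1, flux_2, flux_3, flux_4, flux_5, flux_6, flux_7, flux_8, flux_9, flux_10,
    flux_11, flux_12, flux_13, flux_14, flux_15, flux_16, flux_17, flux_18] <;> ring

theorem dir_cube (j : Fin 19) (i : Fin 3) : dir j i ^ 3 = dir j i := by
  rw [dir_eq]
  have : ∀ j i, dirZ j i ^ 3 = dirZ j i := by decide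
  exact_mod_cast this j i

theorem dir_prod (j : Fin 19) : dir j 0 * dir j 1 * dir j 2 = 0 := by
  rw [dir_eq, dir_eq, dir_eq]
  have : ∀ j, dirZ j 0 * dirZ j 1 * dirZ j 2 = 0 := by decide
  exact_mod_cast this j

/-- The constants in `flux` come from expanding `v_a p_k` in the basis of moments after reduction by
`e_i³ = e_i` and `e_0 e_1 e_2 = 0`, the relations which hold on the nineteen velocities. Thus the
columns of `M` are eigenvectors of `flux` with eigenvalues `v_j·ξ`; by linearity this identifies
`flux` with transport. -/
theorem flux_momentPoly (lam : ℝ) (ξ e : Fin 3 → ℝ) (h0 : e 0 ^ 3 = e 0) (h1 : e 1 ^ 3 = e 1)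
    (h2 : e 2 ^ 3 = e 2) (h3 : e 0 * e 1 * e 2 = 0) :
    flux lam ξ (momentPoly lam fun a => lam * e a) =
      (∑ a, lam * e a * ξ a) • momentPoly lam fun a => lam * e a := by
  funext k
  simp only [Fin.sum_univ_three, Pi.smul_apply, smul_eq_mul]
  revert k
  apply forall_fin_nineteen <;> simp only [flux_0, flux_1, flux_2, flux_3, flux_4, flux_5, flux_6, flux_7, flux_8, flux_9, flux_10,
    flux_11, flux_12, flux_13, flux_14, flux_15, flux_16, flux_17, flux_18] <;>
    simp [momentPoly] <;> grind

theorem M_col (j : Fin 19) : (fun k => D.M k j) = momentPoly D.lam fun a => D.lam * dir j a := rfl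

theorem flux_M_mulVec (ξ : Fin 3 → ℝ) (f : Fin 19 → ℝ) :
    flux D.lam ξ (D.M *ᵥ f) = D.M *ᵥ (fun j => (∑ a, D.vel j a * ξ a) * f j) := by
  let F : (Fin 19 → ℝ) →ₗ[ℝ] (Fin 19 → ℝ) :=
    { toFun := flux D.lam ξ, map_add' := flux_add _ _, map_smul' := flux_smul _ _ }
  have hF : ∀ m, flux D.lam ξ m = F m := fun _ => rfl
  have hM : ∀ g : Fin 19 → ℝ, D.M *ᵥ g = ∑ j, g j • fun k => D.M k j := by
    intro g
    ext k
    simp [mulVec, dotProduct, mul_comm]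
  rw [hM, hM, hF, map_sum]
  refine Finset.sum_congr rfl fun j _ => ?_
  rw [map_smul, ← hF, M_col, flux_momentPoly _ _ _ (dir_cube j 0) (dir_cube j 1) (dir_cube j 2)
    (dir_prod j), smul_smul, mul_comm]
  rfl

theorem Lam_mulVec (ξ : Fin 3 → ℝ) (m : Fin 4 ⊕ Fin 15 → ℝ) (i : Fin 19) :
    (D.Lam ξ *ᵥ m) (split.symm i) = -flux D.lam ξ (m ∘ split.symm) i := by
  have h1 : D.M *ᵥ (D.M⁻¹ *ᵥ (m ∘ split.symm)) = m ∘ split.symm := by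
    rw [mulVec_mulVec, mul_nonsing_inv _ D.isUnit_M_det, one_mulVec]
  rw [Lam, submatrix_mulVec_equiv, Function.comp_apply, Equiv.apply_symm_apply,
    Matrix.mul_assoc, ← mulVec_mulVec, ← mulVec_mulVec]
  conv_rhs => rw [← h1, flux_M_mulVec]
  rw [← Pi.neg_apply, ← mulVec_neg]
  congr 2
  funext j
  rw [mulVec_diagonal, Pi.neg_apply, neg_mul]

end LBM.D3Q19

/-! ### The operators `α_1, …, α_4` in terms of fluxes -/

namespace LBM.D3Q19

open Matrix

variable (D : D3Q19) (ξ : Fin 3 → ℝ)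

/-- The symbol of `α_l` acting on a vector. -/
noncomputable def act (l : ℕ) (W : Fin 4 → ℝ) : Fin 4 → ℝ := sym ξ (D.alpha l) *ᵥ W

/-- The moments `mid ξ k *ᵥ W`, indexed by `Fin 19`. -/
noncomputable def G (k : ℕ) (W : Fin 4 → ℝ) : Fin 19 → ℝ := (D.mid ξ k *ᵥ W) ∘ split.symm

/-- The moments `jump ξ k *ᵥ W`, indexed by `Fin 19`. -/
noncomputable def H (k : ℕ) (W : Fin 4 → ℝ) : Fin 19 → ℝ := (D.jump ξ k *ᵥ W) ∘ split.symm

/-- The leading part of `∂_t + v · ∇` on families of moments depending on `W`. -/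
noncomputable def del (X : (Fin 4 → ℝ) → Fin 19 → ℝ) (W : Fin 4 → ℝ) : Fin 19 → ℝ :=
  X (D.act ξ 1 W) + flux D.lam ξ (X W)

theorem del_apply (X : (Fin 4 → ℝ) → Fin 19 → ℝ) (W : Fin 4 → ℝ) (k : Fin 19) :
    D.del ξ X W k = X (D.act ξ 1 W) k + flux D.lam ξ (X W) k := rfl

theorem com_mulVec (X : Matrix (Fin 4 ⊕ Fin 15) (Fin 4) ℝ) (W : Fin 4 → ℝ) :
    (com (D.Lam ξ) (sym ξ (D.alpha 1)) X *ᵥ W) ∘ split.symm =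
      D.del ξ (fun W => (X *ᵥ W) ∘ split.symm) W := by
  funext i
  rw [com, sub_mulVec, ← mulVec_mulVec, ← mulVec_mulVec, Function.comp_apply, Pi.sub_apply,
    Lam_mulVec, sub_neg_eq_add]
  rfl

theorem G_zero_low (W : Fin 4 → ℝ) (i : Fin 4) : D.G ξ 0 W (split (Sum.inl i)) = W i := by
  rw [G, Function.comp_apply, Equiv.symm_apply_apply, mid_zero, fromRows_mulVec]
  simp

theorem G_zero_high (W : Fin 4 → ℝ) (l : Fin 15) : D.G ξ 0 W (split (Sum.inr l)) =
    ∑ i, D.meq (split (Sum.inr l)) i * W i := by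
  rw [G, Function.comp_apply, Equiv.symm_apply_apply, mid_zero, fromRows_mulVec]
  rfl

theorem H_low (n : ℕ) (W : Fin 4 → ℝ) (i : Fin 4) :
    D.H ξ (n + 1) W (split (Sum.inl i)) = 0 := by
  rw [H, Function.comp_apply, Equiv.symm_apply_apply]
  simp [mulVec, dotProduct, jump_succ_inl]

theorem G_low (n : ℕ) (W : Fin 4 → ℝ) (i : Fin 4) :
    D.G ξ (n + 1) W (split (Sum.inl i)) = 0 := by
  rw [G, Function.comp_apply, Equiv.symm_apply_apply]
  simp [mulVec, dotProduct, mid_succ_inl]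

theorem G_high (n : ℕ) (W : Fin 4 → ℝ) (l : Fin 15) : D.G ξ (n + 1) W (split (Sum.inr l)) =
    -D.sigma (split (Sum.inr l)) * D.H ξ (n + 1) W (split (Sum.inr l)) := by
  rw [G, H, Function.comp_apply, Function.comp_apply, Equiv.symm_apply_apply]
  simp [mulVec, dotProduct, mid_succ_inr, Finset.mul_sum, mul_assoc]

theorem H_one (W : Fin 4 → ℝ) : D.H ξ 1 W = D.del ξ (D.G ξ 0) W := by
  rw [H, jump_one _ _ D.isUnit_M_det, com_mulVec]
  rfl

theorem H_two (W : Fin 4 → ℝ) :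
    D.H ξ 2 W = D.del ξ (D.G ξ 1) W + D.G ξ 0 (D.act ξ 2 W) := by
  rw [H, jump_two _ _ D.isUnit_M_det, add_mulVec, Pi.add_comp, com_mulVec, ← mulVec_mulVec]
  rfl

theorem H_three (W : Fin 4 → ℝ) : D.H ξ 3 W = D.del ξ (D.G ξ 2) W + D.G ξ 1 (D.act ξ 2 W)
    + D.G ξ 0 (D.act ξ 3 W) - (1 / 12 : ℝ) • D.del ξ (D.del ξ (D.H ξ 1)) W := by
  rw [H, jump_three _ _ D.isUnit_M_det, sub_mulVec, add_mulVec, add_mulVec, Pi.sub_comp,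
    Pi.add_comp, Pi.add_comp, com_mulVec, smul_mulVec, Pi.smul_comp, com_mulVec,
    ← mulVec_mulVec, ← mulVec_mulVec]
  simp only [com_mulVec]
  rfl

theorem top_four_mulVec (W : Fin 4 → ℝ) (i : Fin 4) :
    D.del ξ (D.G ξ 3) W (split (Sum.inl i)) + D.G ξ 2 (D.act ξ 2 W) (split (Sum.inl i))
      + D.G ξ 1 (D.act ξ 3 W) (split (Sum.inl i)) + D.act ξ 4 W i
      - (1 / 12 : ℝ) * (D.del ξ (D.del ξ (D.H ξ 2)) W (split (Sum.inl i))
        + D.del ξ (fun W => D.H ξ 1 (D.act ξ 2 W)) W (split (Sum.inl i))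
        + D.del ξ (D.H ξ 1) (D.act ξ 2 W) (split (Sum.inl i))) = 0 := by
  have h := D.top_four ξ D.isUnit_M_det
  set X := com (D.Lam ξ) (sym ξ (D.alpha 1)) (D.mid ξ 3) + D.mid ξ 2 * sym ξ (D.alpha 2)
      + D.mid ξ 1 * sym ξ (D.alpha 3) + D.mid ξ 0 * sym ξ (D.alpha 4)
      - (1 / 12 : ℝ) • (com (D.Lam ξ) (sym ξ (D.alpha 1))
          (com (D.Lam ξ) (sym ξ (D.alpha 1)) (D.jump ξ 2))
        + com (D.Lam ξ) (sym ξ (D.alpha 1)) (D.jump ξ 1 * sym ξ (D.alpha 2))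
        + com (D.Lam ξ) (sym ξ (D.alpha 1)) (D.jump ξ 1) * sym ξ (D.alpha 2)) with hX
  have h0 : ((X *ᵥ W) ∘ split.symm) (split (Sum.inl i)) = 0 := by
    rw [Function.comp_apply, Equiv.symm_apply_apply]
    have : ∀ j, X (Sum.inl i) j = 0 := fun j => congr_fun (congr_fun h i) j
    simp [mulVec, dotProduct, this]
  rw [← h0, hX, sub_mulVec, add_mulVec, add_mulVec, add_mulVec, Pi.sub_comp, Pi.add_comp,
    Pi.add_comp, Pi.add_comp, com_mulVec, smul_mulVec, Pi.smul_comp, add_mulVec, add_mulVec,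
    Pi.add_comp, Pi.add_comp, com_mulVec, com_mulVec, ← mulVec_mulVec, ← mulVec_mulVec,
    ← mulVec_mulVec, ← mulVec_mulVec, com_mulVec]
  simp only [com_mulVec, ← mulVec_mulVec]
  rw [← D.G_zero_low ξ (D.act ξ 4 W) i]
  rfl

/-- On the conserved rows every jump vanishes and `G 0` is the identity, so the jump equation can be
solved for the newest `act`. The same argument gives the next two orders; the fourth uses
`top_four_mulVec`. -/
theorem act_one (W : Fin 4 → ℝ) (i : Fin 4) :
    D.act ξ 1 W i = -flux D.lam ξ (D.G ξ 0 W) (split (Sum.inl i)) := by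
  have h := D.H_low ξ 0 W i
  rw [zero_add, H_one, del_apply, G_zero_low] at h
  linarith

theorem act_two (W : Fin 4 → ℝ) (i : Fin 4) :
    D.act ξ 2 W i = -flux D.lam ξ (D.G ξ 1 W) (split (Sum.inl i)) := by
  have h := D.H_low ξ 1 W i
  rw [show 1 + 1 = 2 from rfl, H_two, Pi.add_apply, del_apply, G_zero_low, D.G_low ξ 0] at h
  linarith

theorem act_three (W : Fin 4 → ℝ) (i : Fin 4) :
    D.act ξ 3 W i = -flux D.lam ξ (D.G ξ 2 W) (split (Sum.inl i))
      + 1 / 12 * (flux D.lam ξ (D.H ξ 1 (D.act ξ 1 W)) (split (Sum.inl i))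
        + flux D.lam ξ (D.del ξ (D.H ξ 1) W) (split (Sum.inl i))) := by
  have h := D.H_low ξ 2 W i
  rw [show 2 + 1 = 3 from rfl, H_three, Pi.sub_apply, Pi.add_apply, Pi.add_apply, Pi.smul_apply,
    del_apply, del_apply, del_apply, G_zero_low, D.G_low ξ 0, D.G_low ξ 1, D.H_low ξ 0,
    smul_eq_mul] at h
  linarith

theorem act_four (W : Fin 4 → ℝ) (i : Fin 4) :
    D.act ξ 4 W i = -flux D.lam ξ (D.G ξ 3 W) (split (Sum.inl i))
      + 1 / 12 * (flux D.lam ξ (D.H ξ 2 (D.act ξ 1 W)) (split (Sum.inl i))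
        + flux D.lam ξ (D.del ξ (D.H ξ 2) W) (split (Sum.inl i))
        + 2 * flux D.lam ξ (D.H ξ 1 (D.act ξ 2 W)) (split (Sum.inl i))) := by
  have h := D.top_four_mulVec ξ W i
  simp only [del_apply, D.G_low ξ 0, D.G_low ξ 1, D.G_low ξ 2, D.H_low ξ 0, D.H_low ξ 1] at h
  linarith

end LBM.D3Q19

/-! ### Rotation invariant operators and separation of the orders -/

namespace LBM

open Matrix

/-- The components of the vector product `ξ × J`, for `W = (ρ, J)`. -/
def cross (ξ : Fin 3 → ℝ) (W : Fin 4 → ℝ) (k : Fin 3) : ℝ :=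
  ![ξ 1 * W 3 - ξ 2 * W 2, ξ 2 * W 1 - ξ 0 * W 3, ξ 0 * W 2 - ξ 1 * W 1] k

open D3Q19 in
theorem acousticOp_mulVec_zero (ξ : Fin 3 → ℝ) (a b d m e f : DOp) (W : Fin 4 → ℝ) :
    (sym ξ (acousticOp a b d m e f) *ᵥ W) 0 =
      a.eval ξ * W 0 + b.eval ξ * ∑ l, ξ l * W l.succ := by
  simp [mulVec, dotProduct, Fin.sum_univ_succ, sym, acousticOp, pd]
  ring

open D3Q19 in
theorem acousticOp_mulVec_succ (ξ : Fin 3 → ℝ) (a b d m e f : DOp) (W : Fin 4 → ℝ) (k : Fin 3) :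
    (sym ξ (acousticOp a b d m e f) *ᵥ W) k.succ =
      d.eval ξ * ξ k * W 0 + m.eval ξ * W k.succ + e.eval ξ * ξ k * (∑ l, ξ l * W l.succ)
        + f.eval ξ * cross ξ W k := by
  have h0 : acousticOp a b d m e f k.succ 0 = d * pd k := rfl
  have h1 : ∀ l : Fin 3, acousticOp a b d m e f k.succ l.succ =
    (if k = l then m else 0) + e * pd k * pd l + f * curlOp k l := fun _ => rfl
  simp only [mulVec, dotProduct, sym, map_apply]
  rw [Fin.sum_univ_succ]
  simp only [h0, h1, Fin.sum_univ_three]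
  fin_cases k <;> simp [pd, curlOp, cross] <;> ring

theorem eval_lap (ξ : Fin 3 → ℝ) : lap.eval ξ = ∑ i, ξ i ^ 2 := by
  simp [lap, pd]

theorem eval_aeval_lap (ξ : Fin 3 → ℝ) (p : Polynomial ℝ) :
    MvPolynomial.eval ξ (Polynomial.aeval lap p) = p.eval (∑ i, ξ i ^ 2) := by
  rw [Polynomial.aeval_def, Polynomial.hom_eval₂, eval_lap, Polynomial.eval]
  congr 1
  ext r
  simp

theorem isRotationInvariantOp_isoOp4 (c0sq μ ζ ξ χ η μ4 ζ4 : ℝ) :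
    IsRotationInvariantOp (isoOp4 c0sq μ ζ ξ χ η μ4 ζ4) := by
  open Polynomial in
  refine ⟨C η * X ^ 2, 1 + C ξ * X, C c0sq + C χ * X, -(C μ * X) + C μ4 * X ^ 2,
    -C ζ + C ζ4 * X, 0, ?_⟩
  simp [isoOp4, MvPolynomial.smul_eq_C_mul, MvPolynomial.algebraMap_eq]

namespace D3Q19

theorem eq_of_sym_mulVec {P Q : Matrix (Fin 4) (Fin 4) DOp}
    (h : ∀ ξ W, sym ξ P *ᵥ W = sym ξ Q *ᵥ W) : P = Q := by
  ext1 i j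
  refine MvPolynomial.funext fun ξ => ?_
  have := congr_fun (h ξ (Pi.single j 1)) i
  simpa [sym] using this

variable (D : D3Q19) (ξ : Fin 3 → ℝ)

theorem sym_sum {ι m n : Type*} (s : Finset ι) (X : ι → Matrix m n DOp) :
    sym ξ (∑ i ∈ s, X i) = ∑ i ∈ s, sym ξ (X i) := by
  ext
  simp [sym, Matrix.sum_apply]

theorem sym_equivOp_mulVec (l : ℕ) (W : Fin 4 → ℝ) : sym ξ (D.equivOp l) *ᵥ W =
    -∑ j ∈ Finset.Icc 1 l, D.dt ^ (j - 1) • D.act ξ j W := by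
  rw [equivOp, sym_neg, sym_sum, neg_mulVec, sum_mulVec]
  simp only [sym_smul, smul_mulVec, act]

theorem equivOp_eq_isoOp4 (l : ℕ) (c0sq μ ζ ξ' χ η μ4 ζ4 : ℝ)
    (h0 : ∀ (ξ : Fin 3 → ℝ) (W : Fin 4 → ℝ), -∑ j ∈ Finset.Icc 1 l, D.dt ^ (j - 1) * D.act ξ j W 0 =
      η * (∑ i, ξ i ^ 2) ^ 2 * W 0 + (1 + ξ' * ∑ i, ξ i ^ 2) * ∑ l, ξ l * W l.succ)
    (h1 : ∀ (ξ : Fin 3 → ℝ) (W : Fin 4 → ℝ) (k : Fin 3),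
      -∑ j ∈ Finset.Icc 1 l, D.dt ^ (j - 1) * D.act ξ j W k.succ =
      (c0sq + χ * ∑ i, ξ i ^ 2) * ξ k * W 0
        + (-(μ * ∑ i, ξ i ^ 2) + μ4 * (∑ i, ξ i ^ 2) ^ 2) * W k.succ
        + (-ζ + ζ4 * ∑ i, ξ i ^ 2) * ξ k * ∑ l, ξ l * W l.succ) :
    D.equivOp l = isoOp4 c0sq μ ζ ξ' χ η μ4 ζ4 := by
  refine eq_of_sym_mulVec fun ξ W => ?_
  rw [sym_equivOp_mulVec]
  ext i
  rw [Pi.neg_apply, Finset.sum_apply]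
  simp only [Pi.smul_apply, smul_eq_mul]
  refine Fin.cases ?_ (fun k => ?_) i
  · rw [h0, isoOp4, acousticOp_mulVec_zero]
    simp [MvPolynomial.smul_eval, eval_lap]
  · rw [h1, isoOp4, acousticOp_mulVec_succ]
    simp [MvPolynomial.smul_eval, eval_lap]

section homogeneity

variable (t : ℝ)

/-- `Λ` is linear in `ξ`. The resulting degree count propagates through the recursion and shows that
`α_l` is homogeneous of degree `l`, which is what separates the orders in a truncated equation. -/
theorem sym_smul_taylor (n : ℕ) : sym (t • ξ) (D.taylor n) = t ^ n • sym ξ (D.taylor n) := by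
  rw [sym_taylor _ _ D.isUnit_M_det, sym_taylor _ _ D.isUnit_M_det]
  have : D.Lam (t • ξ) = t • D.Lam ξ := by
    have hd : diagonal (fun j => -∑ a, D.vel j a * (t • ξ) a) =
        t • diagonal (fun j => -∑ a, D.vel j a * ξ a) := by
      rw [← diagonal_smul]
      congr 1
      funext j
      simp [Fin.sum_univ_three]
      ring
    rw [Lam, hd, Matrix.mul_smul, Matrix.smul_mul]
    rfl
  rw [this, smul_pow, Matrix.smul_mul, smul_comm]

theorem sym_smul_blocks (n : ℕ) : sym (t • ξ) (D.A n) = t ^ n • sym ξ (D.A n) ∧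
    sym (t • ξ) (D.B n) = t ^ n • sym ξ (D.B n) ∧
    sym (t • ξ) (D.C n) = t ^ n • sym ξ (D.C n) ∧
    sym (t • ξ) (D.Dm n) = t ^ n • sym ξ (D.Dm n) := by
  have h := D.sym_smul_taylor ξ t n
  rw [sym_taylor_blocks, sym_taylor_blocks, fromBlocks_smul, fromBlocks_inj] at h
  exact h

theorem S_cancel {X Y : Matrix (Fin 15) (Fin 4) ℝ} (h : D.S * X = D.S * Y) : X = Y := by
  have := congr_arg (D.S⁻¹ * ·) h
  simpa [← Matrix.mul_assoc, nonsing_inv_mul _ D.isUnit_S_det] using this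

theorem sym_smul_beta_zero : sym (t • ξ) (D.beta 0) = sym ξ (D.beta 0) := by
  rw [beta_zero, sym_C, sym_C]

theorem sym_smul_alpha_one : sym (t • ξ) (D.alpha 1) = t • sym ξ (D.alpha 1) := by
  simp only [alpha_one, sym_add, sym_mul, D.sym_smul_blocks ξ t, sym_smul_beta_zero,
    Matrix.smul_mul]
  module

theorem sym_smul_beta_one : sym (t • ξ) (D.beta 1) = t • sym ξ (D.beta 1) := by
  apply D.S_cancel
  have h := fun ξ => congr_arg (sym ξ) D.S_mul_beta_one
  simp only [sym_mul, sym_C, sym_add, sym_sub] at h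
  rw [h, Matrix.mul_smul, h]
  simp only [D.sym_smul_blocks ξ t, sym_smul_beta_zero, sym_smul_alpha_one, Matrix.smul_mul,
    Matrix.mul_smul]
  module

theorem sym_smul_alpha_two : sym (t • ξ) (D.alpha 2) = t ^ 2 • sym ξ (D.alpha 2) := by
  simp only [alpha_two, sym_add, sym_sub, sym_smul, sym_mul, D.sym_smul_blocks ξ t,
    sym_smul_beta_zero, sym_smul_beta_one, sym_smul_alpha_one, Matrix.smul_mul, Matrix.mul_smul]
  module

theorem sym_smul_beta_two : sym (t • ξ) (D.beta 2) = t ^ 2 • sym ξ (D.beta 2) := by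
  apply D.S_cancel
  have h := fun ξ => congr_arg (sym ξ) D.S_mul_beta_two
  simp only [sym_mul, sym_C, sym_add, sym_sub, sym_smul] at h
  rw [h, Matrix.mul_smul, h]
  simp only [D.sym_smul_blocks ξ t, sym_smul_beta_zero, sym_smul_beta_one, sym_smul_alpha_one,
    sym_smul_alpha_two, Matrix.smul_mul, Matrix.mul_smul]
  module

theorem sym_smul_alpha_three : sym (t • ξ) (D.alpha 3) = t ^ 3 • sym ξ (D.alpha 3) := by
  simp only [alpha_three, sym_add, sym_sub, sym_smul, sym_mul, D.sym_smul_blocks ξ t,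
    sym_smul_beta_zero, sym_smul_beta_one, sym_smul_beta_two, sym_smul_alpha_one,
    sym_smul_alpha_two, Matrix.smul_mul, Matrix.mul_smul]
  module

theorem sym_smul_beta_three : sym (t • ξ) (D.beta 3) = t ^ 3 • sym ξ (D.beta 3) := by
  apply D.S_cancel
  have h := fun ξ => congr_arg (sym ξ) D.S_mul_beta_three
  simp only [sym_mul, sym_C, sym_add, sym_sub, sym_smul] at h
  rw [h, Matrix.mul_smul, h]
  simp only [D.sym_smul_blocks ξ t, sym_smul_beta_zero, sym_smul_beta_one, sym_smul_beta_two,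
    sym_smul_alpha_one, sym_smul_alpha_two, sym_smul_alpha_three, Matrix.smul_mul,
    Matrix.mul_smul, Matrix.mul_add]
  module

theorem sym_smul_alpha_four : sym (t • ξ) (D.alpha 4) = t ^ 4 • sym ξ (D.alpha 4) := by
  simp only [alpha_four, sym_add, sym_sub, sym_smul, sym_mul, D.sym_smul_blocks ξ t,
    sym_smul_beta_zero, sym_smul_beta_one, sym_smul_beta_two, sym_smul_beta_three,
    sym_smul_alpha_one, sym_smul_alpha_two, sym_smul_alpha_three, Matrix.smul_mul,
    Matrix.mul_smul]
  module

theorem act_smul {l : ℕ} (h1 : 1 ≤ l) (h4 : l ≤ 4) (W : Fin 4 → ℝ) :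
    D.act (t • ξ) l W = t ^ l • D.act ξ l W := by
  rw [act, act, ← smul_mulVec]
  congr 1
  interval_cases l
  · rw [pow_one, sym_smul_alpha_one]
  · exact D.sym_smul_alpha_two ξ t
  · exact D.sym_smul_alpha_three ξ t
  · exact D.sym_smul_alpha_four ξ t

end homogeneity

open Polynomial in
theorem coeff_expand_comp (p : ℝ[X]) (c : ℝ) (l : ℕ) :
    (expand ℝ 2 (p.comp (Polynomial.C c * X))).coeff l = if 2 ∣ l then p.coeff (l / 2) * c ^ (l / 2) else 0 := by
  rw [coeff_expand (by norm_num), comp_C_mul_X_coeff]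

open Polynomial in
theorem eval_expand_comp (p : ℝ[X]) (c t : ℝ) :
    (expand ℝ 2 (p.comp (Polynomial.C c * X))).eval t = p.eval (c * t ^ 2) := by
  simp [expand_eval]

-- With `tξ` in place of `ξ`, both sides of the invariance condition are polynomials in `t`, and
-- `α_l` is found at `t^l`. `Δ^k` contributes `t^(2k)` while `∇`, `div` and `curl` contribute one
-- further `t` each, whence the parity conditions.
open Polynomial in
theorem act_of_rotationInvariant {L : ℕ} (hL : L ≤ 4) (h : D.RotationInvariantAtOrder L) :
    ∃ a b d m e f : ℝ[X], ∀ l, 1 ≤ l → l ≤ L → ∀ (ξ : Fin 3 → ℝ) (W : Fin 4 → ℝ),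
      D.dt ^ (l - 1) * D.act ξ l W 0 =
        (if 2 ∣ l then a.coeff (l / 2) * (∑ i, ξ i ^ 2) ^ (l / 2) else 0) * W 0
        + (if 2 ∣ l - 1 then b.coeff ((l - 1) / 2) * (∑ i, ξ i ^ 2) ^ ((l - 1) / 2) else 0)
          * ∑ i, ξ i * W i.succ ∧
      ∀ k : Fin 3, D.dt ^ (l - 1) * D.act ξ l W k.succ =
        (if 2 ∣ l - 1 then d.coeff ((l - 1) / 2) * (∑ i, ξ i ^ 2) ^ ((l - 1) / 2) else 0)
          * (ξ k * W 0)
        + (if 2 ∣ l then m.coeff (l / 2) * (∑ i, ξ i ^ 2) ^ (l / 2) else 0) * W k.succ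
        + (if 2 ∣ l ∧ 2 ≤ l then e.coeff ((l - 2) / 2) * (∑ i, ξ i ^ 2) ^ ((l - 2) / 2) else 0)
          * (ξ k * ∑ i, ξ i * W i.succ)
        + (if 2 ∣ l - 1 then f.coeff ((l - 1) / 2) * (∑ i, ξ i ^ 2) ^ ((l - 1) / 2) else 0)
          * cross ξ W k := by
  obtain ⟨a, b, d, m, e, f, hP⟩ := h
  -- The operator `P` stands on the left of `∂_t W + P W = 0`, so its coefficients change sign in
  -- `α`.
  refine ⟨-a, -b, -d, -m, -e, -f, fun l h1 hl ξ W => ?_⟩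
  set n := ∑ i, ξ i ^ 2 with hn
  have hact : ∀ (t : ℝ) (i : Fin 4), -∑ j ∈ Finset.Icc 1 L, D.dt ^ (j - 1) * (t ^ j * D.act ξ j W i)
      = (sym (t • ξ) (D.equivOp L) *ᵥ W) i := by
    intro t i
    rw [sym_equivOp_mulVec, Pi.neg_apply, Finset.sum_apply]
    congr 1
    refine Finset.sum_congr rfl fun j hj => ?_
    have := Finset.mem_Icc.1 hj
    rw [D.act_smul ξ t this.1 (this.2.trans hL)]
    rfl
  have hnt : ∀ t : ℝ, ∑ i, (t • ξ) i ^ 2 = n * t ^ 2 := by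
    intro t
    simp only [hn, Pi.smul_apply, smul_eq_mul, mul_pow, ← Finset.mul_sum, mul_comm]
  have hdt : ∀ t : ℝ, ∑ i, (t • ξ) i * W i.succ = t * ∑ i, ξ i * W i.succ := by
    intro t
    simp only [Pi.smul_apply, smul_eq_mul, mul_assoc, ← Finset.mul_sum]
  have hcr : ∀ (t : ℝ) (k : Fin 3), cross (t • ξ) W k = t * cross ξ W k := by
    intro t k
    fin_cases k <;> simp [cross] <;> ring
  have hcoeff : ∀ i : Fin 4, (-∑ j ∈ Finset.Icc 1 L, Polynomial.C (D.dt ^ (j - 1) * D.act ξ j W i) * X ^ j).coeff l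
      = -(D.dt ^ (l - 1) * D.act ξ l W i) := by
    intro i
    simp only [coeff_neg, finsetSum_coeff, coeff_C_mul, coeff_X_pow, mul_ite, mul_one, mul_zero]
    rw [Finset.sum_ite_eq, if_pos (Finset.mem_Icc.2 ⟨h1, hl⟩)]
  have hX : ∀ p : ℝ[X], ((expand ℝ 2 (p.comp (Polynomial.C n * X))) * X).coeff l =
      if 2 ∣ l - 1 then p.coeff ((l - 1) / 2) * n ^ ((l - 1) / 2) else 0 := by
    intro p
    obtain ⟨l, rfl⟩ := Nat.exists_eq_add_of_le' h1
    rw [coeff_mul_X, coeff_expand_comp, Nat.add_sub_cancel]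
  have hXX : ∀ p : ℝ[X], ((expand ℝ 2 (p.comp (Polynomial.C n * X))) * X ^ 2).coeff l =
      if 2 ∣ l ∧ 2 ≤ l then p.coeff ((l - 2) / 2) * n ^ ((l - 2) / 2) else 0 := by
    intro p
    rw [coeff_mul_X_pow', coeff_expand_comp]
    by_cases h2 : 2 ≤ l
    · have : 2 ∣ l - 2 ↔ 2 ∣ l := by omega
      simp [h2, this]
    · simp [h2]
  constructor
  -- `expand ℝ 2 (p.comp (C n * X))` is the polynomial `t ↦ p(n t²)`, the symbol of `p(Δ)` at `tξ`.
  · have key : -∑ j ∈ Finset.Icc 1 L, Polynomial.C (D.dt ^ (j - 1) * D.act ξ j W 0) * X ^ j =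
        Polynomial.C (W 0) * expand ℝ 2 (a.comp (Polynomial.C n * X))
        + Polynomial.C (∑ i, ξ i * W i.succ) * (expand ℝ 2 (b.comp (Polynomial.C n * X)) * X) := by
      refine Polynomial.funext fun t => ?_
      have := hact t 0
      rw [hP, acousticOp_mulVec_zero, eval_aeval_lap, eval_aeval_lap, hnt, hdt] at this
      simp only [eval_neg, eval_finsetSum, eval_add, eval_mul, eval_C, eval_pow, eval_X,
        eval_expand_comp]
      rw [← sub_eq_zero] at this ⊢
      rw [← this]
      simp only [mul_assoc, mul_comm (D.act ξ _ W 0)]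
      ring
    have := congr_arg (fun p => coeff p l) key
    simp only [hcoeff, coeff_add, coeff_C_mul, hX, coeff_expand_comp] at this
    simp only [coeff_neg, neg_mul]
    rw [neg_eq_iff_eq_neg] at this
    rw [this]
    split_ifs <;> ring
  · intro k
    have key : -∑ j ∈ Finset.Icc 1 L, Polynomial.C (D.dt ^ (j - 1) * D.act ξ j W k.succ) * X ^ j =
        Polynomial.C (ξ k * W 0) * (expand ℝ 2 (d.comp (Polynomial.C n * X)) * X)
        + Polynomial.C (W k.succ) * expand ℝ 2 (m.comp (Polynomial.C n * X))
        + Polynomial.C (ξ k * ∑ i, ξ i * W i.succ) * (expand ℝ 2 (e.comp (Polynomial.C n * X)) * X ^ 2)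
        + Polynomial.C (cross ξ W k) * (expand ℝ 2 (f.comp (Polynomial.C n * X)) * X) := by
      refine Polynomial.funext fun t => ?_
      have := hact t k.succ
      rw [hP, acousticOp_mulVec_succ, eval_aeval_lap, eval_aeval_lap, eval_aeval_lap,
        eval_aeval_lap, hnt, hdt, hcr] at this
      simp only [eval_neg, eval_finsetSum, eval_add, eval_mul, eval_C, eval_pow, eval_X,
        eval_expand_comp]
      rw [← sub_eq_zero] at this ⊢
      rw [← this]
      simp only [mul_assoc, mul_comm (D.act ξ _ W k.succ), Pi.smul_apply, smul_eq_mul]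
      ring
    have := congr_arg (fun p => coeff p l) key
    simp only [hcoeff, coeff_add, coeff_C_mul, hX, hXX, coeff_expand_comp] at this
    simp only [coeff_neg, neg_mul]
    rw [neg_eq_iff_eq_neg] at this
    rw [this]
    split_ifs <;> ring

theorem act_one_of_rotationInvariant (h : D.RotationInvariantAtOrder 1) :
    ∃ b d f : ℝ, ∀ (ξ : Fin 3 → ℝ) (W : Fin 4 → ℝ), D.act ξ 1 W 0 = b * ∑ i, ξ i * W i.succ ∧
      ∀ k : Fin 3, D.act ξ 1 W k.succ = d * (ξ k * W 0) + f * cross ξ W k := by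
  obtain ⟨a, b, d, m, e, f, h⟩ := D.act_of_rotationInvariant (by norm_num) h
  refine ⟨b.coeff 0, d.coeff 0, f.coeff 0, fun ξ W => ?_⟩
  simpa using h 1 le_rfl le_rfl ξ W

theorem act_three_of_rotationInvariant (h : D.RotationInvariantAtOrder 4) :
    ∃ b : ℝ, ∀ (ξ : Fin 3 → ℝ) (W : Fin 4 → ℝ),
      D.act ξ 3 W 0 = b * (∑ i, ξ i ^ 2) * ∑ i, ξ i * W i.succ := by
  obtain ⟨a, b, d, m, e, f, h⟩ := D.act_of_rotationInvariant le_rfl h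
  have hd := D.dt_pos.ne'
  refine ⟨b.coeff 1 / D.dt ^ 2, fun ξ W => ?_⟩
  have h3 := (h 3 (by norm_num) (by norm_num) ξ W).1
  norm_num at h3
  field_simp
  linarith

theorem act_four_of_rotationInvariant (h : D.RotationInvariantAtOrder 4) :
    ∃ a m e : ℝ, ∀ (ξ : Fin 3 → ℝ) (W : Fin 4 → ℝ),
      D.act ξ 4 W 0 = a * (∑ i, ξ i ^ 2) ^ 2 * W 0 ∧
      ∀ k : Fin 3, D.act ξ 4 W k.succ = m * (∑ i, ξ i ^ 2) ^ 2 * W k.succ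
        + e * (∑ i, ξ i ^ 2) * (ξ k * ∑ i, ξ i * W i.succ) := by
  obtain ⟨a, b, d, m, e, f, h⟩ := D.act_of_rotationInvariant le_rfl h
  have hd := D.dt_pos.ne'
  refine ⟨a.coeff 2 / D.dt ^ 3, m.coeff 2 / D.dt ^ 3, e.coeff 1 / D.dt ^ 3, fun ξ W => ?_⟩
  have h4 := h 4 (by norm_num) le_rfl ξ W
  norm_num at h4
  refine ⟨?_, fun k => ?_⟩
  · field_simp
    linarith [h4.1]
  · have := h4.2 k
    field_simp
    linarith

end D3Q19

end LBM

/-! ### Order one -/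

namespace LBM.D3Q19

open Matrix

variable (D : D3Q19) (ξ : Fin 3 → ℝ)

theorem G_zero_eq (W : Fin 4 → ℝ) : D.G ξ 0 W = ![W 0, W 1, W 2, W 3, D.meq 4 ⬝ᵥ W, D.meq 5 ⬝ᵥ W,
    D.meq 6 ⬝ᵥ W, D.meq 7 ⬝ᵥ W, D.meq 8 ⬝ᵥ W, D.meq 9 ⬝ᵥ W, D.meq 10 ⬝ᵥ W, D.meq 11 ⬝ᵥ W,
    D.meq 12 ⬝ᵥ W, D.meq 13 ⬝ᵥ W, D.meq 14 ⬝ᵥ W, D.meq 15 ⬝ᵥ W, D.meq 16 ⬝ᵥ W, D.meq 17 ⬝ᵥ W,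
    D.meq 18 ⬝ᵥ W] := by
  funext k
  obtain ⟨k | l, rfl⟩ := split.surjective k
  · rw [G_zero_low]
    fin_cases k <;> rfl
  · rw [G_zero_high]
    fin_cases l <;> rfl

theorem G_succ_eq (n : ℕ) (W : Fin 4 → ℝ) : D.G ξ (n + 1) W = ![0, 0, 0, 0,
    -D.sigma 4 * D.H ξ (n + 1) W 4, -D.sigma 5 * D.H ξ (n + 1) W 5,
    -D.sigma 6 * D.H ξ (n + 1) W 6, -D.sigma 7 * D.H ξ (n + 1) W 7,
    -D.sigma 8 * D.H ξ (n + 1) W 8, -D.sigma 9 * D.H ξ (n + 1) W 9,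
    -D.sigma 10 * D.H ξ (n + 1) W 10, -D.sigma 11 * D.H ξ (n + 1) W 11,
    -D.sigma 12 * D.H ξ (n + 1) W 12, -D.sigma 13 * D.H ξ (n + 1) W 13,
    -D.sigma 14 * D.H ξ (n + 1) W 14, -D.sigma 15 * D.H ξ (n + 1) W 15,
    -D.sigma 16 * D.H ξ (n + 1) W 16, -D.sigma 17 * D.H ξ (n + 1) W 17,
    -D.sigma 18 * D.H ξ (n + 1) W 18] := by
  funext k
  obtain ⟨k | l, rfl⟩ := split.surjective k
  · rw [G_low]
    fin_cases k <;> rfl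
  · rw [G_high]
    fin_cases l <;> rfl

theorem H_succ_zero (n : ℕ) (W : Fin 4 → ℝ) : D.H ξ (n + 1) W 0 = 0 := D.H_low ξ n W 0
theorem H_succ_one (n : ℕ) (W : Fin 4 → ℝ) : D.H ξ (n + 1) W 1 = 0 := D.H_low ξ n W 1
theorem H_succ_two (n : ℕ) (W : Fin 4 → ℝ) : D.H ξ (n + 1) W 2 = 0 := D.H_low ξ n W 2
theorem H_succ_three (n : ℕ) (W : Fin 4 → ℝ) : D.H ξ (n + 1) W 3 = 0 := D.H_low ξ n W 3

theorem act_one_zero (W : Fin 4 → ℝ) :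
    D.act ξ 1 W 0 = -(ξ 0 * W 1 + ξ 1 * W 2 + ξ 2 * W 3) := by
  rw [act_one]
  change -flux D.lam ξ (D.G ξ 0 W) 0 = _
  rw [flux_0, G_zero_eq]
  simp

theorem act_one_succ (W : Fin 4 → ℝ) :
    D.act ξ 1 W 1 = -(ξ 0 * (10 / 19 * D.lam ^ 2 * W 0 + D.meq 4 ⬝ᵥ W / 57 + D.meq 5 ⬝ᵥ W / 3)
      + ξ 1 * D.meq 7 ⬝ᵥ W + ξ 2 * D.meq 9 ⬝ᵥ W) ∧
    D.act ξ 1 W 2 = -(ξ 0 * D.meq 7 ⬝ᵥ W + ξ 1 * (10 / 19 * D.lam ^ 2 * W 0 + D.meq 4 ⬝ᵥ W / 57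
      - D.meq 5 ⬝ᵥ W / 6 + D.meq 6 ⬝ᵥ W / 2) + ξ 2 * D.meq 8 ⬝ᵥ W) ∧
    D.act ξ 1 W 3 = -(ξ 0 * D.meq 9 ⬝ᵥ W + ξ 1 * D.meq 8 ⬝ᵥ W + ξ 2 * (10 / 19 * D.lam ^ 2 * W 0
      + D.meq 4 ⬝ᵥ W / 57 - D.meq 5 ⬝ᵥ W / 6 - D.meq 6 ⬝ᵥ W / 2)) := by
  rw [act_one, act_one, act_one]
  change -flux D.lam ξ (D.G ξ 0 W) 1 = _ ∧ -flux D.lam ξ (D.G ξ 0 W) 2 = _ ∧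
    -flux D.lam ξ (D.G ξ 0 W) 3 = _
  rw [flux_1, flux_2, flux_3, G_zero_eq]
  simp

theorem order1Cond_of_rotationInvariant (h : D.RotationInvariantAtOrder 1) :
    ∃ a, D.Order1Cond a := by
  obtain ⟨b, d, f, h⟩ := D.act_one_of_rotationInvariant h
  have hl := D.lam_pos.ne'
  have e1 := fun ξ W => (h ξ W).2 0
  have e2 := fun ξ W => (h ξ W).2 1
  have e3 := fun ξ W => (h ξ W).2 2
  simp only [Fin.succ_zero_eq_one, Fin.succ_one_eq_two, show Fin.succ (2 : Fin 3) = 3 from rfl,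
    act_one_succ] at e1 e2 e3
  have hx1 := e1 ![1, 0, 0]
  have hx2 := e2 ![1, 0, 0]
  have hx3 := e3 ![1, 0, 0]
  have hy1 := e1 ![0, 1, 0]
  have hy2 := e2 ![0, 1, 0]
  have hy3 := e3 ![0, 1, 0]
  have hz1 := e1 ![0, 0, 1]
  have hz2 := e2 ![0, 0, 1]
  have hz3 := e3 ![0, 0, 1]
  simp [cross] at hx1 hx2 hx3 hy1 hy2 hy3 hz1 hz2 hz3
  have ext0 : ∀ k, (∀ W, D.meq k ⬝ᵥ W = 0) → D.meq k = 0 := fun k hk => by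
    funext i
    simpa using hk (Pi.single i 1)
  -- The value of `a` solves `(a + 30) / 57 * λ² = -d`.
  refine ⟨-(57 * d + 30 * D.lam ^ 2) / D.lam ^ 2, ?_, ext0 5 fun W => ?_, ext0 6 fun W => ?_,
    ext0 7 fun W => ?_, ext0 8 fun W => ?_, ext0 9 fun W => ?_⟩
  · rw [EqRho, div_mul_cancel₀ _ (pow_ne_zero 2 hl)]
    funext i
    have h1 := hx1 (Pi.single i 1)
    have h2 := hy2 (Pi.single i 1)
    have h3 := hz3 (Pi.single i 1)
    simp only [dotProduct_single, mul_one] at h1 h2 h3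
    have h4 : D.meq 4 i = -(57 * d + 30 * D.lam ^ 2) * (Pi.single i 1 : Fin 4 → ℝ) 0 := by
      linarith
    rw [h4]
    fin_cases i <;> simp
  -- The momentum flux is symmetric while the curl is antisymmetric: each off-diagonal equilibrium
  -- occurs twice with opposite curl terms and so vanishes. The three diagonal entries must agree,
  -- which removes `XX` and `WW`.
  all_goals linarith [hx1 W, hx2 W, hx3 W, hy1 W, hy2 W, hy3 W, hz1 W, hz2 W, hz3 W]

theorem single_dotProduct_zero (c : ℝ) (W : Fin 4 → ℝ) :
    (Pi.single 0 c : Fin 4 → ℝ) ⬝ᵥ W = c * W 0 := by simp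

variable {D} in
theorem Order1Cond.act {a : ℝ} (h : D.Order1Cond a) (W : Fin 4 → ℝ) : D.act ξ 1 W =
    ![-(ξ 0 * W 1 + ξ 1 * W 2 + ξ 2 * W 3), -((a + 30) / 57 * D.lam ^ 2) * ξ 0 * W 0,
      -((a + 30) / 57 * D.lam ^ 2) * ξ 1 * W 0, -((a + 30) / 57 * D.lam ^ 2) * ξ 2 * W 0] := by
  obtain ⟨h4, h5, h6, h7, h8, h9⟩ := h
  obtain ⟨e1, e2, e3⟩ := D.act_one_succ ξ W
  rw [h4, h5, h6, h7, h8, h9] at *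
  simp only [single_dotProduct_zero, zero_dotProduct] at e1 e2 e3
  funext i
  fin_cases i
  · exact D.act_one_zero ξ W
  · simp [e1]; ring
  · simp [e2]; ring
  · simp [e3]; ring

theorem Order1Cond.equivOp {D : D3Q19} {a : ℝ} (h : D.Order1Cond a) :
    D.equivOp 1 = isoOp1 ((a + 30) / 57 * D.lam ^ 2) := by
  refine D.equivOp_eq_isoOp4 1 _ _ _ _ _ _ _ _ (fun ξ W => ?_) (fun ξ W k => ?_)
  · simp [h.act, Fin.sum_univ_three]
  · fin_cases k <;> simp [h.act]

end LBM.D3Q19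

/-! ### Order two -/

namespace LBM.D3Q19

open Matrix

variable {D : D3Q19} (ξ : Fin 3 → ℝ)

theorem H_two_apply (W : Fin 4 → ℝ) (k : Fin 19) : D.H ξ 2 W k =
    D.G ξ 1 (D.act ξ 1 W) k + flux D.lam ξ (D.G ξ 1 W) k + D.G ξ 0 (D.act ξ 2 W) k := by
  rw [H_two]; rfl

theorem H_one_apply (W : Fin 4 → ℝ) (k : Fin 19) : D.H ξ 1 W k =
    D.G ξ 0 (D.act ξ 1 W) k + flux D.lam ξ (D.G ξ 0 W) k := by
  rw [H_one]; rfl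

theorem H_three_apply (W : Fin 4 → ℝ) (k : Fin 19) : D.H ξ 3 W k =
    D.G ξ 2 (D.act ξ 1 W) k + flux D.lam ξ (D.G ξ 2 W) k + D.G ξ 1 (D.act ξ 2 W) k
      + D.G ξ 0 (D.act ξ 3 W) k - 1 / 12 * (D.del ξ (D.H ξ 1) (D.act ξ 1 W) k
        + flux D.lam ξ (D.del ξ (D.H ξ 1) W) k) := by
  rw [H_three]; rfl

/-- The equilibria of the moments `m_4, …, m_12, m_16, m_17, m_18` which occur at second order,
with `q^eq = c λ² J`. -/
structure ViscousEq (D : D3Q19) (a c : ℝ) : Prop where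
  order1 : D.Order1Cond a
  heat : D.EqHeatFlux (c * D.lam ^ 2)
  eq16 : D.meq 16 = 0
  eq17 : D.meq 17 = 0
  eq18 : D.meq 18 = 0

namespace ViscousEq

variable {a c : ℝ} (h : ViscousEq D a c)
include h

theorem G_zero (W : Fin 4 → ℝ) : D.G ξ 0 W = ![W 0, W 1, W 2, W 3, a * D.lam ^ 2 * W 0, 0, 0, 0, 0,
    0, c * D.lam ^ 2 * W 1, c * D.lam ^ 2 * W 2, c * D.lam ^ 2 * W 3, D.meq 13 ⬝ᵥ W,
    D.meq 14 ⬝ᵥ W, D.meq 15 ⬝ᵥ W, 0, 0, 0] := by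
  obtain ⟨⟨h4, h5, h6, h7, h8, h9⟩, ⟨h10, h11, h12⟩, h16, h17, h18⟩ := h
  rw [G_zero_eq, h4, h5, h6, h7, h8, h9, h10, h11, h12, h16, h17, h18]
  simp

theorem H_one_shear (W : Fin 4 → ℝ) :
    D.H ξ 1 W 4 = (21 + 19 * c - 5 * a) / 5 * D.lam ^ 2 * (ξ 0 * W 1 + ξ 1 * W 2 + ξ 2 * W 3) ∧
    D.H ξ 1 W 5 = (6 - c) / 10 * D.lam ^ 2 * (2 * ξ 0 * W 1 - ξ 1 * W 2 - ξ 2 * W 3) ∧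
    D.H ξ 1 W 6 = (6 - c) / 10 * D.lam ^ 2 * (ξ 1 * W 2 - ξ 2 * W 3) ∧
    D.H ξ 1 W 7 = (4 + c) / 10 * D.lam ^ 2 * (ξ 0 * W 2 + ξ 1 * W 1) ∧
    D.H ξ 1 W 8 = (4 + c) / 10 * D.lam ^ 2 * (ξ 1 * W 3 + ξ 2 * W 2) ∧
    D.H ξ 1 W 9 = (4 + c) / 10 * D.lam ^ 2 * (ξ 0 * W 3 + ξ 2 * W 1) := by
  simp only [H_one_apply, flux_4, flux_5, flux_6, flux_7, flux_8, flux_9, h.G_zero, h.order1.act]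
  refine ⟨?_, ?_, ?_, ?_, ?_, ?_⟩ <;> simp <;> ring

/-- The diagonal shear moments relax with `σ₅` and carry the factor `6 - c`, the off-diagonal ones
with `σ₇` and `4 + c`. The stress is isotropic when `(6 - c) σ₅ = 2 (4 + c) σ₇`, which is `hc`
rearranged. -/
theorem act_two_eq (h6 : D.sigma 6 = D.sigma 5) (h8 : D.sigma 8 = D.sigma 7)
    (h9 : D.sigma 9 = D.sigma 7)
    (hc : c * (D.sigma 5 + 2 * D.sigma 7) = 6 * D.sigma 5 - 8 * D.sigma 7)
    {M Z : ℝ} (hM : M = D.lam ^ 2 * (4 + c) * D.sigma 7 / 10)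
    (hZ : Z = D.lam ^ 2 * ((21 + 19 * c - 5 * a) * D.sigma 4 / 285
      - (6 - c) * D.sigma 5 / 30 + (4 + c) * D.sigma 7 / 10)) (W : Fin 4 → ℝ) :
    D.act ξ 2 W = ![0,
      M * (ξ 0 ^ 2 + ξ 1 ^ 2 + ξ 2 ^ 2) * W 1 + Z * ξ 0 * (ξ 0 * W 1 + ξ 1 * W 2 + ξ 2 * W 3),
      M * (ξ 0 ^ 2 + ξ 1 ^ 2 + ξ 2 ^ 2) * W 2 + Z * ξ 1 * (ξ 0 * W 1 + ξ 1 * W 2 + ξ 2 * W 3),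
      M * (ξ 0 ^ 2 + ξ 1 ^ 2 + ξ 2 ^ 2) * W 3
        + Z * ξ 2 * (ξ 0 * W 1 + ξ 1 * W 2 + ξ 2 * W 3)] := by
  obtain ⟨e4, e5, e6, e7, e8, e9⟩ := h.H_one_shear ξ W
  have hG := D.G_succ_eq ξ 0 W
  rw [zero_add, e4, e5, e6, e7, e8, e9, h6, h8, h9] at hG
  subst hM hZ
  funext i
  rw [act_two]
  fin_cases i
  · change -flux D.lam ξ (D.G ξ 1 W) 0 = _
    rw [flux_0, hG]
    simp
  · change -flux D.lam ξ (D.G ξ 1 W) 1 = _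
    rw [flux_1, hG]
    simp
    -- The only defect is the cubic-anisotropic term `ξ_k² J_k`, and it is a multiple of `hc`.
    linear_combination (-(1 / 10) * D.lam ^ 2 * ξ 0 ^ 2 * W 1) * hc
  · change -flux D.lam ξ (D.G ξ 1 W) 2 = _
    rw [flux_2, hG]
    simp
    linear_combination (-(1 / 10) * D.lam ^ 2 * ξ 1 ^ 2 * W 2) * hc
  · change -flux D.lam ξ (D.G ξ 1 W) 3 = _
    rw [flux_3, hG]
    simp
    linear_combination (-(1 / 10) * D.lam ^ 2 * ξ 2 ^ 2 * W 3) * hc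

end ViscousEq

theorem Order2Cond.viscousEq {a : ℝ} (h : D.Order2Cond a) : ViscousEq D a
    (2 * ((3 * D.sigma 5 - 4 * D.sigma 7) / (D.sigma 5 + 2 * D.sigma 7))) :=
  ⟨h.1, h.2.2.1, h.2.2.2.1, h.2.2.2.2.1, h.2.2.2.2.2.1⟩

theorem lam_mul_dt : D.dx = D.lam * D.dt := by
  rw [lam, div_mul_cancel₀ _ D.dt_pos.ne']

theorem Order2Cond.equivOp {a : ℝ} (h : D.Order2Cond a) : D.equivOp 2 =
    isoOp2 ((a + 30) / 57 * D.lam ^ 2)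
      (D.sigma 5 * D.sigma 7 / (D.sigma 5 + 2 * D.sigma 7) * D.lam * D.dx)
      (D.lam * D.dx / (57 * (D.sigma 5 + 2 * D.sigma 7)) *
          (27 * D.sigma 4 * D.sigma 5 + 19 * D.sigma 5 * D.sigma 7 - 22 * D.sigma 4 * D.sigma 7
            - a * D.sigma 4 * D.sigma 5 - 2 * a * D.sigma 4 * D.sigma 7)) := by
  have hV := h.viscousEq
  obtain ⟨h1, hs, -, -, -, -, h56, h78, h89⟩ := h
  have act2 := fun ξ => hV.act_two_eq ξ h56.symm h78.symm (h78.trans h89).symm (by field_simp; ring)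
    rfl rfl
  refine D.equivOp_eq_isoOp4 2 _ _ _ _ _ _ _ _ (fun ξ W => ?_) (fun ξ W k => ?_)
  · simp [Finset.sum_Icc_succ_top, h1.act, act2, Fin.sum_univ_three]
  · fin_cases k <;>
      simp [Finset.sum_Icc_succ_top, h1.act, act2, Fin.sum_univ_three, lam_mul_dt] <;>
      field_simp <;> ring

end LBM.D3Q19

/-! ### Order three -/

namespace LBM.D3Q19

open Matrix

variable {D : D3Q19}

/-- Equilibria with `q^eq = -2/3 λ² J`, `XX_e^eq = WW_e^eq = 0`, equal Hénon parameters for the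
five shear moments, and `ε₂^eq` which deviates by `κ λ⁴ ρ` from `-(42 + 9 a) / 19 λ⁴ ρ`. -/
structure IsoEq (D : D3Q19) (a κ : ℝ) : Prop where
  viscous : ViscousEq D a (-(2 / 3))
  eq13 : D.EqRho 13 ((-((42 + 9 * a) / 19) + κ) * D.lam ^ 4)
  eq14 : D.meq 14 = 0
  eq15 : D.meq 15 = 0
  sigma6 : D.sigma 6 = D.sigma 5
  sigma7 : D.sigma 7 = D.sigma 5
  sigma8 : D.sigma 8 = D.sigma 5
  sigma9 : D.sigma 9 = D.sigma 5

namespace IsoEq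

variable {a κ : ℝ} (h : IsoEq D a κ) (x y z r u v w : ℝ)
include h

theorem G_zero : D.G ![x, y, z] 0 ![r, u, v, w] = ![r, u, v, w, a * D.lam ^ 2 * r, 0, 0, 0, 0,
    0, -(2 / 3) * D.lam ^ 2 * u, -(2 / 3) * D.lam ^ 2 * v, -(2 / 3) * D.lam ^ 2 * w,
    (-((42 + 9 * a) / 19) + κ) * D.lam ^ 4 * r, 0, 0, 0, 0, 0] := by
  rw [h.viscous.G_zero, h.eq13, h.eq14, h.eq15]
  simp

theorem act_one : D.act ![x, y, z] 1 ![r, u, v, w] = ![-(x * u + y * v + z * w),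
    -((a + 30) / 57 * D.lam ^ 2) * x * r, -((a + 30) / 57 * D.lam ^ 2) * y * r,
    -((a + 30) / 57 * D.lam ^ 2) * z * r] := by
  rw [h.viscous.order1.act]
  simp

theorem act_two : D.act ![x, y, z] 2 ![r, u, v, w] = ![0,
    D.lam ^ 2 * (D.sigma 5 / 3 * (x ^ 2 + y ^ 2 + z ^ 2) * u
      + (5 * D.sigma 4 + 19 * D.sigma 5 - 3 * a * D.sigma 4) / 171 * x * (x * u + y * v + z * w)),
    D.lam ^ 2 * (D.sigma 5 / 3 * (x ^ 2 + y ^ 2 + z ^ 2) * v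
      + (5 * D.sigma 4 + 19 * D.sigma 5 - 3 * a * D.sigma 4) / 171 * y * (x * u + y * v + z * w)),
    D.lam ^ 2 * (D.sigma 5 / 3 * (x ^ 2 + y ^ 2 + z ^ 2) * w
      + (5 * D.sigma 4 + 19 * D.sigma 5 - 3 * a * D.sigma 4) / 171 * z
        * (x * u + y * v + z * w))] := by
  rw [h.viscous.act_two_eq _ h.sigma6 (h.sigma8.trans h.sigma7.symm) (h.sigma9.trans h.sigma7.symm)
    (by rw [h.sigma7]; ring) rfl rfl, h.sigma7]
  simp
  refine ⟨?_, ?_, ?_⟩ <;> ring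

/-- The reference value `-(42 + 9a)/19` is the one for which `q` has no first order jump: rows 10 to
12 are proportional to `κ`. Row 13 is where the exceptional factor `27a + 88` originates. -/
theorem H_one : D.H ![x, y, z] 1 ![r, u, v, w] = ![0, 0, 0, 0,
    (5 - 3 * a) / 3 * D.lam ^ 2 * (x * u + y * v + z * w),
    2 / 3 * D.lam ^ 2 * (2 * x * u - y * v - z * w), 2 / 3 * D.lam ^ 2 * (y * v - z * w),
    1 / 3 * D.lam ^ 2 * (x * v + y * u), 1 / 3 * D.lam ^ 2 * (y * w + z * v),
    1 / 3 * D.lam ^ 2 * (x * w + z * u),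
    10 / 63 * κ * D.lam ^ 4 * x * r, 10 / 63 * κ * D.lam ^ 4 * y * r,
    10 / 63 * κ * D.lam ^ 4 * z * r,
    ((27 * a + 88) / 57 - κ) * D.lam ^ 4 * (x * u + y * v + z * w),
    -(1 / 3) * D.lam ^ 4 * (2 * x * u - y * v - z * w), -(1 / 3) * D.lam ^ 4 * (y * v - z * w),
    0, 0, 0] := by
  funext k
  rw [H_one_apply, h.act_one, h.G_zero, h.G_zero]
  revert k
  apply forall_fin_nineteen <;>
  simp [flux_0, flux_1, flux_2, flux_3, flux_4, flux_5, flux_6, flux_7, flux_8, flux_9, flux_10,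
    flux_11, flux_12, flux_13, flux_14, flux_15, flux_16, flux_17, flux_18] <;> ring

theorem G_one : D.G ![x, y, z] 1 ![r, u, v, w] = ![0, 0, 0, 0,
    -D.sigma 4 * ((5 - 3 * a) / 3 * D.lam ^ 2 * (x * u + y * v + z * w)),
    -D.sigma 5 * (2 / 3 * D.lam ^ 2 * (2 * x * u - y * v - z * w)),
    -D.sigma 5 * (2 / 3 * D.lam ^ 2 * (y * v - z * w)),
    -D.sigma 5 * (1 / 3 * D.lam ^ 2 * (x * v + y * u)),
    -D.sigma 5 * (1 / 3 * D.lam ^ 2 * (y * w + z * v)),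
    -D.sigma 5 * (1 / 3 * D.lam ^ 2 * (x * w + z * u)),
    -D.sigma 10 * (10 / 63 * κ * D.lam ^ 4 * x * r),
    -D.sigma 11 * (10 / 63 * κ * D.lam ^ 4 * y * r),
    -D.sigma 12 * (10 / 63 * κ * D.lam ^ 4 * z * r),
    -D.sigma 13 * (((27 * a + 88) / 57 - κ) * D.lam ^ 4 * (x * u + y * v + z * w)),
    -D.sigma 14 * (-(1 / 3) * D.lam ^ 4 * (2 * x * u - y * v - z * w)),
    -D.sigma 15 * (-(1 / 3) * D.lam ^ 4 * (y * v - z * w)), 0, 0, 0] := by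
  have hG := D.G_succ_eq ![x, y, z] 0 ![r, u, v, w]
  rw [zero_add, h.H_one, h.sigma6, h.sigma7, h.sigma8, h.sigma9] at hG
  rw [hG]
  simp

theorem H_two_shear :
    D.H ![x, y, z] 2 ![r, u, v, w] 4 = D.sigma 4 * ((5 - 3 * a) / 3 * D.lam ^ 2)
        * ((a + 30) / 57 * D.lam ^ 2) * (x ^ 2 + y ^ 2 + z ^ 2) * r
      - 38 / 63 * κ * D.lam ^ 4 * (D.sigma 10 * x ^ 2 + D.sigma 11 * y ^ 2 + D.sigma 12 * z ^ 2)
        * r ∧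
    D.H ![x, y, z] 2 ![r, u, v, w] 5 = D.sigma 5 * (2 / 3 * D.lam ^ 2)
        * ((a + 30) / 57 * D.lam ^ 2) * (2 * x ^ 2 - y ^ 2 - z ^ 2) * r
      + 1 / 63 * κ * D.lam ^ 4 * (2 * D.sigma 10 * x ^ 2 - D.sigma 11 * y ^ 2 - D.sigma 12 * z ^ 2)
        * r ∧
    D.H ![x, y, z] 2 ![r, u, v, w] 6 = D.sigma 5 * (2 / 3 * D.lam ^ 2)
        * ((a + 30) / 57 * D.lam ^ 2) * (y ^ 2 - z ^ 2) * r
      + 1 / 63 * κ * D.lam ^ 4 * (D.sigma 11 * y ^ 2 - D.sigma 12 * z ^ 2) * r ∧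
    D.H ![x, y, z] 2 ![r, u, v, w] 7 = D.sigma 5 * (2 / 3 * D.lam ^ 2)
        * ((a + 30) / 57 * D.lam ^ 2) * (x * y) * r
      - 1 / 63 * κ * D.lam ^ 4 * (D.sigma 10 + D.sigma 11) * (x * y) * r ∧
    D.H ![x, y, z] 2 ![r, u, v, w] 8 = D.sigma 5 * (2 / 3 * D.lam ^ 2)
        * ((a + 30) / 57 * D.lam ^ 2) * (y * z) * r
      - 1 / 63 * κ * D.lam ^ 4 * (D.sigma 11 + D.sigma 12) * (y * z) * r ∧
    D.H ![x, y, z] 2 ![r, u, v, w] 9 = D.sigma 5 * (2 / 3 * D.lam ^ 2)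
        * ((a + 30) / 57 * D.lam ^ 2) * (z * x) * r
      - 1 / 63 * κ * D.lam ^ 4 * (D.sigma 12 + D.sigma 10) * (z * x) * r := by
  simp only [H_two_apply, flux_4, flux_5, flux_6, flux_7, flux_8, flux_9]
  rw [h.act_one, h.act_two, h.G_zero, h.G_one, h.G_one]
  refine ⟨?_, ?_, ?_, ?_, ?_, ?_⟩ <;> simp <;> ring

theorem del_H_one_shear :
    D.del ![x, y, z] (D.H ![x, y, z] 1) ![r, u, v, w] 4 = (-((5 - 3 * a) / 3 * D.lam ^ 2)
        * ((a + 30) / 57 * D.lam ^ 2) + 38 / 63 * κ * D.lam ^ 4) * (x ^ 2 + y ^ 2 + z ^ 2) * r ∧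
    D.del ![x, y, z] (D.H ![x, y, z] 1) ![r, u, v, w] 5 = -(2 / 3 * D.lam ^ 2
        * ((a + 30) / 57 * D.lam ^ 2) + 1 / 63 * κ * D.lam ^ 4)
        * (2 * x ^ 2 - y ^ 2 - z ^ 2) * r ∧
    D.del ![x, y, z] (D.H ![x, y, z] 1) ![r, u, v, w] 6 = -(2 / 3 * D.lam ^ 2
        * ((a + 30) / 57 * D.lam ^ 2) + 1 / 63 * κ * D.lam ^ 4) * (y ^ 2 - z ^ 2) * r ∧
    D.del ![x, y, z] (D.H ![x, y, z] 1) ![r, u, v, w] 7 = (-(2 / 3 * D.lam ^ 2)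
        * ((a + 30) / 57 * D.lam ^ 2) + 2 / 63 * κ * D.lam ^ 4) * (x * y) * r ∧
    D.del ![x, y, z] (D.H ![x, y, z] 1) ![r, u, v, w] 8 = (-(2 / 3 * D.lam ^ 2)
        * ((a + 30) / 57 * D.lam ^ 2) + 2 / 63 * κ * D.lam ^ 4) * (y * z) * r ∧
    D.del ![x, y, z] (D.H ![x, y, z] 1) ![r, u, v, w] 9 = (-(2 / 3 * D.lam ^ 2)
        * ((a + 30) / 57 * D.lam ^ 2) + 2 / 63 * κ * D.lam ^ 4) * (z * x) * r := by
  simp only [del_apply, flux_4, flux_5, flux_6, flux_7, flux_8, flux_9]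
  rw [h.act_one, h.H_one, h.H_one]
  refine ⟨?_, ?_, ?_, ?_, ?_, ?_⟩ <;> simp <;> ring

theorem del_H_one_low :
    D.del ![x, y, z] (D.H ![x, y, z] 1) ![r, u, v, w] 0 = 0 ∧
    D.del ![x, y, z] (D.H ![x, y, z] 1) ![r, u, v, w] 1 =
      D.lam ^ 2 * (1 / 3 * (x ^ 2 + y ^ 2 + z ^ 2) * u
      + (24 - 3 * a) / 171 * x * (x * u + y * v + z * w)) ∧
    D.del ![x, y, z] (D.H ![x, y, z] 1) ![r, u, v, w] 2 =
      D.lam ^ 2 * (1 / 3 * (x ^ 2 + y ^ 2 + z ^ 2) * v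
      + (24 - 3 * a) / 171 * y * (x * u + y * v + z * w)) ∧
    D.del ![x, y, z] (D.H ![x, y, z] 1) ![r, u, v, w] 3 =
      D.lam ^ 2 * (1 / 3 * (x ^ 2 + y ^ 2 + z ^ 2) * w
      + (24 - 3 * a) / 171 * z * (x * u + y * v + z * w)) := by
  simp only [del_apply, flux_0, flux_1, flux_2, flux_3]
  rw [h.act_one, h.H_one, h.H_one]
  refine ⟨?_, ?_, ?_, ?_⟩ <;> simp <;> ring

theorem act_three_zero : D.act ![x, y, z] 3 ![r, u, v, w] 0 =
    (27 - a) / 684 * D.lam ^ 2 * (x ^ 2 + y ^ 2 + z ^ 2) * (x * u + y * v + z * w) := by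
  obtain ⟨-, d1, d2, d3⟩ := h.del_H_one_low x y z r u v w
  rw [act_three]
  change -flux _ _ _ 0 + 1 / 12 * (flux _ _ _ 0 + flux _ _ _ 0) = _
  rw [flux_0, flux_0, flux_0, d1, d2, d3, h.act_one, h.H_one, D.G_succ_eq _ 1]
  simp
  ring

/-- The momentum flux of `-G 2 = σ H 2` gives the first group of terms, the cubic correction the
second. In the correction only the `κ/252` term is anisotropic. The second order jumps are kept as
variables so that each family can substitute its own values. -/
theorem act_three_succ {k4 k5 k6 k7 k8 k9 : ℝ}
    (h4 : D.H ![x, y, z] 2 ![r, u, v, w] 4 = k4) (h5 : D.H ![x, y, z] 2 ![r, u, v, w] 5 = k5)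
    (h6 : D.H ![x, y, z] 2 ![r, u, v, w] 6 = k6) (h7 : D.H ![x, y, z] 2 ![r, u, v, w] 7 = k7)
    (h8 : D.H ![x, y, z] 2 ![r, u, v, w] 8 = k8) (h9 : D.H ![x, y, z] 2 ![r, u, v, w] 9 = k9) :
    D.act ![x, y, z] 3 ![r, u, v, w] 1 =
      (x * (D.sigma 4 * k4 / 57 + D.sigma 5 * k5 / 3)
        + D.sigma 5 * (y * k7 + z * k9))
      + ((a + 30) * (a - 27) / 19494 * (x ^ 2 + y ^ 2 + z ^ 2) + κ / 252 * (y ^ 2 + z ^ 2)) * D.lam ^ 4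
        * x * r ∧
    D.act ![x, y, z] 3 ![r, u, v, w] 2 =
      (y * (D.sigma 4 * k4 / 57 - D.sigma 5 * k5 / 6
        + D.sigma 5 * k6 / 2) + D.sigma 5 * (x * k7 + z * k8))
      + ((a + 30) * (a - 27) / 19494 * (x ^ 2 + y ^ 2 + z ^ 2) + κ / 252 * (x ^ 2 + z ^ 2)) * D.lam ^ 4
        * y * r ∧
    D.act ![x, y, z] 3 ![r, u, v, w] 3 =
      (z * (D.sigma 4 * k4 / 57 - D.sigma 5 * k5 / 6
        - D.sigma 5 * k6 / 2) + D.sigma 5 * (x * k9 + y * k8))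
      + ((a + 30) * (a - 27) / 19494 * (x ^ 2 + y ^ 2 + z ^ 2) + κ / 252 * (x ^ 2 + y ^ 2)) * D.lam ^ 4
        * z * r := by
  obtain ⟨d4, d5, d6, d7, d8, d9⟩ := h.del_H_one_shear x y z r u v w
  rw [D.act_three _ _ 1, D.act_three _ _ 2, D.act_three _ _ 3]
  change -flux _ _ _ 1 + 1 / 12 * (flux _ _ _ 1 + flux _ _ _ 1) = _ ∧
    -flux _ _ _ 2 + 1 / 12 * (flux _ _ _ 2 + flux _ _ _ 2) = _ ∧
    -flux _ _ _ 3 + 1 / 12 * (flux _ _ _ 3 + flux _ _ _ 3) = _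
  simp only [flux_1, flux_2, flux_3, d4, d5, d6, d7, d8, d9]
  rw [h.act_one, h.H_one, D.G_succ_eq _ 1, h.sigma6, h.sigma7, h.sigma8, h.sigma9,
    (h.del_H_one_low x y z r u v w).1, h4, h5, h6, h7, h8, h9]
  refine ⟨?_, ?_, ?_⟩ <;> simp <;> ring

end IsoEq

theorem heat_coeff_of_sigma {s t : ℝ} (hs : s + 2 * t ≠ 0) (h : s = t) :
    2 * ((3 * s - 4 * t) / (s + 2 * t)) = -(2 / 3) := by
  subst h
  have : s ≠ 0 := fun h0 => hs (by rw [h0]; norm_num)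
  field_simp
  norm_num

theorem Order2Cond.isoEq {a b : ℝ} (h : D.Order2Cond a) (h13 : D.EqRho 13 (b * D.lam ^ 4))
    (h14 : D.meq 14 = 0) (h15 : D.meq 15 = 0) (h57 : D.sigma 5 = D.sigma 7) :
    IsoEq D a (b + (42 + 9 * a) / 19) := by
  have hV := h.viscousEq
  rw [heat_coeff_of_sigma h.2.1 h57] at hV
  obtain ⟨-, -, -, -, -, -, h56, h78, h89⟩ := h
  refine ⟨hV, ?_, h14, h15, h56.symm, h57.symm, (h57.trans h78).symm,
    (h57.trans (h78.trans h89)).symm⟩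
  have : -((42 + 9 * a) / 19) + (b + (42 + 9 * a) / 19) = b := by ring
  rwa [this]

theorem Order3CondA.isoEq {a : ℝ} (h : D.Order3CondA a) : IsoEq D a 0 := by
  obtain ⟨h2, h13, h14, h15, h57⟩ := h
  have := h2.isoEq h13 h14 h15 h57
  rwa [neg_add_cancel] at this

theorem eta_fin_four (W : Fin 4 → ℝ) : W = ![W 0, W 1, W 2, W 3] := by
  funext i; fin_cases i <;> rfl

theorem eta_fin_three (W : Fin 3 → ℝ) : W = ![W 0, W 1, W 2] := by
  funext i; fin_cases i <;> rfl

theorem Order3CondA.equivOp {a : ℝ} (h : D.Order3CondA a) : D.equivOp 3 =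
    isoOp3 ((a + 30) / 57 * D.lam ^ 2) (1 / 3 * D.sigma 5 * D.lam * D.dx)
      (D.lam * D.dx / 171 * (5 * D.sigma 4 + 19 * D.sigma 5 - 3 * a * D.sigma 4))
      (D.dx ^ 2 / 684 * (a - 27))
      (D.lam ^ 2 * D.dx ^ 2 / 19494 * (a + 30) *
          (27 + 6 * a * D.sigma 4 ^ 2 - 10 * D.sigma 4 ^ 2 - 152 * D.sigma 5 ^ 2 - a)) := by
  have hI := h.isoEq
  refine D.equivOp_eq_isoOp4 3 _ _ _ _ _ _ _ _ (fun ξ W => ?_) (fun ξ W k => ?_)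
  all_goals
    rw [eta_fin_three ξ, eta_fin_four W]
    generalize ξ 0 = x, ξ 1 = y, ξ 2 = z, W 0 = r, W 1 = u, W 2 = v, W 3 = w
  · simp [Finset.sum_Icc_succ_top, hI.act_one, hI.act_two, hI.act_three_zero, Fin.sum_univ_three,
      lam_mul_dt]
    ring
  · obtain ⟨h4, h5, h6, h7, h8, h9⟩ := hI.H_two_shear x y z r u v w
    obtain ⟨e1, e2, e3⟩ := hI.act_three_succ x y z r u v w h4 h5 h6 h7 h8 h9
    fin_cases k <;>
      simp [Finset.sum_Icc_succ_top, hI.act_one, hI.act_two, e1, e2, e3, Fin.sum_univ_three,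
        lam_mul_dt] <;>
      ring

theorem Order3CondB.isoEq {a b : ℝ} (h : D.Order3CondB a b) :
    IsoEq D a (b + (42 + 9 * a) / 19) :=
  h.1.isoEq h.2.1 h.2.2.1 h.2.2.2.1 h.2.2.2.2.1

theorem Order3CondB.equivOp {a b : ℝ} (h : D.Order3CondB a b) : D.equivOp 3 =
    isoOp3 ((a + 30) / 57 * D.lam ^ 2) (1 / 3 * D.sigma 5 * D.lam * D.dx)
      (D.lam * D.dx / 171 * (5 * D.sigma 4 + 19 * D.sigma 5 - 3 * a * D.sigma 4))
      (D.dx ^ 2 / 684 * (a - 27))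
      (D.lam ^ 2 * D.dx ^ 2 / (409374 * D.sigma 5) *
          (16212 * D.sigma 5 + 126 * a ^ 2 * D.sigma 4 ^ 2 * D.sigma 5
            + 3570 * a * D.sigma 4 ^ 2 * D.sigma 5 - 6300 * D.sigma 4 ^ 2 * D.sigma 5
            - 21 * D.sigma 5 * a ^ 2 - 234 * a * D.sigma 5
            + 361 * b * D.sigma 4 + 171 * a * D.sigma 4 + 798 * D.sigma 4
            - 3192 * a * D.sigma 5 ^ 3 - 95760 * D.sigma 5 ^ 3 - 361 * b * D.sigma 5)) := by
  have hI := h.isoEq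
  have hs : D.sigma 5 ≠ 0 := by
    intro h0
    apply h.1.2.1
    rw [← h.2.2.2.2.1, h0]
    norm_num
  obtain ⟨-, -, -, -, -, h10, h11, h12, -⟩ := h
  refine D.equivOp_eq_isoOp4 3 _ _ _ _ _ _ _ _ (fun ξ W => ?_) (fun ξ W k => ?_)
  all_goals
    rw [eta_fin_three ξ, eta_fin_four W]
    generalize ξ 0 = x, ξ 1 = y, ξ 2 = z, W 0 = r, W 1 = u, W 2 = v, W 3 = w
  · simp [Finset.sum_Icc_succ_top, hI.act_one, hI.act_two, hI.act_three_zero, Fin.sum_univ_three,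
      lam_mul_dt]
    ring
  · obtain ⟨h4, h5, h6, h7, h8, h9⟩ := hI.H_two_shear x y z r u v w
    obtain ⟨e1, e2, e3⟩ := hI.act_three_succ x y z r u v w h4 h5 h6 h7 h8 h9
    have e0 := hI.act_two x y z r u v w
    -- With a common value `s` of `σ₁₀, σ₁₁, σ₁₂`, the anisotropic part of row `x` is `κ x (y² + z²)
    -- (1/252 - σ₅ s/21)`, up to the factor `λ⁴ ρ`; it cancels for `12 σ₅ s = 1`, and the other rows
    -- behave alike.
    rw [h10, h11, h12] at e1 e2 e3
    generalize D.sigma 5 = s5 at *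
    fin_cases k <;>
      simp [Finset.sum_Icc_succ_top, hI.act_one, e0, e1, e2, e3, Fin.sum_univ_three,
        lam_mul_dt] <;>
      field_simp <;> ring

/-- The third order fluxes (moments `q` and the antisymmetric ones) of a moment vector with
vanishing conserved and third order components; `s4, …, s15` are weights of the other components. -/
noncomputable def thirdFlux (a s4 s5 s13 s14 s15 x y z u v w : ℝ) : Fin 6 → ℝ :=
  let d := x * u + y * v + z * w
  let p := 2 * x * u - y * v - z * w
  let q := y * v - z * w
  let e := 4 / 189 * s4 * (5 - 3 * a) * d + 10 / 3591 * s13 * (27 * a + 88) * d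
  ![x * (e - 4 / 27 * s5 * p - 5 / 27 * s14 * p)
      + s5 / 3 * (y * (x * v + y * u) + z * (x * w + z * u)),
    y * (e + 2 / 27 * s5 * p - 2 / 9 * s5 * q + 5 / 54 * s14 * p - 5 / 18 * s15 * q)
      + s5 / 3 * (x * (x * v + y * u) + z * (y * w + z * v)),
    z * (e + 2 / 27 * s5 * p + 2 / 9 * s5 * q + 5 / 54 * s14 * p + 5 / 18 * s15 * q)
      + s5 / 3 * (x * (x * w + z * u) + y * (y * w + z * v)),
    x * (4 * s5 - s15) * q / 9 + s5 / 3 * (y * (x * v + y * u) - z * (x * w + z * u)),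
    s5 / 3 * (z * (y * w + z * v) - x * (x * v + y * u))
      - y * (4 * s5 * (p + q) - s14 * p - s15 * q) / 18,
    s5 / 3 * (x * (x * w + z * u) - y * (y * w + z * v))
      + z * (4 * s5 * (p - q) - s14 * p + s15 * q) / 18]

/-! ### Order four: jumps and coefficients when `κ = 0` -/

namespace IsoEq

variable {a : ℝ} (h : IsoEq D a 0) (x y z r u v w : ℝ)
include h

/-- As `G 1 = -σ H 1` componentwise, the odd third order rows are `thirdFlux` weighted by the `σ_k`;
the rows of `q` also receive `q^eq` applied to `α_2`. The same function with unit weights describes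
`del` of `H 1`. -/
theorem H_two : D.H ![x, y, z] 2 ![r, u, v, w] = ![0, 0, 0, 0,
    D.sigma 4 * (5 - 3 * a) / 3 * (a + 30) / 57 * D.lam ^ 4 * (x ^ 2 + y ^ 2 + z ^ 2) * r,
    D.sigma 5 * (2 / 3) * (a + 30) / 57 * D.lam ^ 4 * (2 * x ^ 2 - y ^ 2 - z ^ 2) * r,
    D.sigma 5 * (2 / 3) * (a + 30) / 57 * D.lam ^ 4 * (y ^ 2 - z ^ 2) * r,
    D.sigma 5 * (2 / 3) * (a + 30) / 57 * D.lam ^ 4 * (x * y) * r,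
    D.sigma 5 * (2 / 3) * (a + 30) / 57 * D.lam ^ 4 * (y * z) * r,
    D.sigma 5 * (2 / 3) * (a + 30) / 57 * D.lam ^ 4 * (z * x) * r,
    -(D.lam ^ 4 * thirdFlux a (D.sigma 4) (D.sigma 5) (D.sigma 13) (D.sigma 14) (D.sigma 15)
      x y z u v w 0) - 2 / 3 * D.lam ^ 2 * D.act ![x, y, z] 2 ![r, u, v, w] 1,
    -(D.lam ^ 4 * thirdFlux a (D.sigma 4) (D.sigma 5) (D.sigma 13) (D.sigma 14) (D.sigma 15)
      x y z u v w 1) - 2 / 3 * D.lam ^ 2 * D.act ![x, y, z] 2 ![r, u, v, w] 2,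
    -(D.lam ^ 4 * thirdFlux a (D.sigma 4) (D.sigma 5) (D.sigma 13) (D.sigma 14) (D.sigma 15)
      x y z u v w 2) - 2 / 3 * D.lam ^ 2 * D.act ![x, y, z] 2 ![r, u, v, w] 3,
    D.sigma 13 * (27 * a + 88) / 57 * (a + 30) / 57 * D.lam ^ 6 * (x ^ 2 + y ^ 2 + z ^ 2) * r,
    -(D.sigma 14 / 3 * (a + 30) / 57 * D.lam ^ 6 * (2 * x ^ 2 - y ^ 2 - z ^ 2) * r),
    -(D.sigma 15 / 3 * (a + 30) / 57 * D.lam ^ 6 * (y ^ 2 - z ^ 2) * r),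
    -(D.lam ^ 4 * thirdFlux a (D.sigma 4) (D.sigma 5) (D.sigma 13) (D.sigma 14) (D.sigma 15)
      x y z u v w 3),
    -(D.lam ^ 4 * thirdFlux a (D.sigma 4) (D.sigma 5) (D.sigma 13) (D.sigma 14) (D.sigma 15)
      x y z u v w 4),
    -(D.lam ^ 4 * thirdFlux a (D.sigma 4) (D.sigma 5) (D.sigma 13) (D.sigma 14) (D.sigma 15)
      x y z u v w 5)] := by
  funext k
  obtain ⟨e4, e5, e6, e7, e8, e9⟩ := h.H_two_shear x y z r u v w
  revert k
  apply forall_fin_nineteen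
  · exact D.H_succ_zero _ 1 _
  · exact D.H_succ_one _ 1 _
  · exact D.H_succ_two _ 1 _
  · exact D.H_succ_three _ 1 _
  · rw [e4]; simp only [Matrix.cons_val]; ring
  · rw [e5]; simp only [Matrix.cons_val]; ring
  · rw [e6]; simp only [Matrix.cons_val]; ring
  · rw [e7]; simp only [Matrix.cons_val]; ring
  · rw [e8]; simp only [Matrix.cons_val]; ring
  · rw [e9]; simp only [Matrix.cons_val]; ring
  all_goals
    rw [H_two_apply, h.act_one, h.act_two, h.G_zero, h.G_one, h.G_one]
    simp [thirdFlux, flux_10, flux_11, flux_12, flux_13, flux_14, flux_15, flux_16, flux_17,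
      flux_18]
    try ring

theorem del_H_one : D.del ![x, y, z] (D.H ![x, y, z] 1) ![r, u, v, w] = ![0,
    D.lam ^ 2 * (1 / 3 * (x ^ 2 + y ^ 2 + z ^ 2) * u
      + (24 - 3 * a) / 171 * x * (x * u + y * v + z * w)),
    D.lam ^ 2 * (1 / 3 * (x ^ 2 + y ^ 2 + z ^ 2) * v
      + (24 - 3 * a) / 171 * y * (x * u + y * v + z * w)),
    D.lam ^ 2 * (1 / 3 * (x ^ 2 + y ^ 2 + z ^ 2) * w
      + (24 - 3 * a) / 171 * z * (x * u + y * v + z * w)),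
    -((5 - 3 * a) / 3 * (a + 30) / 57 * D.lam ^ 4 * (x ^ 2 + y ^ 2 + z ^ 2) * r),
    -((2 / 3) * (a + 30) / 57 * D.lam ^ 4 * (2 * x ^ 2 - y ^ 2 - z ^ 2) * r),
    -((2 / 3) * (a + 30) / 57 * D.lam ^ 4 * (y ^ 2 - z ^ 2) * r),
    -((2 / 3) * (a + 30) / 57 * D.lam ^ 4 * (x * y) * r),
    -((2 / 3) * (a + 30) / 57 * D.lam ^ 4 * (y * z) * r),
    -((2 / 3) * (a + 30) / 57 * D.lam ^ 4 * (z * x) * r),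
    D.lam ^ 4 * thirdFlux a 1 1 1 1 1 x y z u v w 0,
    D.lam ^ 4 * thirdFlux a 1 1 1 1 1 x y z u v w 1,
    D.lam ^ 4 * thirdFlux a 1 1 1 1 1 x y z u v w 2,
    -((27 * a + 88) / 57 * (a + 30) / 57 * D.lam ^ 6 * (x ^ 2 + y ^ 2 + z ^ 2) * r),
    1 / 3 * (a + 30) / 57 * D.lam ^ 6 * (2 * x ^ 2 - y ^ 2 - z ^ 2) * r,
    1 / 3 * (a + 30) / 57 * D.lam ^ 6 * (y ^ 2 - z ^ 2) * r,
    D.lam ^ 4 * thirdFlux a 1 1 1 1 1 x y z u v w 3,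
    D.lam ^ 4 * thirdFlux a 1 1 1 1 1 x y z u v w 4,
    D.lam ^ 4 * thirdFlux a 1 1 1 1 1 x y z u v w 5] := by
  funext k
  rw [del_apply, h.act_one, h.H_one, h.H_one]
  revert k
  apply forall_fin_nineteen <;>
  simp [thirdFlux, flux_0, flux_1, flux_2, flux_3, flux_4, flux_5, flux_6, flux_7, flux_8, flux_9,
    flux_10, flux_11, flux_12, flux_13, flux_14, flux_15, flux_16, flux_17, flux_18] <;> ring

theorem G_two : D.G ![x, y, z] 2 ![r, u, v, w] = ![0, 0, 0, 0,
    -D.sigma 4 * D.H ![x, y, z] 2 ![r, u, v, w] 4, -D.sigma 5 * D.H ![x, y, z] 2 ![r, u, v, w] 5,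
    -D.sigma 5 * D.H ![x, y, z] 2 ![r, u, v, w] 6, -D.sigma 5 * D.H ![x, y, z] 2 ![r, u, v, w] 7,
    -D.sigma 5 * D.H ![x, y, z] 2 ![r, u, v, w] 8, -D.sigma 5 * D.H ![x, y, z] 2 ![r, u, v, w] 9,
    -D.sigma 10 * D.H ![x, y, z] 2 ![r, u, v, w] 10,
    -D.sigma 11 * D.H ![x, y, z] 2 ![r, u, v, w] 11,
    -D.sigma 12 * D.H ![x, y, z] 2 ![r, u, v, w] 12,
    -D.sigma 13 * D.H ![x, y, z] 2 ![r, u, v, w] 13,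
    -D.sigma 14 * D.H ![x, y, z] 2 ![r, u, v, w] 14,
    -D.sigma 15 * D.H ![x, y, z] 2 ![r, u, v, w] 15,
    -D.sigma 16 * D.H ![x, y, z] 2 ![r, u, v, w] 16,
    -D.sigma 17 * D.H ![x, y, z] 2 ![r, u, v, w] 17,
    -D.sigma 18 * D.H ![x, y, z] 2 ![r, u, v, w] 18] := by
  have hG := D.G_succ_eq ![x, y, z] 1 ![r, u, v, w]
  rwa [h.sigma6, h.sigma7, h.sigma8, h.sigma9] at hG

end IsoEq

namespace IsoEq

variable {a : ℝ} (h : IsoEq D a 0) (x y z r u v w : ℝ)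
include h

/-- The combination `G 2 - del (H 1) / 12` enters through its flux: `X`, `Y` and `R` are its
components on `q`, on the antisymmetric moments and on the momentum. Keeping them abstract keeps the
polynomial identities small and lets the sufficiency proof insert simplified values. -/
theorem H_three_shear {A : Fin 4 → ℝ} {T U : Fin 6 → ℝ} {X1 X2 X3 Y1 Y2 Y3 R1 R2 R3 : ℝ}
    (hA : D.act ![x, y, z] 2 ![r, u, v, w] = A)
    (hT : thirdFlux a (D.sigma 4) (D.sigma 5) (D.sigma 13) (D.sigma 14) (D.sigma 15) x y z u v w
      = T)
    (hU : thirdFlux a 1 1 1 1 1 x y z u v w = U)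
    (hX1 : D.sigma 10 * (D.lam ^ 4 * T 0 + 2 / 3 * D.lam ^ 2 * A 1) - D.lam ^ 4 * U 0 / 12 = X1)
    (hX2 : D.sigma 11 * (D.lam ^ 4 * T 1 + 2 / 3 * D.lam ^ 2 * A 2) - D.lam ^ 4 * U 1 / 12 = X2)
    (hX3 : D.sigma 12 * (D.lam ^ 4 * T 2 + 2 / 3 * D.lam ^ 2 * A 3) - D.lam ^ 4 * U 2 / 12 = X3)
    (hY1 : D.sigma 16 * (D.lam ^ 4 * T 3) - D.lam ^ 4 * U 3 / 12 = Y1)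
    (hY2 : D.sigma 17 * (D.lam ^ 4 * T 4) - D.lam ^ 4 * U 4 / 12 = Y2)
    (hY3 : D.sigma 18 * (D.lam ^ 4 * T 5) - D.lam ^ 4 * U 5 / 12 = Y3)
    (hR1 : -(D.lam ^ 2 / 12 * (1 / 3 * (x ^ 2 + y ^ 2 + z ^ 2) * u
      + (24 - 3 * a) / 171 * x * (x * u + y * v + z * w))) = R1)
    (hR2 : -(D.lam ^ 2 / 12 * (1 / 3 * (x ^ 2 + y ^ 2 + z ^ 2) * v
      + (24 - 3 * a) / 171 * y * (x * u + y * v + z * w))) = R2)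
    (hR3 : -(D.lam ^ 2 / 12 * (1 / 3 * (x ^ 2 + y ^ 2 + z ^ 2) * w
      + (24 - 3 * a) / 171 * z * (x * u + y * v + z * w))) = R3) :
    D.H ![x, y, z] 3 ![r, u, v, w] 4 = (D.sigma 4 ^ 2 - 1 / 12) * ((5 - 3 * a) / 3) * (a + 30)
      / 57 * D.lam ^ 4 * (x ^ 2 + y ^ 2 + z ^ 2) * (x * u + y * v + z * w) + (x * (21 * D.lam ^
      2 * R1 + 19 * X1) + y * (21 * D.lam ^ 2 * R2 + 19 * X2) + z * (21 * D.lam ^ 2 * R3 + 19 *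
      X3)) / 5 - D.sigma 4 * ((5 - 3 * a) / 3 * D.lam ^ 2 * (x * A 1 + y * A 2 + z * A 3)) + a *
      (27 - a) / 684 * D.lam ^ 4 * (x ^ 2 + y ^ 2 + z ^ 2) * (x * u + y * v + z * w) ∧
    D.H ![x, y, z] 3 ![r, u, v, w] 5 = (D.sigma 5 ^ 2 - 1 / 12) * (2 / 3) * (a + 30) / 57 *
      D.lam ^ 4 * (2 * x ^ 2 - y ^ 2 - z ^ 2) * (x * u + y * v + z * w) + (2 * x * (6 * D.lam ^
      2 * R1 - X1) - y * (6 * D.lam ^ 2 * R2 - X2 + 15 * Y2) - z * (6 * D.lam ^ 2 * R3 - X3 - 15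
      * Y3)) / 10 - D.sigma 5 * (2 / 3 * D.lam ^ 2 * (2 * x * A 1 - y * A 2 - z * A 3)) ∧
    D.H ![x, y, z] 3 ![r, u, v, w] 6 = (D.sigma 5 ^ 2 - 1 / 12) * (2 / 3) * (a + 30) / 57 *
      D.lam ^ 4 * (y ^ 2 - z ^ 2) * (x * u + y * v + z * w) + (10 * x * Y1 + y * (6 * D.lam ^ 2
      * R2 - X2 - 5 * Y2) - z * (6 * D.lam ^ 2 * R3 - X3 + 5 * Y3)) / 10 - D.sigma 5 * (2 / 3 *
      D.lam ^ 2 * (y * A 2 - z * A 3)) ∧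
    D.H ![x, y, z] 3 ![r, u, v, w] 7 = (D.sigma 5 ^ 2 - 1 / 12) * (2 / 3) * (a + 30) / 57 *
      D.lam ^ 4 * (x * y) * (x * u + y * v + z * w) + (x * (4 * D.lam ^ 2 * R2 + X2 - 5 * Y2) +
      y * (4 * D.lam ^ 2 * R1 + X1 + 5 * Y1)) / 10 - D.sigma 5 * (1 / 3 * D.lam ^ 2 * (x * A 2 +
      y * A 1)) ∧
    D.H ![x, y, z] 3 ![r, u, v, w] 8 = (D.sigma 5 ^ 2 - 1 / 12) * (2 / 3) * (a + 30) / 57 *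
      D.lam ^ 4 * (y * z) * (x * u + y * v + z * w) + (y * (4 * D.lam ^ 2 * R3 + X3 - 5 * Y3) +
      z * (4 * D.lam ^ 2 * R2 + X2 + 5 * Y2)) / 10 - D.sigma 5 * (1 / 3 * D.lam ^ 2 * (y * A 3 +
      z * A 2)) ∧
    D.H ![x, y, z] 3 ![r, u, v, w] 9 = (D.sigma 5 ^ 2 - 1 / 12) * (2 / 3) * (a + 30) / 57 *
      D.lam ^ 4 * (z * x) * (x * u + y * v + z * w) + (x * (4 * D.lam ^ 2 * R3 + X3 + 5 * Y3) +
      z * (4 * D.lam ^ 2 * R1 + X1 - 5 * Y1)) / 10 - D.sigma 5 * (1 / 3 * D.lam ^ 2 * (x * A 3 +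
      z * A 1)) := by
  have hA0 : A = ![0, A 1, A 2, A 3] := by rw [← hA, h.act_two]; simp
  simp only [H_three_apply, flux_4, flux_5, flux_6, flux_7, flux_8, flux_9]
  rw [h.act_one, h.del_H_one, h.del_H_one, h.G_two, h.G_two, h.H_two, h.H_two, hA, hT, hU, hA0,
    h.G_one, h.viscous.G_zero, h.act_three_zero]
  subst hX1 hX2 hX3 hY1 hY2 hY3 hR1 hR2 hR3
  refine ⟨?_, ?_, ?_, ?_, ?_, ?_⟩ <;> simp only [Matrix.cons_val] <;> ring

end IsoEq

namespace IsoEq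

variable {a : ℝ} (h : IsoEq D a 0) (x y z r u v w : ℝ)
include h

/-- `L4, …, L9` are the second order moments whose momentum flux is `α_4`: `σ H 3` plus one twelfth
of `2 H 2 ∘ α_1 + flux (H 2) + 2 H 1 ∘ α_2`. The explicit zeros are the momentum components of `H
2`, kept in the shape produced by `flux`. -/
theorem act_four_succ {A : Fin 4 → ℝ} {T : Fin 6 → ℝ} {Z1 Z2 Z3 V1 V2 V3 L4 L5 L6 L7 L8 L9 : ℝ}
    {k4 k5 k6 k7 k8 k9 : ℝ}
    (hA : D.act ![x, y, z] 2 ![r, u, v, w] = A)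
    (hT : thirdFlux a (D.sigma 4) (D.sigma 5) (D.sigma 13) (D.sigma 14) (D.sigma 15) x y z u v w
      = T)
    (h4 : D.H ![x, y, z] 3 ![r, u, v, w] 4 = k4)
    (h5 : D.H ![x, y, z] 3 ![r, u, v, w] 5 = k5)
    (h6 : D.H ![x, y, z] 3 ![r, u, v, w] 6 = k6)
    (h7 : D.H ![x, y, z] 3 ![r, u, v, w] 7 = k7)
    (h8 : D.H ![x, y, z] 3 ![r, u, v, w] 8 = k8)
    (h9 : D.H ![x, y, z] 3 ![r, u, v, w] 9 = k9)
    (hZ1 : D.lam ^ 4 * T 0 + 2 / 3 * D.lam ^ 2 * A 1 = Z1)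
    (hZ2 : D.lam ^ 4 * T 1 + 2 / 3 * D.lam ^ 2 * A 2 = Z2)
    (hZ3 : D.lam ^ 4 * T 2 + 2 / 3 * D.lam ^ 2 * A 3 = Z3)
    (hV1 : D.lam ^ 4 * T 3 = V1)
    (hV2 : D.lam ^ 4 * T 4 = V2)
    (hV3 : D.lam ^ 4 * T 5 = V3)
    (hL4 : D.sigma 4 * k4 + (-(2 * D.sigma 4 * ((5 - 3 * a) / 3) * (a + 30) / 57 * D.lam ^ 4 *
      (x ^ 2 + y ^ 2 + z ^ 2) * (x * u + y * v + z * w)) - (x * (21 * D.lam ^ 2 * 0 + 19 * Z1) +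
      y * (21 * D.lam ^ 2 * 0 + 19 * Z2) + z * (21 * D.lam ^ 2 * 0 + 19 * Z3)) / 5 + 2 * ((5 - 3
      * a) / 3 * D.lam ^ 2 * (x * A 1 + y * A 2 + z * A 3))) / 12 = L4)
    (hL5 : D.sigma 5 * k5 + (-(2 * D.sigma 5 * (2 / 3) * (a + 30) / 57 * D.lam ^ 4 * (2 * x ^
      2 - y ^ 2 - z ^ 2) * (x * u + y * v + z * w)) - (2 * x * (6 * D.lam ^ 2 * 0 - Z1) - y * (6
      * D.lam ^ 2 * 0 - Z2 + 15 * V2) - z * (6 * D.lam ^ 2 * 0 - Z3 - 15 * V3)) / 10 + 2 * (2 /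
      3 * D.lam ^ 2 * (2 * x * A 1 - y * A 2 - z * A 3))) / 12 = L5)
    (hL6 : D.sigma 5 * k6 + (-(2 * D.sigma 5 * (2 / 3) * (a + 30) / 57 * D.lam ^ 4 * (y ^ 2 -
      z ^ 2) * (x * u + y * v + z * w)) - (10 * x * V1 + y * (6 * D.lam ^ 2 * 0 - Z2 - 5 * V2) -
      z * (6 * D.lam ^ 2 * 0 - Z3 + 5 * V3)) / 10 + 2 * (2 / 3 * D.lam ^ 2 * (y * A 2 - z * A
      3))) / 12 = L6)
    (hL7 : D.sigma 5 * k7 + (-(2 * D.sigma 5 * (2 / 3) * (a + 30) / 57 * D.lam ^ 4 * (x * y) *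
      (x * u + y * v + z * w)) - (x * (4 * D.lam ^ 2 * 0 + Z2 - 5 * V2) + y * (4 * D.lam ^ 2 * 0
      + Z1 + 5 * V1)) / 10 + 2 * (1 / 3 * D.lam ^ 2 * (x * A 2 + y * A 1))) / 12 = L7)
    (hL8 : D.sigma 5 * k8 + (-(2 * D.sigma 5 * (2 / 3) * (a + 30) / 57 * D.lam ^ 4 * (y * z) *
      (x * u + y * v + z * w)) - (y * (4 * D.lam ^ 2 * 0 + Z3 - 5 * V3) + z * (4 * D.lam ^ 2 * 0
      + Z2 + 5 * V2)) / 10 + 2 * (1 / 3 * D.lam ^ 2 * (y * A 3 + z * A 2))) / 12 = L8)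
    (hL9 : D.sigma 5 * k9 + (-(2 * D.sigma 5 * (2 / 3) * (a + 30) / 57 * D.lam ^ 4 * (z * x) *
      (x * u + y * v + z * w)) - (x * (4 * D.lam ^ 2 * 0 + Z3 + 5 * V3) + z * (4 * D.lam ^ 2 * 0
      + Z1 - 5 * V1)) / 10 + 2 * (1 / 3 * D.lam ^ 2 * (x * A 3 + z * A 1))) / 12 = L9) :
    D.act ![x, y, z] 4 ![r, u, v, w] 1 = x * (L4 / 57 + L5 / 3) + y * L7 + z * L9 ∧
    D.act ![x, y, z] 4 ![r, u, v, w] 2 = y * (L4 / 57 - L5 / 6 + L6 / 2) + x * L7 + z * L8 ∧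
    D.act ![x, y, z] 4 ![r, u, v, w] 3 = z * (L4 / 57 - L5 / 6 - L6 / 2) + x * L9 + y * L8 := by
  have hA0 : A = ![0, A 1, A 2, A 3] := by rw [← hA, h.act_two]; simp
  rw [D.act_four _ _ 1, D.act_four _ _ 2, D.act_four _ _ 3]
  change -flux _ _ _ 1 + 1 / 12 * (flux _ _ _ 1 + flux _ _ _ 1 + 2 * flux _ _ _ 1) = _ ∧
    -flux _ _ _ 2 + 1 / 12 * (flux _ _ _ 2 + flux _ _ _ 2 + 2 * flux _ _ _ 2) = _ ∧
    -flux _ _ _ 3 + 1 / 12 * (flux _ _ _ 3 + flux _ _ _ 3 + 2 * flux _ _ _ 3) = _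
  simp only [flux_1, flux_2, flux_3, del_apply, flux_0, flux_4, flux_5, flux_6, flux_7, flux_8,
    flux_9]
  rw [h.act_one, h.H_two, h.H_two, hA, hT, hA0, h.H_one, D.G_succ_eq _ 2, h.sigma6, h.sigma7,
    h.sigma8, h.sigma9]
  simp only [Nat.reduceAdd, h4, h5, h6, h7, h8, h9]
  subst hL4 hL5 hL6 hL7 hL8 hL9 hZ1 hZ2 hZ3 hV1 hV2 hV3
  refine ⟨?_, ?_, ?_⟩ <;> simp only [Matrix.cons_val] <;> ring

end IsoEq

/-- The mass flux is the momentum, which vanishes in `G 3`, `H 2` and `H 1`. What survives is one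
twelfth of the double divergence of the stress of `H 2`, the same data that determine the momentum
rows of `α_3`. -/
theorem IsoEq.act_four_zero {a κ : ℝ} (h : IsoEq D a κ) (x y z r u v w : ℝ)
    {k4 k5 k6 k7 k8 k9 : ℝ}
    (h4 : D.H ![x, y, z] 2 ![r, u, v, w] 4 = k4) (h5 : D.H ![x, y, z] 2 ![r, u, v, w] 5 = k5)
    (h6 : D.H ![x, y, z] 2 ![r, u, v, w] 6 = k6) (h7 : D.H ![x, y, z] 2 ![r, u, v, w] 7 = k7)
    (h8 : D.H ![x, y, z] 2 ![r, u, v, w] 8 = k8) (h9 : D.H ![x, y, z] 2 ![r, u, v, w] 9 = k9) :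
    D.act ![x, y, z] 4 ![r, u, v, w] 0 = 1 / 12 *
      (x * (x * (k4 / 57 + k5 / 3) + y * k7 + z * k9)
        + y * (y * (k4 / 57 - k5 / 6 + k6 / 2) + x * k7 + z * k8)
        + z * (z * (k4 / 57 - k5 / 6 - k6 / 2) + x * k9 + y * k8)) := by
  rw [act_four]
  change -flux _ _ _ 0 + 1 / 12 * (flux _ _ _ 0 + flux _ _ _ 0 + 2 * flux _ _ _ 0) = _
  simp only [flux_0, del_apply, flux_1, flux_2, flux_3, h4, h5, h6, h7, h8, h9]
  have e0 : ∀ W, D.H ![x, y, z] 2 W 0 = 0 := D.H_succ_zero _ 1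
  have e1 : ∀ W, D.H ![x, y, z] 2 W 1 = 0 := D.H_succ_one _ 1
  have e2 : ∀ W, D.H ![x, y, z] 2 W 2 = 0 := D.H_succ_two _ 1
  have e3 : ∀ W, D.H ![x, y, z] 2 W 3 = 0 := D.H_succ_three _ 1
  rw [h.act_two, h.H_one, D.G_succ_eq _ 2]
  simp only [Matrix.cons_val, e0, e1, e2, e3]
  ring

theorem Order3CondA.sigma_five_ne_zero {a : ℝ} (h : D.Order3CondA a) : D.sigma 5 ≠ 0 := by
  intro h0
  apply h.1.2.1
  rw [← h.2.2.2.2, h0]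
  norm_num

set_option maxHeartbeats 1000000 in
theorem Order3CondA.act_four_succ {a : ℝ} (h : D.Order3CondA a) (hs : D.Order4Sigmas)
    (h13 : D.sigma 13 = D.sigma 5) (x y z r u v w : ℝ) {m e : ℝ}
    (hm : m = (1 - 12 * D.sigma 5 ^ 2) / 108 * D.sigma 5 * D.lam ^ 4)
    (he : e = -(D.sigma 5 * D.lam ^ 4 / 38988 * (2062 + 45 * a - 4 * a ^ 2
      - 5304 * D.sigma 5 ^ 2 - 612 * a * D.sigma 5 ^ 2 + 24 * a ^ 2 * D.sigma 5 ^ 2))) :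
    D.act ![x, y, z] 4 ![r, u, v, w] 1 = m * (x ^ 2 + y ^ 2 + z ^ 2) ^ 2 * u
      + e * (x ^ 2 + y ^ 2 + z ^ 2) * (x * (x * u + y * v + z * w)) ∧
    D.act ![x, y, z] 4 ![r, u, v, w] 2 = m * (x ^ 2 + y ^ 2 + z ^ 2) ^ 2 * v
      + e * (x ^ 2 + y ^ 2 + z ^ 2) * (y * (x * u + y * v + z * w)) ∧
    D.act ![x, y, z] 4 ![r, u, v, w] 3 = m * (x ^ 2 + y ^ 2 + z ^ 2) ^ 2 * w
      + e * (x ^ 2 + y ^ 2 + z ^ 2) * (z * (x * u + y * v + z * w)) := by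
  have hI := h.isoEq
  have h0 := h.sigma_five_ne_zero
  obtain ⟨h4, h10, h11, h12, h14, h15, h16, h17, h18⟩ := hs
  have hA := hI.act_two x y z r u v w
  obtain ⟨A, hA'⟩ : ∃ A : Fin 4 → ℝ, A = ![0,
      D.lam ^ 2 * (1 / 3 * (x ^ 2 + y ^ 2 + z ^ 2) * u
        + (24 - 3 * a) / 171 * x * (x * u + y * v + z * w)),
      D.lam ^ 2 * (1 / 3 * (x ^ 2 + y ^ 2 + z ^ 2) * v
        + (24 - 3 * a) / 171 * y * (x * u + y * v + z * w)),
      D.lam ^ 2 * (1 / 3 * (x ^ 2 + y ^ 2 + z ^ 2) * w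
        + (24 - 3 * a) / 171 * z * (x * u + y * v + z * w))] := ⟨_, rfl⟩
  replace hA : D.act ![x, y, z] 2 ![r, u, v, w] = D.sigma 5 • A := by
    rw [hA, hA', h4]
    simp
    refine ⟨?_, ?_, ?_⟩ <;> ring
  obtain ⟨U, hU⟩ : ∃ U, thirdFlux a 1 1 1 1 1 x y z u v w = U := ⟨_, rfl⟩
  -- The fourth order conditions make all weights equal to `σ₅`, and `thirdFlux` is linear in its
  -- weights.
  have hT : thirdFlux a (D.sigma 4) (D.sigma 5) (D.sigma 13) (D.sigma 14) (D.sigma 15)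
      x y z u v w = D.sigma 5 • U := by
    rw [← hU, h4, h13, h14, h15]
    simp [thirdFlux]
    refine ⟨?_, ?_, ?_, ?_, ?_, ?_⟩ <;> ring
  -- The factor `1/(6 σ₅)` cancels the common `σ₅`, and `1/6 - 1/12 = 1/12` leaves expressions free
  -- of denominators in `σ₅`.
  have hX : ∀ b c : ℝ, 1 / (6 * D.sigma 5) * (D.lam ^ 4 * (D.sigma 5 * b)
      + 2 / 3 * D.lam ^ 2 * (D.sigma 5 * c)) - D.lam ^ 4 * b / 12 =
      D.lam ^ 4 * b / 12 + D.lam ^ 2 / 9 * c := by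
    intro b c; field_simp; ring
  have hY : ∀ b : ℝ, 1 / (6 * D.sigma 5) * (D.lam ^ 4 * (D.sigma 5 * b)) - D.lam ^ 4 * b / 12 =
      D.lam ^ 4 * b / 12 := by
    intro b; field_simp; ring
  obtain ⟨k4, k5, k6, k7, k8, k9⟩ := hI.H_three_shear x y z r u v w hA hT hU
    (h10.symm ▸ hX _ _) (h11.symm ▸ hX _ _) (h12.symm ▸ hX _ _)
    (h16.symm ▸ hY _) (h17.symm ▸ hY _) (h18.symm ▸ hY _) rfl rfl rfl
  obtain ⟨e1, e2, e3⟩ := hI.act_four_succ x y z r u v w hA hT k4 k5 k6 k7 k8 k9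
    rfl rfl rfl rfl rfl rfl rfl rfl rfl rfl rfl rfl
  rw [e1, e2, e3, ← hU, hA', h4]
  simp only [thirdFlux, Matrix.cons_val, Pi.smul_apply, smul_eq_mul]
  subst hm he
  refine ⟨?_, ?_, ?_⟩ <;> ring

theorem Order3CondA.equivOp_four {a : ℝ} (h : D.Order3CondA a) (hs : D.Order4Sigmas)
    (h13 : D.sigma 13 = D.sigma 5) : D.equivOp 4 =
    isoOp4 ((a + 30) / 57 * D.lam ^ 2) (1 / 3 * D.sigma 5 * D.lam * D.dx)
      (D.lam * D.dx / 171 * (5 * D.sigma 4 + 19 * D.sigma 5 - 3 * a * D.sigma 4))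
      ((a - 27) / 684 * D.dx ^ 2)
      (D.lam ^ 2 * D.dx ^ 2 / 19494 * (a + 30) *
          (27 + 6 * a * D.sigma 4 ^ 2 - 10 * D.sigma 4 ^ 2 - 152 * D.sigma 5 ^ 2 - a))
      ((a + 30) * (a - 27) / 38988 * D.sigma 5 * D.lam * D.dx ^ 3)
      ((12 * D.sigma 5 ^ 2 - 1) / 108 * D.sigma 5 * D.lam * D.dx ^ 3)
      (D.sigma 5 * D.lam * D.dx ^ 3 / 38988 *
          (2062 + 45 * a - 4 * a ^ 2 - 5304 * D.sigma 5 ^ 2 - 612 * a * D.sigma 5 ^ 2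
            + 24 * a ^ 2 * D.sigma 5 ^ 2)) := by
  have hI := h.isoEq
  refine D.equivOp_eq_isoOp4 4 _ _ _ _ _ _ _ _ (fun ξ W => ?_) (fun ξ W k => ?_)
  all_goals
    rw [eta_fin_three ξ, eta_fin_four W]
    generalize ξ 0 = x, ξ 1 = y, ξ 2 = z, W 0 = r, W 1 = u, W 2 = v, W 3 = w
    obtain ⟨h4, h5, h6, h7, h8, h9⟩ := hI.H_two_shear x y z r u v w
  · have e := hI.act_four_zero x y z r u v w h4 h5 h6 h7 h8 h9
    rw [hs.1] at e
    simp [Finset.sum_Icc_succ_top, hI.act_one, hI.act_two, hI.act_three_zero, e,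
      Fin.sum_univ_three, lam_mul_dt]
    ring
  · obtain ⟨e1, e2, e3⟩ := hI.act_three_succ x y z r u v w h4 h5 h6 h7 h8 h9
    obtain ⟨f1, f2, f3⟩ := h.act_four_succ hs h13 x y z r u v w rfl rfl
    fin_cases k <;>
      simp [Finset.sum_Icc_succ_top, hI.act_one, hI.act_two, e1, e2, e3, f1, f2, f3,
        Fin.sum_univ_three, lam_mul_dt] <;>
      ring

/-! ### Necessity at order four -/

theorem Stable.sigma_pos (h : D.Stable) {k : Fin 19} (hk : 4 ≤ k) : 0 < D.sigma k := by
  obtain ⟨h0, h2⟩ := h k hk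
  rw [sigma, sub_pos]
  exact one_div_lt_one_div_of_lt h0 h2

theorem act_three_zero (ξ : Fin 3 → ℝ) (W : Fin 4 → ℝ) :
    D.act ξ 3 W 0 = 1 / 12 * (ξ 0 * flux D.lam ξ (D.H ξ 1 W) 1 + ξ 1 * flux D.lam ξ (D.H ξ 1 W) 2
      + ξ 2 * flux D.lam ξ (D.H ξ 1 W) 3) := by
  have e1 : ∀ W, D.H ξ 1 W 1 = 0 := D.H_succ_one ξ 0
  have e2 : ∀ W, D.H ξ 1 W 2 = 0 := D.H_succ_two ξ 0
  have e3 : ∀ W, D.H ξ 1 W 3 = 0 := D.H_succ_three ξ 0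
  rw [act_three]
  change -flux _ _ _ 0 + 1 / 12 * (flux _ _ _ 0 + flux _ _ _ 0) = _
  rw [flux_0, flux_0, flux_0, del_apply, del_apply, del_apply, D.G_succ_eq _ 1]
  simp [e1, e2, e3]

/-- The mass row of `α_3` is the double divergence of the first order stress and contains no `σ_k`.
Equality of its coefficients of `x³u` and `xy²u` reads `6 - c = 2 (4 + c)`. -/
theorem ViscousEq.heat_coeff_of_rotationInvariant {a c : ℝ} (h : ViscousEq D a c)
    (hr : D.RotationInvariantAtOrder 4) : c = -(2 / 3) := by
  obtain ⟨b, hb⟩ := D.act_three_of_rotationInvariant hr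
  have hp := fun x y => hb ![x, y, 0] ![0, 1, 0, 0]
  simp only [D.act_three_zero, flux_1, flux_2, flux_3, h.H_one_shear, D.H_succ_zero _ 0,
    Fin.sum_univ_three] at hp
  have h1 := hp 1 0
  have h2 := hp 1 1
  simp at h1 h2
  have hl := (pow_pos D.lam_pos 2).ne'
  apply mul_right_cancel₀ hl
  linarith

theorem IsoEq.eq_zero_of_rotationInvariant {a κ : ℝ} (h : IsoEq D a κ)
    (hr : D.RotationInvariantAtOrder 4) (h10 : 0 < D.sigma 10) (h11 : 0 < D.sigma 11) :
    κ = 0 := by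
  obtain ⟨b, m, e, hb⟩ := D.act_four_of_rotationInvariant hr
  have hp : ∀ x y : ℝ, D.act ![x, y, 0] 4 ![1, 0, 0, 0] 0 = b * (x ^ 2 + y ^ 2) ^ 2 := by
    intro x y
    rw [(hb ![x, y, 0] ![1, 0, 0, 0]).1]
    simp [Fin.sum_univ_three]
  have hq : ∀ x y : ℝ, _ = D.act ![x, y, 0] 4 ![1, 0, 0, 0] 0 := fun x y => by
    obtain ⟨h4, h5, h6, h7, h8, h9⟩ := h.H_two_shear x y 0 1 0 0 0
    exact (h.act_four_zero x y 0 1 0 0 0 h4 h5 h6 h7 h8 h9).symm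
  have h1 := (hq 1 0).trans (hp 1 0)
  have h2 := (hq 0 1).trans (hp 0 1)
  have h3 := (hq 1 1).trans (hp 1 1)
  -- The combination `f(1,1) - 2 f(1,0) - 2 f(0,1)` annihilates `(x² + y²)²` and detects the
  -- anisotropic part of the quartic form.
  have h0 : D.lam ^ 4 * ((D.sigma 10 + D.sigma 11) * κ) = 0 := by
    linear_combination -252 * (h3 - 2 * h1 - 2 * h2)
  have hl := (pow_pos D.lam_pos 4).ne'
  have hs : D.sigma 10 + D.sigma 11 ≠ 0 := by positivity
  exact (mul_eq_zero.1 ((mul_eq_zero.1 h0).resolve_left hl)).resolve_left hs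

namespace IsoEq

variable {a : ℝ} (h : IsoEq D a 0)
include h

/-- For `J` along one axis and `ξ` orthogonal to it, the longitudinal coefficient `e` drops out. The
associated antisymmetric moment is excited in proportion to the difference of the squares of the two
transverse components of `ξ`. On the diagonal only the corresponding `q` parameter remains and fixes
`m`; on an axis the antisymmetric parameter is then determined. -/
theorem sigma_of_act_four {m e : ℝ} (hs : 0 < D.sigma 5)
    (hr : ∀ (ξ : Fin 3 → ℝ) (W : Fin 4 → ℝ) (k : Fin 3),
      D.act ξ 4 W k.succ = m * (∑ i, ξ i ^ 2) ^ 2 * W k.succ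
        + e * (∑ i, ξ i ^ 2) * (ξ k * ∑ i, ξ i * W i.succ)) :
    m = D.lam ^ 4 * (-(1 / 9) * D.sigma 5 ^ 3 + 1 / 18 * D.sigma 5 ^ 2 * D.sigma 10) ∧
    D.sigma 11 = D.sigma 10 ∧ D.sigma 12 = D.sigma 10 ∧
    6 * D.sigma 5 * D.sigma 16 = 1 ∧ 6 * D.sigma 5 * D.sigma 17 = 1 ∧
    6 * D.sigma 5 * D.sigma 18 = 1 := by
  have key := fun x y z u v w : ℝ =>
    have k := h.H_three_shear x y z 0 u v w (h.act_two x y z 0 u v w)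
      rfl rfl rfl rfl rfl rfl rfl rfl rfl rfl rfl
    h.act_four_succ x y z 0 u v w (h.act_two x y z 0 u v w)
      rfl k.1 k.2.1 k.2.2.1 k.2.2.2.1 k.2.2.2.2.1 k.2.2.2.2.2
      rfl rfl rfl rfl rfl rfl rfl rfl rfl rfl rfl rfl
  have p1 := (key 0 1 0 1 0 0).1.symm.trans (hr ![0, 1, 0] ![0, 1, 0, 0] 0)
  have p2 := (key 0 1 1 1 0 0).1.symm.trans (hr ![0, 1, 1] ![0, 1, 0, 0] 0)
  have p3 := (key 1 0 0 0 1 0).2.1.symm.trans (hr ![1, 0, 0] ![0, 0, 1, 0] 1)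
  have p4 := (key 1 0 1 0 1 0).2.1.symm.trans (hr ![1, 0, 1] ![0, 0, 1, 0] 1)
  have p5 := (key 1 0 0 0 0 1).2.2.symm.trans (hr ![1, 0, 0] ![0, 0, 0, 1] 2)
  have p6 := (key 1 1 0 0 0 1).2.2.symm.trans (hr ![1, 1, 0] ![0, 0, 0, 1] 2)
  simp only [thirdFlux, Matrix.cons_val, Fin.sum_univ_three, Fin.succ_zero_eq_one,
    Fin.succ_one_eq_two, Fin.reduceSucc] at p1 p2 p3 p4 p5 p6
  have hm : m = D.lam ^ 4 * (-(1 / 9) * D.sigma 5 ^ 3 + 1 / 18 * D.sigma 5 ^ 2 * D.sigma 10) := by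
    linear_combination (-1 / 4) * p2
  have h11 : D.sigma 11 = D.sigma 10 := by
    apply mul_left_cancel₀ (mul_pos (pow_pos D.lam_pos 4) (pow_pos hs 2)).ne'
    linear_combination 18 / 4 * (p4 - p2)
  have h12 : D.sigma 12 = D.sigma 10 := by
    apply mul_left_cancel₀ (mul_pos (pow_pos D.lam_pos 4) (pow_pos hs 2)).ne'
    linear_combination 18 / 4 * (p6 - p2)
  refine ⟨hm, h11, h12, ?_, ?_, ?_⟩
  all_goals apply mul_left_cancel₀ (mul_pos (pow_pos D.lam_pos 4) hs).ne'
  · linear_combination 36 * p1 - 9 * p2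
  · linear_combination 36 * p3 - 9 * p4
  · linear_combination 36 * p5 - 9 * p6

end IsoEq

-- Seven evaluations are linear in `m` and `e`. Each combination below eliminates `e`, inserts `m`
-- through `hm` where it occurs, and uses `6 σ₅ σ₁₆ = 1` to remove the antisymmetric parameters.
set_option maxHeartbeats 1000000 in
theorem IsoEq.relations_of_act_four {a : ℝ} (h : IsoEq D a 0) {m e : ℝ}
    (hr : ∀ (ξ : Fin 3 → ℝ) (W : Fin 4 → ℝ) (k : Fin 3),
      D.act ξ 4 W k.succ = m * (∑ i, ξ i ^ 2) ^ 2 * W k.succ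
        + e * (∑ i, ξ i ^ 2) * (ξ k * ∑ i, ξ i * W i.succ))
    (hm : m = D.lam ^ 4 * (-(1 / 9) * D.sigma 5 ^ 3 + 1 / 18 * D.sigma 5 ^ 2 * D.sigma 10))
    (h11 : D.sigma 11 = D.sigma 10) (h12 : D.sigma 12 = D.sigma 10)
    (h16 : 6 * D.sigma 5 * D.sigma 16 = 1) (h17 : D.sigma 17 = D.sigma 16)
    (h18 : D.sigma 18 = D.sigma 16) :
    D.lam ^ 4 * (a * D.sigma 4 * D.sigma 5 * D.sigma 10 - 1 / 12 * a * D.sigma 4 - a * D.sigma 5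
      * D.sigma 10 * D.sigma 13 + 1 / 12 * a * D.sigma 13 + 5 / 6 * D.sigma 4 * D.sigma 10 *
      D.sigma 15 - 5 / 72 * D.sigma 4 - 88 / 27 * D.sigma 5 * D.sigma 10 * D.sigma 13 + 131 / 972
      * D.sigma 5 + 22 / 81 * D.sigma 13 - 1 / 486 * D.sigma 14 + 5 / 72 * D.sigma 15) = 0 ∧
    D.lam ^ 4 * (D.sigma 4 * D.sigma 5 * D.sigma 10 + 1 / 2 * D.sigma 4 * D.sigma 10 * D.sigma
      15 - 1 / 8 * D.sigma 4 - 1 / 12 * D.sigma 5 - 1 / 12 * D.sigma 14 + 1 / 24 * D.sigma 15) = 0 ∧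
    D.lam ^ 4 * (D.sigma 4 * D.sigma 10 * D.sigma 14 - D.sigma 4 * D.sigma 10 * D.sigma 15 + 1 /
      3 * D.sigma 14 - 1 / 3 * D.sigma 15) = 0 ∧
    D.lam ^ 4 * (D.sigma 5 ^ 2 * D.sigma 10 - 2 / 9 * D.sigma 5 + 1 / 18 * D.sigma 14) = 0 ∧
    D.lam ^ 4 * (D.sigma 5 * D.sigma 10 * D.sigma 14 - 2 / 9 * D.sigma 5 + 11 / 36 * D.sigma 14
      - 1 / 4 * D.sigma 15) = 0 ∧
    D.lam ^ 4 * (D.sigma 5 * D.sigma 10 * D.sigma 15 - 2 / 9 * D.sigma 5 - 1 / 36 * D.sigma 14 +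
      1 / 12 * D.sigma 15) = 0 := by
  have key := fun x y z u v w : ℝ =>
    have k := h.H_three_shear x y z 0 u v w (h.act_two x y z 0 u v w)
      rfl rfl rfl rfl rfl rfl rfl rfl rfl rfl rfl
    h.act_four_succ x y z 0 u v w (h.act_two x y z 0 u v w)
      rfl k.1 k.2.1 k.2.2.1 k.2.2.2.1 k.2.2.2.2.1 k.2.2.2.2.2
      rfl rfl rfl rfl rfl rfl rfl rfl rfl rfl rfl rfl
  have p0 := (key 1 0 0 1 0 0).1.symm.trans (hr ![1, 0, 0] ![0, 1, 0, 0] 0)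
  have p1 := (key 1 1 0 1 0 0).1.symm.trans (hr ![1, 1, 0] ![0, 1, 0, 0] 0)
  have p2 := (key 1 1 0 0 1 0).1.symm.trans (hr ![1, 1, 0] ![0, 0, 1, 0] 0)
  have p3 := (key 2 1 0 0 1 0).1.symm.trans (hr ![2, 1, 0] ![0, 0, 1, 0] 0)
  have p4 := (key 1 1 1 0 1 0).1.symm.trans (hr ![1, 1, 1] ![0, 0, 1, 0] 0)
  have p5 := (key 0 1 0 0 1 0).2.1.symm.trans (hr ![0, 1, 0] ![0, 0, 1, 0] 1)
  have p6 := (key 1 1 0 0 1 0).2.1.symm.trans (hr ![1, 1, 0] ![0, 0, 1, 0] 1)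
  simp only [thirdFlux, Matrix.cons_val, Fin.sum_univ_three, Fin.succ_zero_eq_one,
    Fin.succ_one_eq_two, Fin.reduceSucc, h11, h12, h17, h18] at p0 p1 p2 p3 p4 p5 p6
  ring_nf at p0 p1 p2 p3 p4 p5 p6
  refine ⟨?_, ?_, ?_, ?_, ?_, ?_⟩
  · linear_combination 1201 / 27 * p0 - 395 / 27 * p1 - 671 / 18 * p2 + 401 / 36 * p3 - 397 / 54 * p4 - 30 * p5 -
      1189 / 27 * hm - D.lam ^ 4 * (271 / 486 * D.sigma 5 - 1 / 243 * D.sigma 14 + 5 / 18 *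
      D.sigma 15) * h16
  · linear_combination 6 * p0 + 6 * p1 - 27 / 2 * p2 + 9 / 4 * p3 + 3 / 2 * p4 - 18 * p5 + 12 * hm - D.lam ^ 4 * (5
      / 12 * D.sigma 5 - 1 / 6 * D.sigma 14 + 1 / 6 * D.sigma 15) * h16
  · linear_combination -(18) * p0 - 36 * p1 + 18 * p5 + 36 * p6 - D.lam ^ 4 * (5 / 6 * D.sigma 14 - 5 / 6 * D.sigma
      15) * h16
  · linear_combination 2 * p0 - 4 * p1 + 2 * p4 - 14 * hm - D.lam ^ 4 * (-(8 / 9) * D.sigma 5 + 1 / 9 * D.sigma 14)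
      * h16
  · linear_combination 26 * p0 - 34 * p1 - 18 * p2 + 8 * p4 - 18 * p5 + 36 * p6 + 16 * hm - D.lam ^ 4 * (-(26 / 9)
      * D.sigma 5 + 7 / 9 * D.sigma 14 - 1 / 2 * D.sigma 15) * h16
  · linear_combination -(10) * p0 + 2 * p1 - 18 * p2 + 8 * p4 + 18 * p5 + 16 * hm - D.lam ^ 4 * (-(26 / 9) *
      D.sigma 5 - 1 / 18 * D.sigma 14 + 1 / 3 * D.sigma 15) * h16

theorem IsoEq.order4Sigmas_of_rotationInvariant {a : ℝ} (h : IsoEq D a 0) (hD : D.Stable)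
    (hr : D.RotationInvariantAtOrder 4) :
    D.Order4Sigmas ∧ (27 * a + 88 ≠ 0 → D.sigma 13 = D.sigma 5) := by
  obtain ⟨_, m, e, h4⟩ := D.act_four_of_rotationInvariant hr
  replace h4 := fun ξ W => (h4 ξ W).2
  have s4 : 0 < D.sigma 4 := hD.sigma_pos (by decide)
  have s5 : 0 < D.sigma 5 := hD.sigma_pos (by decide)
  have s10 : 0 < D.sigma 10 := hD.sigma_pos (by decide)
  obtain ⟨hm, h11, h12, h16, h17, h18⟩ := h.sigma_of_act_four s5 h4
  have h6 : (6 * D.sigma 5) ≠ 0 := by positivity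
  have r := h.relations_of_act_four h4 hm h11 h12 h16 (mul_left_cancel₀ h6 (h17.trans h16.symm))
    (mul_left_cancel₀ h6 (h18.trans h16.symm))
  have hl := (pow_pos D.lam_pos 4).ne'
  simp only [mul_eq_zero, hl, false_or] at r
  obtain ⟨r1, r2, -, r4, r5, r6⟩ := r
  have e15 : D.sigma 15 = D.sigma 14 := by
    -- The difference `r6 - r5` factors as `(σ₅ σ₁₀ + 1/3)(σ₁₅ - σ₁₄)`; stability makes the first
    -- factor positive.
    apply mul_left_cancel₀ (a := D.sigma 5 * D.sigma 10 + 1 / 3) (by positivity)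
    linear_combination r6 - r5
  rw [e15] at r1 r2 r5
  have e14 : D.sigma 14 = D.sigma 5 := by
    -- Once `σ₁₅ = σ₁₄`, the difference `r5 - r4` is `σ₅ σ₁₀ (σ₁₄ - σ₅)`.
    apply mul_left_cancel₀ (mul_pos s5 s10).ne'
    linear_combination r5 - r4
  rw [e14] at r1 r2 r4
  have p : D.sigma 5 * D.sigma 10 = 1 / 6 := by
    apply mul_left_cancel₀ s5.ne'
    linear_combination r4
  have e4 : D.sigma 4 = D.sigma 5 := by
    linear_combination 8 * r2 - 12 * D.sigma 4 * p
  rw [e4] at r1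
  have inv : ∀ t, 6 * D.sigma 5 * t = 1 → t = 1 / (6 * D.sigma 5) := fun t ht => by
    rw [eq_div_iff h6, mul_comm, ht]
  have e10 := inv (D.sigma 10) (by linear_combination 6 * p)
  refine ⟨⟨e4, e10, h11.trans e10, h12.trans e10, e14, e15.trans e14, inv _ h16, inv _ h17,
    inv _ h18⟩, fun ha => ?_⟩
  -- With all other parameters fixed, `r1` reduces to `(27a + 88)(σ₅ - σ₁₃)/324 = 0`.
  apply mul_left_cancel₀ ha
  linear_combination (-324) * r1 + (324 * a * D.sigma 5 + 270 * D.sigma 5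
    - (324 * a + 1056) * D.sigma 13) * p

theorem Order2Cond.sigma_five_eq_sigma_seven {a : ℝ} (h : D.Order2Cond a)
    (hr : D.RotationInvariantAtOrder 4) : D.sigma 5 = D.sigma 7 := by
  have hc := h.viscousEq.heat_coeff_of_rotationInvariant hr
  have h0 := h.2.1
  field_simp at hc
  linarith

theorem Order2Cond.order3CondA_of_rotationInvariant {a b : ℝ} (h : D.Order2Cond a)
    (h13 : D.EqRho 13 (b * D.lam ^ 4)) (h14 : D.meq 14 = 0) (h15 : D.meq 15 = 0)
    (hD : D.Stable) (hr : D.RotationInvariantAtOrder 4) : D.Order3CondA a := by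
  have h57 := h.sigma_five_eq_sigma_seven hr
  have hb := (h.isoEq h13 h14 h15 h57).eq_zero_of_rotationInvariant hr
    (hD.sigma_pos (by decide)) (hD.sigma_pos (by decide))
  rw [eq_neg_of_add_eq_zero_left hb] at h13
  exact ⟨h, h13, h14, h15, h57⟩

end LBM.D3Q19

/-! ### The theorem, assembled from the four orders -/

theorem mainTheorem4 (D : LBM.D3Q19) (a : ℝ) :
    -- order 1
    (D.RotationInvariantAtOrder 1 ↔ ∃ a' : ℝ, D.Order1Cond a') ∧
    (D.Order1Cond a → D.equivOp 1 = LBM.isoOp1 ((a + 30) / 57 * D.lam ^ 2)) ∧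
    -- order 2
    (D.Order2Cond a →
      D.RotationInvariantAtOrder 2 ∧
      ∃ μ ζ : ℝ,
        D.equivOp 2 = LBM.isoOp2 ((a + 30) / 57 * D.lam ^ 2) μ ζ ∧
        μ = D.sigma 5 * D.sigma 7 / (D.sigma 5 + 2 * D.sigma 7) * D.lam * D.dx ∧
        ζ = D.lam * D.dx / (57 * (D.sigma 5 + 2 * D.sigma 7)) *
          (27 * D.sigma 4 * D.sigma 5 + 19 * D.sigma 5 * D.sigma 7 - 22 * D.sigma 4 * D.sigma 7
            - a * D.sigma 4 * D.sigma 5 - 2 * a * D.sigma 4 * D.sigma 7)) ∧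
    -- order 3, first family
    (D.Order3CondA a →
      D.RotationInvariantAtOrder 3 ∧
      D.EqHeatFlux (-(2 / 3) * D.lam ^ 2) ∧
      ∃ μ ζ ξ χ : ℝ,
        D.equivOp 3 = LBM.isoOp3 ((a + 30) / 57 * D.lam ^ 2) μ ζ ξ χ ∧
        μ = 1 / 3 * D.sigma 5 * D.lam * D.dx ∧
        ζ = D.lam * D.dx / 171 * (5 * D.sigma 4 + 19 * D.sigma 5 - 3 * a * D.sigma 4) ∧
        ξ = D.dx ^ 2 / 684 * (a - 27) ∧
        χ = D.lam ^ 2 * D.dx ^ 2 / 19494 * (a + 30) *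
          (27 + 6 * a * D.sigma 4 ^ 2 - 10 * D.sigma 4 ^ 2 - 152 * D.sigma 5 ^ 2 - a) ∧
        3 * ζ - μ = D.lam * D.sigma 4 * D.dx / 57 * (5 - 3 * a)) ∧
    -- order 3, second family
    (∀ b : ℝ, D.Order3CondB a b →
      D.RotationInvariantAtOrder 3 ∧
      D.EqHeatFlux (-(2 / 3) * D.lam ^ 2) ∧
      ∃ μ ζ ξ χ : ℝ,
        D.equivOp 3 = LBM.isoOp3 ((a + 30) / 57 * D.lam ^ 2) μ ζ ξ χ ∧
        μ = 1 / 3 * D.sigma 5 * D.lam * D.dx ∧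
        ζ = D.lam * D.dx / 171 * (5 * D.sigma 4 + 19 * D.sigma 5 - 3 * a * D.sigma 4) ∧
        ξ = D.dx ^ 2 / 684 * (a - 27) ∧
        χ = D.lam ^ 2 * D.dx ^ 2 / (409374 * D.sigma 5) *
          (16212 * D.sigma 5 + 126 * a ^ 2 * D.sigma 4 ^ 2 * D.sigma 5
            + 3570 * a * D.sigma 4 ^ 2 * D.sigma 5 - 6300 * D.sigma 4 ^ 2 * D.sigma 5
            - 21 * D.sigma 5 * a ^ 2 - 234 * a * D.sigma 5
            + 361 * b * D.sigma 4 + 171 * a * D.sigma 4 + 798 * D.sigma 4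
            - 3192 * a * D.sigma 5 ^ 3 - 95760 * D.sigma 5 ^ 3 - 361 * b * D.sigma 5) ∧
        3 * ζ - μ = D.lam * D.sigma 4 * D.dx / 57 * (5 - 3 * a)) ∧
    -- order 4, sufficient conditions and coefficients
    (D.Order3CondA a → D.Order4Sigmas → D.sigma 13 = D.sigma 5 →
      D.RotationInvariantAtOrder 4 ∧
      ∃ μ ζ ξ χ η μ4 ζ4 : ℝ,
        D.equivOp 4 = LBM.isoOp4 ((a + 30) / 57 * D.lam ^ 2) μ ζ ξ χ η μ4 ζ4 ∧
        μ = 1 / 3 * D.sigma 5 * D.lam * D.dx ∧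
        ζ = D.lam * D.dx / 171 * (5 * D.sigma 4 + 19 * D.sigma 5 - 3 * a * D.sigma 4) ∧
        3 * ζ - μ = D.lam * D.sigma 4 * D.dx / 57 * (5 - 3 * a) ∧
        3 * ζ - μ = (5 - 3 * a) / 19 * μ ∧
        χ = D.lam ^ 2 * D.dx ^ 2 / 19494 * (a + 30) *
          (27 + 6 * a * D.sigma 4 ^ 2 - 10 * D.sigma 4 ^ 2 - 152 * D.sigma 5 ^ 2 - a) ∧
        ξ = (a - 27) / 684 * D.dx ^ 2 ∧
        η = (a + 30) * (a - 27) / 38988 * D.sigma 5 * D.lam * D.dx ^ 3 ∧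
        μ4 = (12 * D.sigma 5 ^ 2 - 1) / 108 * D.sigma 5 * D.lam * D.dx ^ 3 ∧
        ζ4 = D.sigma 5 * D.lam * D.dx ^ 3 / 38988 *
          (2062 + 45 * a - 4 * a ^ 2 - 5304 * D.sigma 5 ^ 2 - 612 * a * D.sigma 5 ^ 2
            + 24 * a ^ 2 * D.sigma 5 ^ 2)) ∧
    -- order 4, necessary conditions
    (∀ b : ℝ, D.Stable → D.Order2Cond a → D.EqRho 13 (b * D.lam ^ 4) →
      D.meq 14 = 0 → D.meq 15 = 0 → D.RotationInvariantAtOrder 4 →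
      D.Order3CondA a ∧ D.Order4Sigmas ∧ (27 * a + 88 ≠ 0 → D.sigma 13 = D.sigma 5)) := by
  refine ⟨⟨D.order1Cond_of_rotationInvariant, ?_⟩, fun h => h.equivOp, fun h => ⟨?_, ?_⟩,
    fun h => ⟨?_, h.isoEq.viscous.heat, ?_⟩, fun b h => ⟨?_, h.isoEq.viscous.heat, ?_⟩,
    fun h h4 h13 => ⟨?_, ?_⟩, fun b hD h h13 h14 h15 hr => ?_⟩
  · rintro ⟨a', h⟩
    rw [LBM.D3Q19.RotationInvariantAtOrder, h.equivOp]
    exact LBM.isRotationInvariantOp_isoOp4 ..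
  · rw [LBM.D3Q19.RotationInvariantAtOrder, h.equivOp]
    exact LBM.isRotationInvariantOp_isoOp4 ..
  · exact ⟨_, _, h.equivOp, rfl, rfl⟩
  · rw [LBM.D3Q19.RotationInvariantAtOrder, h.equivOp]
    exact LBM.isRotationInvariantOp_isoOp4 ..
  · exact ⟨_, _, _, _, h.equivOp, rfl, rfl, rfl, rfl, by ring⟩
  · rw [LBM.D3Q19.RotationInvariantAtOrder, h.equivOp]
    exact LBM.isRotationInvariantOp_isoOp4 ..
  · exact ⟨_, _, _, _, h.equivOp, rfl, rfl, rfl, rfl, by ring⟩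
  · rw [LBM.D3Q19.RotationInvariantAtOrder, h.equivOp_four h4 h13]
    exact LBM.isRotationInvariantOp_isoOp4 ..
  · exact ⟨_, _, _, _, _, _, _, h.equivOp_four h4 h13, rfl, rfl, by ring, by rw [h4.1]; ring, rfl,
      rfl, rfl, rfl, rfl⟩
  · have hA := h.order3CondA_of_rotationInvariant h13 h14 h15 hD hr
    exact ⟨hA, hA.isoEq.order4Sigmas_of_rotationInvariant hD hr⟩
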